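/- Let $m\ge 1$, $n,k\ge 0$ be integers and $M=m-2n$. Let $\mathcal P(\mathbb R^{m|2n})=\mathbb R[x_1,\dots,x_m]\otimes\Lambda(\theta_1,\dots,\theta_{2n})$, with $$\Delta=\sum_{j=1}^m\partial_{x_j}^2-4\sum_{j=1}^n\partial_{\theta_{2j-1}}\partial_{\theta_{2j}},\qquad R^2=\sum_{j=1}^m x_j^2-\sum_{j=1}^n\theta_{2j-1}\theta_{2j},\qquad \mathbb E=\sum_{j=1}^m x_j\partial_{x_j}+\sum_{j=1}^{2n}\theta_j\partial_{\theta_j}.$$ Put $\mathcal P_k=\{P\in\mathcal P\mid \mathbb E P=kP\}$, $\mathcal H_k=\mathcal H_k(\mathbb R^{m|2n})=\{P\in\mathcal P_k\mid\Delta P=0\}$ and $\tilde{\mathcal H}_k=\tilde{\mathcal H}_k(\mathbb R^{m|2n})=\{P\in\mathcal P_k\mid\Delta R^2\Delta P=0\}$. The real orthosymplectic Lie superalgebra $\mathfrak{osp}(m|2n)$ (which preserves $R^2$ and $\Delta$) acts naturally, by superderivations, on these spaces, and $\mathfrak{osp}(m-1|2n)\subset\mathfrak{osp}(m|2n)$ is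 the subalgebra acting on the variables $x_1,\dots,x_{m-1},\theta_1,\dots,\theta_{2n}$ only. Write $\underline{\mathcal H}_\ell=\mathcal H_\ell(\mathbb R^{m-1|2n})$ and $\underline{\tilde{\mathcal H}}_\ell=\tilde{\mathcal H}_\ell(\mathbb R^{m-1|2n})$. For an integer $N$ let $I_N=\{\ell\in\mathbb N_0\mid 2-N/2\le\ell\le 2-N\}$ if $N\in-2\mathbb N_0$, and $I_N=\emptyset$ otherwise. Put $$\tilde B_k=\{0,\dots,k\}\cap I_{M-1},\qquad B_k=\{0,\dots,k\}\setminus\bigl(\tilde B_k\cup\{3-M-\ell\mid\ell\in\tilde B_k\}\bigr).$$ Theorem 2. As $\mathbb Z/2$-graded $\mathfrak{osp}(m-1|2n)$-modules, $$\mathcal H_k(\mathbb R^{m|2n})\;\simeq\;\bigoplus_{\ell\in\tilde B_k}\underline{\tilde{\mathcal H}}_\ell\;\oplus\;\bigoplus_{\ell\in B_k}\underline{\mathcal H}_\ell ,$$ and every summand on the right is an indecomposable (in particular nonzero) $\mathfrak{osp}(m-1|2n)$-module, with the following exceptions, in which the summand is zero: $\underline{\tilde{\mathcal H}}_\ell$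 with $\ell\in\tilde B_k$ when $m=1$; $\underline{\mathcal H}_\ell$ with $\ell>n$ when $m=1$; $\underline{\mathcal H}_\ell$ with $\ell>2n+1$ when $m=2$. If $M-1\notin-2\mathbb N_0$, then $\tilde B_k=\emptyset$, $B_k=\{0,\dots,k\}$, and the decomposition reads $\mathcal H_k\simeq\bigoplus_{\ell=0}^k\underline{\mathcal H}_\ell$. -/

import Mathlib

open scoped TensorProduct DirectSum Kronecker

noncomputable section

namespace SuperHarmonic

/-- Indices of the coordinates `X = (x₁, …, x_m, θ₁, …, θ_{2n})` of `ℝ^{m|2n}`: `inl j` stands for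
the bosonic variable `x_{j+1}`, and `inr (j, 0)`, `inr (j, 1)` stand for the fermionic variables
`θ_{2j+1}`, `θ_{2j+2}` (with `j = 0, 1, …`). -/
abbrev Idx (m n : ℕ) : Type := Fin m ⊕ (Fin n × Fin 2)

/-- Superpolynomials `𝒫(ℝ^{m|2n}) = ℝ[x₁, …, x_m] ⊗ Λ(θ₁, …, θ_{2n})`. -/
def SuperPoly (m n : ℕ) : Type :=
  MvPolynomial (Fin m) ℝ ⊗[ℝ] ExteriorAlgebra ℝ (Fin n × Fin 2 → ℝ)

instance (m n : ℕ) : AddCommGroup (SuperPoly m n) :=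
  inferInstanceAs (AddCommGroup
    (MvPolynomial (Fin m) ℝ ⊗[ℝ] ExteriorAlgebra ℝ (Fin n × Fin 2 → ℝ)))

instance (m n : ℕ) : Module ℝ (SuperPoly m n) :=
  inferInstanceAs (Module ℝ
    (MvPolynomial (Fin m) ℝ ⊗[ℝ] ExteriorAlgebra ℝ (Fin n × Fin 2 → ℝ)))

/-- The superdimension `M = m - 2n`. -/
def superdim (m n : ℕ) : ℤ := (m : ℤ) - 2 * (n : ℤ)

/-- The parity of a coordinate: `0` for `x_j`, `1` for `θ_j`. -/
def par {m n : ℕ} : Idx m n → ℕ := Sum.elim (fun _ => 0) (fun _ => 1)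

/-- The operator `f ⊗ 1` on superpolynomials, for an operator `f` on `ℝ[x₁, …, x_m]`. -/
def onX {m n : ℕ} (f : Module.End ℝ (MvPolynomial (Fin m) ℝ)) : Module.End ℝ (SuperPoly m n) :=
  LinearMap.rTensor (ExteriorAlgebra ℝ (Fin n × Fin 2 → ℝ)) f

/-- The operator `1 ⊗ f` on superpolynomials, for an operator `f` on `Λ(θ₁, …, θ_{2n})`. -/
def onTheta {m n : ℕ} (f : Module.End ℝ (ExteriorAlgebra ℝ (Fin n × Fin 2 → ℝ))) :
    Module.End ℝ (SuperPoly m n) :=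
  LinearMap.lTensor (MvPolynomial (Fin m) ℝ) f

/-- The Grassmann generator `θ_t`. -/
def theta {n : ℕ} (t : Fin n × Fin 2) : ExteriorAlgebra ℝ (Fin n × Fin 2 → ℝ) :=
  ExteriorAlgebra.ι ℝ (Pi.single t 1)

/-- The partial derivative `∂_{θ_t}` on the Grassmann algebra: contraction (from the left) with the
`t`-th coordinate functional, i.e. the odd derivation with `∂_{θ_t} θ_s = δ_{ts}`. -/
def dTheta {n : ℕ} (t : Fin n × Fin 2) : Module.End ℝ (ExteriorAlgebra ℝ (Fin n × Fin 2 → ℝ)) :=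
  CliffordAlgebra.contractLeft (LinearMap.proj t)

/-- Multiplication from the left by the coordinate `X_i`. -/
def X {m n : ℕ} : Idx m n → Module.End ℝ (SuperPoly m n)
  | Sum.inl j => onX (LinearMap.mulLeft ℝ (MvPolynomial.X j))
  | Sum.inr t => onTheta (LinearMap.mulLeft ℝ (theta t))

/-- The (left) partial derivative `∂_{X_i}`. -/
def D {m n : ℕ} : Idx m n → Module.End ℝ (SuperPoly m n)
  | Sum.inl j => onX (MvPolynomial.pderiv j).toLinearMap
  | Sum.inr t => onTheta (dTheta t)

/-- The super Laplacian `Δ = ∑ ∂_{x_j}² - 4 ∑ ∂_{θ_{2j-1}} ∂_{θ_{2j}}`. -/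
def lap (m n : ℕ) : Module.End ℝ (SuperPoly m n) :=
  ∑ j : Fin m, D (Sum.inl j) * D (Sum.inl j)
    - (4 : ℝ) • ∑ j : Fin n, D (Sum.inr (j, 0)) * D (Sum.inr (j, 1))

/-- Multiplication by `R² = ∑ x_j² - ∑ θ_{2j-1} θ_{2j}`. -/
def Rsq (m n : ℕ) : Module.End ℝ (SuperPoly m n) :=
  ∑ j : Fin m, X (Sum.inl j) * X (Sum.inl j)
    - ∑ j : Fin n, X (Sum.inr (j, 0)) * X (Sum.inr (j, 1))

/-- The super Euler operator `𝔼 = ∑ X_i ∂_{X_i}`. -/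
def euler (m n : ℕ) : Module.End ℝ (SuperPoly m n) := ∑ i : Idx m n, X i * D i

/-- The parity involution of `𝒫(ℝ^{m|2n})`: it is `1` on even and `-1` on odd superpolynomials. -/
def parity (m n : ℕ) : Module.End ℝ (SuperPoly m n) :=
  onTheta (CliffordAlgebra.involute (R := ℝ) (M := Fin n × Fin 2 → ℝ) (Q := 0)).toLinearMap

/-- The `k`-homogeneous superpolynomials `𝒫_k = {P | 𝔼 P = k P}`. -/
def Homog (m n k : ℕ) : Submodule ℝ (SuperPoly m n) :=
  Module.End.eigenspace (euler m n) (k : ℝ)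

/-- The `k`-homogeneous spherical harmonics `ℋ_k = Ker_k Δ`. -/
def Harm (m n k : ℕ) : Submodule ℝ (SuperPoly m n) :=
  Homog m n k ⊓ LinearMap.ker (lap m n)

/-- The `k`-homogeneous generalized spherical harmonics `ℋ̃_k = Ker_k (Δ R² Δ)`. -/
def GenHarm (m n k : ℕ) : Submodule ℝ (SuperPoly m n) :=
  Homog m n k ⊓ LinearMap.ker (lap m n * Rsq m n * lap m n)

/-- The matrix `(g^{ij})`, block diagonal with blocks `E_m` and `J_{2n}`; thus
`R² = ∑ X_i g^{ij} X_j`. -/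
def gUp (m n : ℕ) : Matrix (Idx m n) (Idx m n) ℝ :=
  Matrix.fromBlocks 1 0 0 ((1 : Matrix (Fin n) (Fin n) ℝ) ⊗ₖ !![0, -1/2; 1/2, 0])

/-- The inverse matrix `(g_{ij})` of `(g^{ij})`: the Gram matrix `g_{ij} = g(X_i, X_j)` of the
scalar superproduct on the superspace `V` spanned by the coordinates `X_i`, for which the element
`∑ X_i g^{ij} X_j` of the supersymmetric algebra of `V` is the square norm `R²`. -/
def gLow (m n : ℕ) : Matrix (Idx m n) (Idx m n) ℝ :=
  Matrix.fromBlocks 1 0 0 ((1 : Matrix (Fin n) (Fin n) ℝ) ⊗ₖ !![0, 2; -2, 0])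

theorem gUp_mul_gLow (m n : ℕ) : gUp m n * gLow m n = 1 := by
  have h : (!![0, -1/2; 1/2, 0] : Matrix (Fin 2) (Fin 2) ℝ) * !![0, 2; -2, 0] = 1 := by
    ext i j; fin_cases i <;> fin_cases j <;> simp [Matrix.mul_apply, Fin.sum_univ_two]
  rw [gUp, gLow, Matrix.fromBlocks_multiply, ← Matrix.mul_kronecker_mul, h]
  simp [Matrix.fromBlocks_one]

/-- The orthosymplectic Lie superalgebra `𝔬𝔰𝔭(m|2n) = 𝔬𝔰𝔭(V, g)`, as a space of (super)matrices
`A`, where `A X_j = ∑ A_{ij} X_i`. The defining condition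
`g(A v, w) + (-1)^{|A||v|} g(v, A w) = 0` is written out for `v = X_i`, `w = X_j`; the matrix entry
in row `k` and column `j` has parity `|k| + |j|`, so that even and odd parts of `A` satisfy the
condition separately. -/
def osp (m n : ℕ) : Submodule ℝ (Matrix (Idx m n) (Idx m n) ℝ) where
  carrier := {A | ∀ i j, ∑ k, A k i * gLow m n k j
      + ∑ k, (-1) ^ ((par k + par j) * par i) * gLow m n i k * A k j = 0}
  zero_mem' := by intro i j; simp
  add_mem' := by
    intro A B hA hB i j
    have h := congrArg₂ (· + ·) (hA i j) (hB i j)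
    simp only [add_zero] at h
    rw [← h]
    simp only [Matrix.add_apply, add_mul, mul_add, Finset.sum_add_distrib]
    ring
  smul_mem' := by
    intro c A hA i j
    have h := congrArg (c * ·) (hA i j)
    simp only [mul_zero, mul_add, Finset.mul_sum] at h
    rw [← h]
    simp only [Matrix.smul_apply, smul_eq_mul]
    congr 1 <;> exact Finset.sum_congr rfl fun k _ => by ring

/-- The natural action on superpolynomials: `A` acts as the superderivation
`∑ A_{ij} X_i ∂_{X_j}`, which extends `X_j ↦ ∑ A_{ij} X_i`. -/
def act {m n : ℕ} (A : Matrix (Idx m n) (Idx m n) ℝ) : Module.End ℝ (SuperPoly m n) :=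
  ∑ i, ∑ j, A i j • (X i * D j)

/-- The sign in the supercommutation rules. -/
def sg {m n : ℕ} (i j : Idx m n) : ℝ := (-1) ^ (par i * par j)

section

variable {m n : ℕ} (f g : Module.End ℝ (MvPolynomial (Fin m) ℝ))
  (u v : Module.End ℝ (ExteriorAlgebra ℝ (Fin n × Fin 2 → ℝ))) (c : ℝ)

theorem onX_mul : (onX (f * g) : Module.End ℝ (SuperPoly m n)) = onX f * onX g :=
  LinearMap.rTensor_mul _ f g

theorem onX_add : (onX (f + g) : Module.End ℝ (SuperPoly m n)) = onX f + onX g :=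
  LinearMap.rTensor_add _ f g

theorem onX_smul : (onX (c • f) : Module.End ℝ (SuperPoly m n)) = c • onX f :=
  LinearMap.rTensor_smul _ c f

theorem onX_one : (onX 1 : Module.End ℝ (SuperPoly m n)) = 1 :=
  LinearMap.rTensor_id _ _

theorem onTheta_mul : (onTheta (u * v) : Module.End ℝ (SuperPoly m n)) = onTheta u * onTheta v :=
  LinearMap.lTensor_mul _ u v

theorem onTheta_add : (onTheta (u + v) : Module.End ℝ (SuperPoly m n)) = onTheta u + onTheta v :=
  LinearMap.lTensor_add _ u v

theorem onTheta_smul : (onTheta (c • u) : Module.End ℝ (SuperPoly m n)) = c • onTheta u :=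
  LinearMap.lTensor_smul _ c u

theorem onTheta_one : (onTheta 1 : Module.End ℝ (SuperPoly m n)) = 1 :=
  LinearMap.lTensor_id _ _

theorem onX_onTheta :
    (onX f * onTheta u : Module.End ℝ (SuperPoly m n)) = onTheta u * onX f :=
  (LinearMap.rTensor_comp_lTensor _ _ _).trans (LinearMap.lTensor_comp_rTensor _ _ _).symm

theorem theta_mul_theta (s t : Fin n × Fin 2) : theta s * theta t = - (theta t * theta s) := by
  have h := CliffordAlgebra.ι_mul_ι_add_swap (Q := (0 : QuadraticForm ℝ (Fin n × Fin 2 → ℝ)))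
    (Pi.single s 1) (Pi.single t 1)
  rw [eq_neg_iff_add_eq_zero]
  exact h.trans (by simp [QuadraticMap.polar])

theorem dTheta_theta_mul (s t : Fin n × Fin 2) (w : ExteriorAlgebra ℝ (Fin n × Fin 2 → ℝ)) :
    dTheta s (theta t * w) = (if s = t then 1 else 0 : ℝ) • w - theta t * dTheta s w := by
  rw [dTheta, theta, CliffordAlgebra.contractLeft_ι_mul]
  simp [Pi.single_apply]

end

theorem X_mul_X {m n : ℕ} (i j : Idx m n) :
    (X i * X j : Module.End ℝ (SuperPoly m n)) = sg i j • (X j * X i) := by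
  rcases i with i | i <;> rcases j with j | j <;>
    simp only [X, sg, par, Sum.elim_inl, Sum.elim_inr, pow_zero, mul_zero, one_smul, pow_one,
      mul_one, onX_onTheta]
  · rw [← onX_mul, ← onX_mul]
    congr 1; ext f; simp [mul_left_comm]
  · rw [← onTheta_mul, ← onTheta_mul, ← onTheta_smul]
    congr 1
    refine LinearMap.ext fun f => ?_
    simp [← mul_assoc, theta_mul_theta i j]

theorem D_mul_D {m n : ℕ} (i j : Idx m n) :
    (D i * D j : Module.End ℝ (SuperPoly m n)) = sg i j • (D j * D i) := by
  rcases i with i | i <;> rcases j with j | j <;>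
    simp only [D, sg, par, Sum.elim_inl, Sum.elim_inr, pow_zero, mul_zero, one_smul, pow_one,
      mul_one, onX_onTheta]
  · rw [← onX_mul, ← onX_mul]
    congr 1
    have h : ⁅(MvPolynomial.pderiv i :
          Derivation ℝ (MvPolynomial (Fin m) ℝ) (MvPolynomial (Fin m) ℝ)),
        (MvPolynomial.pderiv j :
          Derivation ℝ (MvPolynomial (Fin m) ℝ) (MvPolynomial (Fin m) ℝ))⁆ = 0 := by
      refine MvPolynomial.derivation_ext (R := ℝ) ?_
      intro k
      classical
      simp only [Derivation.commutator_apply, MvPolynomial.pderiv_X, Derivation.zero_apply,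
        Pi.single_apply]
      split_ifs <;> simp
    refine LinearMap.ext fun f => ?_
    have := congrArg (fun d => d f) h
    simpa [Derivation.commutator_apply, sub_eq_zero] using this
  · rw [← onTheta_mul, ← onTheta_mul, ← onTheta_smul]
    congr 1
    refine LinearMap.ext fun f => ?_
    rw [LinearMap.smul_apply, neg_one_smul]
    exact CliffordAlgebra.contractLeft_comm _ _ _

theorem D_mul_X {m n : ℕ} (i j : Idx m n) :
    (D i * X j : Module.End ℝ (SuperPoly m n))
      = sg i j • (X j * D i) + (if i = j then 1 else 0 : ℝ) • 1 := by
  rcases i with i | i <;> rcases j with j | j <;>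
    simp only [D, X, sg, par, Sum.elim_inl, Sum.elim_inr, pow_zero, mul_zero, one_smul, pow_one,
      mul_one, Sum.inl.injEq, Sum.inr.injEq, reduceCtorEq, if_false, zero_smul, add_zero,
      onX_onTheta]
  · rw [← onX_mul, ← onX_mul, ← onX_one, ← onX_smul, ← onX_add]
    congr 1
    refine LinearMap.ext fun f => ?_
    classical
    simp only [Module.End.mul_apply, LinearMap.mulLeft_apply, Derivation.coeFn_coe,
      MvPolynomial.pderiv_mul, MvPolynomial.pderiv_X, LinearMap.add_apply,
      LinearMap.smul_apply, Module.End.one_apply, Pi.single_apply, eq_comm (a := j)]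
    split_ifs <;> simp [add_comm]
  · rw [← onTheta_mul, ← onTheta_mul, ← onTheta_one, ← onTheta_smul, ← onTheta_smul,
      ← onTheta_add]
    congr 1
    refine LinearMap.ext fun f => ?_
    simp only [Module.End.mul_apply, LinearMap.mulLeft_apply, dTheta_theta_mul,
      LinearMap.add_apply, LinearMap.smul_apply, neg_one_smul, Module.End.one_apply]
    rw [sub_eq_neg_add]

theorem sg_comm {m n : ℕ} (i j : Idx m n) : sg i j = sg j i := by
  rw [sg, sg, mul_comm]

theorem sg_mul_self {m n : ℕ} (i j : Idx m n) : sg i j * sg i j = 1 := by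
  rw [sg, ← mul_pow]; norm_num

theorem gLow_sg {m n : ℕ} (i j a : Idx m n) : gLow m n i j * (sg i a * sg j a) = gLow m n i j := by
  rcases i with i | i <;> rcases j with j | j <;> rcases a with a | a <;> simp [gLow, sg, par]

theorem gLow_swap {m n : ℕ} (i a : Idx m n) : gLow m n i a * sg i a = gLow m n a i := by
  rcases i with i | ⟨i, s⟩ <;> rcases a with a | ⟨a, t⟩ <;>
    simp [gLow, sg, par, Matrix.one_apply, eq_comm (a := i)]
  fin_cases s <;> fin_cases t <;> simp <;> split_ifs <;> norm_num

theorem gUp_sg {m n : ℕ} (i j a : Idx m n) : gUp m n i j * (sg i a * sg j a) = gUp m n i j := by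
  rcases i with i | i <;> rcases j with j | j <;> rcases a with a | a <;> simp [gUp, sg, par]

theorem gUp_swap {m n : ℕ} (i a : Idx m n) : gUp m n i a * sg i a = gUp m n a i := by
  rcases i with i | ⟨i, s⟩ <;> rcases a with a | ⟨a, t⟩ <;>
    simp [gUp, sg, par, Matrix.one_apply, eq_comm (a := i)]
  fin_cases s <;> fin_cases t <;> simp <;> split_ifs <;> norm_num

theorem lap_eq (m n : ℕ) : lap m n = ∑ i, ∑ j, gLow m n i j • (D j * D i) := by
  have h : ∀ j : Fin n, (D (Sum.inr (j, 1)) * D (Sum.inr (j, 0)) : Module.End ℝ (SuperPoly m n))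
      = (-1 : ℝ) • (D (Sum.inr (j, 0)) * D (Sum.inr (j, 1))) := fun j => by
    rw [D_mul_D]; simp [sg, par]
  simp only [lap, Fintype.sum_sum_type, Fintype.sum_prod_type, Fin.sum_univ_two, gLow,
    Matrix.fromBlocks_apply₁₁, Matrix.fromBlocks_apply₁₂, Matrix.fromBlocks_apply₂₁,
    Matrix.fromBlocks_apply₂₂, Matrix.zero_apply, Matrix.one_apply, Matrix.kroneckerMap_apply]
  simp [h, Finset.sum_add_distrib, ite_smul]
  rw [sub_eq_add_neg, ← Finset.smul_sum]
  module


theorem Rsq_eq (m n : ℕ) : Rsq m n = ∑ i, ∑ j, gUp m n i j • (X i * X j) := by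
  have h : ∀ j : Fin n, (X (Sum.inr (j, 1)) * X (Sum.inr (j, 0)) : Module.End ℝ (SuperPoly m n))
      = (-1 : ℝ) • (X (Sum.inr (j, 0)) * X (Sum.inr (j, 1))) := fun j => by
    rw [X_mul_X]; simp [sg, par]
  simp only [Rsq, Fintype.sum_sum_type, Fintype.sum_prod_type, Fin.sum_univ_two, gUp,
    Matrix.fromBlocks_apply₁₁, Matrix.fromBlocks_apply₁₂, Matrix.fromBlocks_apply₂₁,
    Matrix.fromBlocks_apply₂₂, Matrix.zero_apply, Matrix.one_apply, Matrix.kroneckerMap_apply]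
  simp [h, Finset.sum_add_distrib, ite_smul]
  rw [sub_eq_add_neg, ← Finset.smul_sum, ← Finset.smul_sum]
  module

theorem lap_mul_X {m n : ℕ} (a : Idx m n) :
    lap m n * X a = X a * lap m n + (2 : ℝ) • ∑ j, gLow m n a j • D j := by
  have key : ∀ i j : Idx m n, gLow m n i j • (D j * D i) * X a
      = X a * (gLow m n i j • (D j * D i)) + (if j = a then gLow m n a i else 0 : ℝ) • D i
        + (if i = a then gLow m n a j else 0 : ℝ) • D j := by
    intro i j
    rw [smul_mul_assoc, mul_assoc, D_mul_X, mul_add, mul_smul_comm, ← mul_assoc (D j), D_mul_X,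
      add_mul, smul_mul_assoc, smul_add, smul_add, smul_add, smul_smul, smul_smul, smul_smul,
      mul_smul_comm, mul_assoc, mul_one, smul_mul_assoc, one_mul, smul_smul, smul_smul, 
      mul_assoc (gLow m n i j), gLow_sg, mul_smul_comm]
    congr 2
    · congr 1
      split_ifs with h
      · rw [h, mul_one, gLow_swap]
      · simp
    · split_ifs with h
      · rw [h, mul_one]
      · simp
  rw [lap_eq]
  simp only [Finset.sum_mul, Finset.mul_sum, key, Finset.sum_add_distrib]
  rw [add_assoc]
  congr 1
  rw [two_smul]
  congr 1
  · simp [ite_smul]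
  · rw [Finset.sum_comm]
    simp [ite_smul]

theorem D_mul_Rsq {m n : ℕ} (b : Idx m n) :
    D b * Rsq m n = Rsq m n * D b + (2 : ℝ) • ∑ j, gUp m n b j • X j := by
  have key : ∀ i j : Idx m n, D b * (gUp m n i j • (X i * X j))
      = (gUp m n i j • (X i * X j)) * D b + (if b = i then gUp m n b j else 0 : ℝ) • X j
        + (if b = j then gUp m n b i else 0 : ℝ) • X i := by
    intro i j
    rw [mul_smul_comm, ← mul_assoc, D_mul_X, add_mul, smul_mul_assoc, mul_assoc, D_mul_X,
      mul_add, mul_smul_comm, smul_add, smul_add, smul_add, smul_smul, smul_smul, smul_smul,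
      mul_smul_comm, ← mul_assoc, mul_one, smul_mul_assoc, one_mul, smul_smul, smul_smul,
      sg_comm b i, sg_comm b j, mul_assoc (gUp m n i j), gUp_sg, smul_mul_assoc, add_assoc, add_assoc]
    congr 1
    rw [add_comm]
    congr 2
    · split_ifs with h
      · rw [h, mul_one]
      · simp
    · split_ifs with h
      · rw [h, mul_one, gUp_swap]
      · simp
  rw [Rsq_eq]
  simp only [Finset.sum_mul, Finset.mul_sum, key, Finset.sum_add_distrib]
  rw [add_assoc]
  congr 1
  rw [two_smul]
  congr 1
  · rw [Finset.sum_comm]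
    simp [ite_smul]
  · simp [ite_smul]

theorem lap_mul_D {m n : ℕ} (b : Idx m n) : lap m n * D b = D b * lap m n := by
  rw [lap_eq]
  simp only [Finset.sum_mul, Finset.mul_sum]
  refine Finset.sum_congr rfl fun i _ => Finset.sum_congr rfl fun j _ => ?_
  rw [smul_mul_assoc, mul_assoc, D_mul_D i b, mul_smul_comm, ← mul_assoc, D_mul_D j b,
    smul_mul_assoc, smul_smul, smul_smul, mul_assoc (gLow m n i j), gLow_sg, mul_smul_comm,
    mul_assoc]

theorem Rsq_mul_X {m n : ℕ} (b : Idx m n) : Rsq m n * X b = X b * Rsq m n := by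
  rw [Rsq_eq]
  simp only [Finset.sum_mul, Finset.mul_sum]
  refine Finset.sum_congr rfl fun i _ => Finset.sum_congr rfl fun j _ => ?_
  rw [smul_mul_assoc, mul_assoc, X_mul_X j b, mul_smul_comm, ← mul_assoc, X_mul_X i b,
    smul_mul_assoc, smul_smul, smul_smul, mul_assoc (gUp m n i j), mul_comm (sg j b), gUp_sg,
    mul_smul_comm, mul_assoc]

theorem euler_mul_X {m n : ℕ} (a : Idx m n) : euler m n * X a = X a * euler m n + X a := by
  have key : ∀ i : Idx m n, X i * D i * X a
      = X a * (X i * D i) + (if i = a then 1 else 0 : ℝ) • X i := by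
    intro i
    rw [mul_assoc, D_mul_X, mul_add, mul_smul_comm, mul_smul_comm, mul_one, ← mul_assoc,
      X_mul_X i a, smul_mul_assoc, smul_smul, sg_mul_self, one_smul, mul_assoc]
  simp only [euler, Finset.sum_mul, Finset.mul_sum, key, Finset.sum_add_distrib]
  simp [ite_smul]

theorem D_mul_euler {m n : ℕ} (b : Idx m n) : D b * euler m n = euler m n * D b + D b := by
  have key : ∀ i : Idx m n, D b * (X i * D i)
      = X i * D i * D b + (if b = i then 1 else 0 : ℝ) • D i := by
    intro i
    rw [← mul_assoc, D_mul_X, add_mul, smul_mul_assoc, smul_mul_assoc, one_mul, mul_assoc,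
      D_mul_D b i, mul_smul_comm, smul_smul, sg_mul_self, one_smul, mul_assoc]
  simp only [euler, Finset.sum_mul, Finset.mul_sum, key, Finset.sum_add_distrib]
  simp [ite_smul]

theorem osp_antisymm {m n : ℕ} {A : Matrix (Idx m n) (Idx m n) ℝ} (hA : A ∈ osp m n)
    (i j : Idx m n) : (A.transpose * gLow m n) i j = - (sg i j * (A.transpose * gLow m n) j i) := by
  have h := hA i j
  have h2 : ∀ k : Idx m n, (-1 : ℝ) ^ ((par k + par j) * par i) * gLow m n i k
      = sg i j * gLow m n k i := by
    intro k
    rw [← gLow_swap i k, sg, sg]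
    rcases i with i | i <;> rcases j with j | j <;> rcases k with k | k <;> simp [gLow, par]
  simp only [h2] at h
  rw [Matrix.mul_apply, Matrix.mul_apply, Finset.mul_sum, eq_neg_iff_add_eq_zero, ← h]
  simp only [Matrix.transpose_apply]
  congr 1
  exact Finset.sum_congr rfl fun k _ => by ring

theorem sum_eq_zero_of_antisymm {ι V : Type*} [Fintype ι] [AddCommGroup V] [Module ℝ V]
    (f : ι → ι → V) (h : ∀ i j, f i j = - f j i) : ∑ i, ∑ j, f i j = 0 := by
  have h1 : ∑ i, ∑ j, f i j = - ∑ i, ∑ j, f i j := by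
    conv_lhs => rw [Finset.sum_comm]
    simp only [← Finset.sum_neg_distrib]
    exact Finset.sum_congr rfl fun i _ => Finset.sum_congr rfl fun j _ => h j i
  have h2 : (2 : ℝ) • ∑ i, ∑ j, f i j = 0 := by
    rw [two_smul]; nth_rewrite 1 [h1]; simp
  simpa using h2

theorem lap_act {m n : ℕ} {A : Matrix (Idx m n) (Idx m n) ℝ} (hA : A ∈ osp m n) :
    Commute (lap m n) (act A) := by
  have key : ∀ a b : Idx m n, lap m n * (A a b • (X a * D b)) = (A a b • (X a * D b)) * lap m n
      + (2 : ℝ) • ∑ j, (A a b * gLow m n a j) • (D j * D b) := by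
    intro a b
    rw [mul_smul_comm, ← mul_assoc, lap_mul_X, add_mul, mul_assoc, lap_mul_D, smul_add,
      smul_mul_assoc, smul_mul_assoc, mul_assoc, smul_comm (A a b) (2 : ℝ), Finset.sum_mul,
      Finset.smul_sum]
    congr 2
    exact Finset.sum_congr rfl fun j _ => by rw [smul_mul_assoc, smul_smul]
  rw [Commute, SemiconjBy, act]
  simp only [Finset.sum_mul, Finset.mul_sum, key, Finset.sum_add_distrib]
  rw [add_eq_left]
  simp only [← Finset.smul_sum]
  rw [Finset.sum_comm]
  have : ∀ b : Idx m n, ∑ a, ∑ j, (A a b * gLow m n a j) • (D j * D b : Module.End ℝ (SuperPoly m n))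
      = ∑ j, (A.transpose * gLow m n) b j • (D j * D b) := by
    intro b
    rw [Finset.sum_comm]
    refine Finset.sum_congr rfl fun j _ => ?_
    rw [Matrix.mul_apply, Finset.sum_smul]
    rfl
  simp only [this]
  rw [sum_eq_zero_of_antisymm, smul_zero]
  intro i j
  rw [osp_antisymm hA i j, D_mul_D j i, neg_smul, smul_smul, mul_assoc, mul_comm _ (sg j i),
    ← mul_assoc, sg_comm j i, sg_mul_self, one_mul]

theorem gUp_par {m n : ℕ} (b a c : Idx m n) : gUp m n b a * sg b c = gUp m n b a * sg a c := by
  rcases b with b | b <;> rcases a with a | a <;> simp [gUp, sg, par]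

theorem osp_antisymm' {m n : ℕ} {A : Matrix (Idx m n) (Idx m n) ℝ} (hA : A ∈ osp m n)
    (a j : Idx m n) : (A * gUp m n) a j = - (sg a j * (A * gUp m n) j a) := by
  have hg : gLow m n * gUp m n = 1 := mul_eq_one_comm.mp (gUp_mul_gLow m n)
  have hA' : A * gUp m n
      = (gUp m n).transpose * ((A.transpose * gLow m n).transpose * gUp m n) := by
    rw [← Matrix.mul_assoc, ← Matrix.transpose_mul, Matrix.mul_assoc, hg, Matrix.mul_one,
      Matrix.transpose_transpose]
  rw [hA']
  simp only [Matrix.mul_apply (M := (gUp m n).transpose),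
    Matrix.mul_apply (M := (A.transpose * gLow m n).transpose), Matrix.transpose_apply,
    Finset.mul_sum, ← Finset.sum_neg_distrib]
  rw [Finset.sum_comm]
  refine Finset.sum_congr rfl fun c _ => Finset.sum_congr rfl fun b _ => ?_
  rw [osp_antisymm hA c b]
  have h1 := gUp_par c j b
  have h2 := gUp_par b a j
  rw [sg_comm b j] at h2
  linear_combination (-(gUp m n b a * (A.transpose * gLow m n) b c)) * h1
    - gUp m n c j * (A.transpose * gLow m n) b c * h2

theorem Rsq_act {m n : ℕ} {A : Matrix (Idx m n) (Idx m n) ℝ} (hA : A ∈ osp m n) :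
    Commute (Rsq m n) (act A) := by
  have key : ∀ a b : Idx m n, (A a b • (X a * D b)) * Rsq m n = Rsq m n * (A a b • (X a * D b))
      + (2 : ℝ) • ∑ j, (A a b * gUp m n b j) • (X a * X j) := by
    intro a b
    rw [smul_mul_assoc, mul_assoc, D_mul_Rsq, mul_add, ← mul_assoc, ← Rsq_mul_X, smul_add,
      mul_smul_comm, mul_smul_comm, mul_assoc, smul_comm (A a b) (2 : ℝ), Finset.mul_sum,
      Finset.smul_sum]
    congr 2
    exact Finset.sum_congr rfl fun j _ => by rw [mul_smul_comm, smul_smul]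
  refine Commute.symm ?_
  rw [Commute, SemiconjBy, act]
  simp only [Finset.sum_mul, Finset.mul_sum, key, Finset.sum_add_distrib]
  rw [add_eq_left]
  simp only [← Finset.smul_sum]
  have : ∀ a : Idx m n, ∑ b, ∑ j, (A a b * gUp m n b j) • (X a * X j : Module.End ℝ (SuperPoly m n))
      = ∑ j, (A * gUp m n) a j • (X a * X j) := by
    intro a
    rw [Finset.sum_comm]
    refine Finset.sum_congr rfl fun j _ => ?_
    rw [Matrix.mul_apply, Finset.sum_smul]
  simp only [this]
  rw [sum_eq_zero_of_antisymm, smul_zero]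
  intro i j
  rw [osp_antisymm' hA i j, X_mul_X i j, neg_smul, smul_smul, mul_assoc, mul_comm _ (sg i j),
    ← mul_assoc, sg_mul_self, one_mul]

theorem euler_act {m n : ℕ} (A : Matrix (Idx m n) (Idx m n) ℝ) :
    Commute (euler m n) (act A) := by
  have key : ∀ a b : Idx m n, euler m n * (X a * D b) = (X a * D b) * euler m n := by
    intro a b
    rw [← mul_assoc, euler_mul_X, mul_assoc, D_mul_euler, add_mul, mul_add, mul_assoc]
  rw [Commute, SemiconjBy, act]
  simp only [Finset.sum_mul, Finset.mul_sum, mul_smul_comm, smul_mul_assoc, key]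

theorem involute_dTheta {n : ℕ} (t : Fin n × Fin 2) (w : ExteriorAlgebra ℝ (Fin n × Fin 2 → ℝ)) :
    CliffordAlgebra.involute (dTheta t w) = - dTheta t (CliffordAlgebra.involute w) := by
  induction w using CliffordAlgebra.left_induction with
  | algebraMap r => simp [dTheta]
  | add x y hx hy => simp only [map_add, hx, hy, neg_add]
  | ι_mul x a hx =>
    simp only [dTheta] at hx ⊢
    simp only [CliffordAlgebra.contractLeft_ι_mul, map_sub, map_smul, map_mul,
      CliffordAlgebra.involute_ι, hx, neg_mul, map_neg]
    simp

theorem parity_X {m n : ℕ} (i : Idx m n) :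
    parity m n * X i = ((-1 : ℝ) ^ par i) • (X i * parity m n) := by
  rcases i with i | i <;>
    simp only [parity, X, par, Sum.elim_inl, Sum.elim_inr, pow_zero, one_smul, pow_one, onX_onTheta]
  rw [← onTheta_mul, ← onTheta_mul, ← onTheta_smul]
  congr 1
  refine LinearMap.ext fun f => ?_
  simp [theta]

theorem parity_D {m n : ℕ} (i : Idx m n) :
    parity m n * D i = ((-1 : ℝ) ^ par i) • (D i * parity m n) := by
  rcases i with i | i <;>
    simp only [parity, D, par, Sum.elim_inl, Sum.elim_inr, pow_zero, one_smul, pow_one, onX_onTheta]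
  rw [← onTheta_mul, ← onTheta_mul, ← onTheta_smul]
  congr 1
  refine LinearMap.ext fun f => ?_
  simp [involute_dTheta]

theorem parity_lap (m n : ℕ) : Commute (lap m n) (parity m n) := by
  refine Commute.symm ?_
  have h : ∀ i j : Idx m n, par i = par j → parity m n * (D i * D j) = (D i * D j) * parity m n := by
    intro i j hij
    rw [← mul_assoc, parity_D, smul_mul_assoc, mul_assoc, parity_D, mul_smul_comm, smul_smul, hij,
      ← mul_pow, mul_assoc]
    norm_num
  rw [Commute, SemiconjBy, lap, mul_sub, sub_mul, mul_smul_comm, smul_mul_assoc]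
  simp only [Finset.mul_sum, Finset.sum_mul]
  congr 1
  · exact Finset.sum_congr rfl fun j _ => h _ _ rfl
  · congr 1
    exact Finset.sum_congr rfl fun j _ => h _ _ rfl

theorem parity_Rsq (m n : ℕ) : Commute (Rsq m n) (parity m n) := by
  refine Commute.symm ?_
  have h : ∀ i j : Idx m n, par i = par j → parity m n * (X i * X j) = (X i * X j) * parity m n := by
    intro i j hij
    rw [← mul_assoc, parity_X, smul_mul_assoc, mul_assoc, parity_X, mul_smul_comm, smul_smul, hij,
      ← mul_pow, mul_assoc]
    norm_num
  rw [Commute, SemiconjBy, Rsq, mul_sub, sub_mul]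
  simp only [Finset.mul_sum, Finset.sum_mul]
  congr 1
  · exact Finset.sum_congr rfl fun j _ => h _ _ rfl
  · exact Finset.sum_congr rfl fun j _ => h _ _ rfl

theorem parity_euler (m n : ℕ) : Commute (euler m n) (parity m n) := by
  refine Commute.symm ?_
  rw [Commute, SemiconjBy, euler]
  simp only [Finset.mul_sum, Finset.sum_mul]
  refine Finset.sum_congr rfl fun i _ => ?_
  rw [← mul_assoc, parity_X, smul_mul_assoc, mul_assoc, parity_D, mul_smul_comm, smul_smul,
    ← mul_pow, mul_assoc]
  norm_num

theorem mem_Harm_of_commute {m n : ℕ} {T : Module.End ℝ (SuperPoly m n)}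
    (hE : Commute (euler m n) T) (hL : Commute (lap m n) T) (k : ℕ) :
    ∀ f ∈ Harm m n k, T f ∈ Harm m n k := by
  intro f hf
  have h1 := Module.End.mem_eigenspace_iff.mp hf.1
  have h2 := LinearMap.mem_ker.mp hf.2
  refine ⟨Module.End.mem_eigenspace_iff.mpr ?_, LinearMap.mem_ker.mpr ?_⟩
  · rw [← Module.End.mul_apply, hE.eq, Module.End.mul_apply, h1, map_smul]
  · rw [← Module.End.mul_apply, hL.eq, Module.End.mul_apply, h2, map_zero]

theorem mem_GenHarm_of_commute {m n : ℕ} {T : Module.End ℝ (SuperPoly m n)}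
    (hE : Commute (euler m n) T) (hL : Commute (lap m n) T) (hR : Commute (Rsq m n) T) (k : ℕ) :
    ∀ f ∈ GenHarm m n k, T f ∈ GenHarm m n k := by
  intro f hf
  have h1 := Module.End.mem_eigenspace_iff.mp hf.1
  have h2 := LinearMap.mem_ker.mp hf.2
  refine ⟨Module.End.mem_eigenspace_iff.mpr ?_, LinearMap.mem_ker.mpr ?_⟩
  · rw [← Module.End.mul_apply, hE.eq, Module.End.mul_apply, h1, map_smul]
  · rw [← Module.End.mul_apply, ((hL.mul_left hR).mul_left hL).eq, Module.End.mul_apply, h2,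
      map_zero]

/-- The action of `𝔬𝔰𝔭(m|2n)` on `ℋ_k(ℝ^{m|2n})`. -/
def harmAct {m n : ℕ} (k : ℕ) (A : osp m n) : Module.End ℝ (Harm m n k) :=
  (act (A : Matrix (Idx m n) (Idx m n) ℝ)).restrict
    (mem_Harm_of_commute (euler_act _) (lap_act A.2) k)

/-- The action of `𝔬𝔰𝔭(m|2n)` on `ℋ̃_k(ℝ^{m|2n})`. -/
def genHarmAct {m n : ℕ} (k : ℕ) (A : osp m n) : Module.End ℝ (GenHarm m n k) :=
  (act (A : Matrix (Idx m n) (Idx m n) ℝ)).restrict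
    (mem_GenHarm_of_commute (euler_act _) (lap_act A.2) (Rsq_act A.2) k)

/-- The parity involution of `ℋ_k(ℝ^{m|2n})`. -/
def harmParity (m n k : ℕ) : Module.End ℝ (Harm m n k) :=
  (parity m n).restrict (mem_Harm_of_commute (parity_euler m n) (parity_lap m n) k)

/-- The parity involution of `ℋ̃_k(ℝ^{m|2n})`. -/
def genHarmParity (m n k : ℕ) : Module.End ℝ (GenHarm m n k) :=
  (parity m n).restrict
    (mem_GenHarm_of_commute (parity_euler m n) (parity_lap m n) (parity_Rsq m n) k)

/-- The inclusion of the coordinates of the hyperplane `x_{m+1} = 0`, identified with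
`ℝ^{m|2n}`, into those of `ℝ^{m+1|2n}`. -/
def emb {m n : ℕ} : Idx m n → Idx (m + 1) n := Sum.map Fin.castSucc id

/-- The `0`-`1` matrix of the inclusion of the coordinates. -/
def embMatrix (m n : ℕ) : Matrix (Idx (m + 1) n) (Idx m n) ℝ :=
  Matrix.of fun a i => if a = emb i then 1 else 0

/-- A matrix of `𝔬𝔰𝔭(m|2n)`, extended by zeros in the row and the column of `x_{m+1}`. -/
def extendMatrix {m n : ℕ} (A : Matrix (Idx m n) (Idx m n) ℝ) :
    Matrix (Idx (m + 1) n) (Idx (m + 1) n) ℝ :=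
  embMatrix m n * A * (embMatrix m n).transpose

theorem mem_osp_of_antisymm {m n : ℕ} {A : Matrix (Idx m n) (Idx m n) ℝ}
    (h : ∀ i j, (A.transpose * gLow m n) i j = - (sg i j * (A.transpose * gLow m n) j i)) :
    A ∈ osp m n := by
  intro i j
  have h2 : ∀ k : Idx m n, (-1 : ℝ) ^ ((par k + par j) * par i) * gLow m n i k
      = sg i j * gLow m n k i := by
    intro k
    rw [← gLow_swap i k, sg, sg]
    rcases i with i | i <;> rcases j with j | j <;> rcases k with k | k <;> simp [gLow, par]
  have h3 := h i j
  rw [Matrix.mul_apply, Matrix.mul_apply, Finset.mul_sum, eq_neg_iff_add_eq_zero] at h3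
  simp only [Matrix.transpose_apply] at h3
  simp only [h2]
  rw [← h3]
  congr 1
  exact Finset.sum_congr rfl fun k _ => by ring

theorem embMatrix_gLow (m n : ℕ) :
    (embMatrix m n).transpose * gLow (m + 1) n = gLow m n * (embMatrix m n).transpose := by
  ext i b
  rw [Matrix.mul_apply, Matrix.mul_apply]
  rcases i with i | ⟨i, s⟩ <;> rcases b with b | ⟨b, t⟩ <;>
    simp [embMatrix, emb, gLow, Matrix.one_apply]
  · rw [Finset.sum_eq_single i] <;> simp +contextual [eq_comm]
  · rw [Finset.sum_eq_single (i, s)] <;> simp +contextual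

theorem extendMatrix_mem_osp {m n : ℕ} {A : Matrix (Idx m n) (Idx m n) ℝ} (hA : A ∈ osp m n) :
    extendMatrix A ∈ osp (m + 1) n := by
  apply mem_osp_of_antisymm
  have hC : (extendMatrix A).transpose * gLow (m + 1) n
      = embMatrix m n * ((A.transpose * gLow m n) * (embMatrix m n).transpose) := by
    rw [extendMatrix, Matrix.transpose_mul, Matrix.transpose_mul, Matrix.transpose_transpose,
      Matrix.mul_assoc, Matrix.mul_assoc, embMatrix_gLow, Matrix.mul_assoc]
  intro a b
  rw [hC]
  simp only [Matrix.mul_apply (M := embMatrix m n),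
    Matrix.mul_apply (M := A.transpose * gLow m n), Matrix.transpose_apply,
    Finset.mul_sum, ← Finset.sum_neg_distrib]
  rw [Finset.sum_comm]
  refine Finset.sum_congr rfl fun i _ => Finset.sum_congr rfl fun j _ => ?_
  rw [osp_antisymm hA j i]
  simp only [embMatrix, Matrix.of_apply]
  split_ifs with h1 h2
  · rw [h1, h2]
    have : sg (emb j : Idx (m + 1) n) (emb i) = sg j i := by
      rcases i with i | i <;> rcases j with j | j <;> rfl
    rw [this]; ring
  all_goals ring

/-- The inclusion of `𝔬𝔰𝔭(m|2n)` into `𝔬𝔰𝔭(m+1|2n)`. -/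
def ospIncl {m n : ℕ} (A : osp m n) : osp (m + 1) n :=
  ⟨extendMatrix (A : Matrix (Idx m n) (Idx m n) ℝ), extendMatrix_mem_osp A.2⟩

/-- `U ⊆ 𝒫(ℝ^{m|2n})` is an `𝔬𝔰𝔭(m|2n)`-submodule: a `ℤ/2`-graded subspace that is stable under
the action. -/
structure IsOspSubmodule {m n : ℕ} (U : Submodule ℝ (SuperPoly m n)) : Prop where
  act_mem : ∀ A ∈ osp m n, ∀ f ∈ U, act A f ∈ U
  parity_mem : ∀ f ∈ U, parity m n f ∈ U

/-- The `𝔬𝔰𝔭(m|2n)`-module `W ⊆ 𝒫(ℝ^{m|2n})` is indecomposable: it is nonzero and not the direct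
sum of two nonzero submodules. -/
structure IsIndecomposable {m n : ℕ} (W : Submodule ℝ (SuperPoly m n)) : Prop where
  isOspSubmodule : IsOspSubmodule W
  ne_bot : W ≠ ⊥
  eq_bot_or_eq_bot : ∀ U₁ U₂ : Submodule ℝ (SuperPoly m n), IsOspSubmodule U₁ → IsOspSubmodule U₂ →
    U₁ ⊔ U₂ = W → U₁ ⊓ U₂ = ⊥ → U₁ = ⊥ ∨ U₂ = ⊥

/-- The set `I_M` of exceptional indices: `{ℓ ∈ ℕ₀ | 2 - M/2 ≤ ℓ ≤ 2 - M}` if `M ∈ -2ℕ₀`, and `∅`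
otherwise. -/
def exceptional (M : ℤ) : Set ℕ :=
  {ℓ | M ≤ 0 ∧ Even M ∧ 2 - M / 2 ≤ (ℓ : ℤ) ∧ (ℓ : ℤ) ≤ 2 - M}

/-- `B̃_k = {0, …, k} ∩ I_{M-1}`, where `M` is the superdimension of the larger space. -/
def tildeB (M : ℤ) (k : ℕ) : Set ℕ := Set.Iic k ∩ exceptional (M - 1)

/-- `B_k = {0, …, k} ∖ (B̃_k ∪ {3 - M - ℓ | ℓ ∈ B̃_k})`, where `M` is the superdimension of the
larger space. -/
def regularB (M : ℤ) (k : ℕ) : Set ℕ :=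
  Set.Iic k \ (tildeB M k ∪ {j | ∃ ℓ ∈ tildeB M k, (j : ℤ) = 3 - M - (ℓ : ℤ)})

/-- The `𝔬𝔰𝔭(m|2n)`-module `⨁_{ℓ ∈ S} ℋ̃_ℓ(ℝ^{m|2n}) ⊕ ⨁_{ℓ ∈ T} ℋ_ℓ(ℝ^{m|2n})`. -/
abbrev HarmSum (m n : ℕ) (S T : Set ℕ) : Type :=
  (⨁ ℓ : S, GenHarm m n ℓ) × (⨁ ℓ : T, Harm m n ℓ)

/-- The summandwise action of `𝔬𝔰𝔭(m|2n)` on `HarmSum m n S T`. -/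
def harmSumAct {m n : ℕ} (S T : Set ℕ) (A : osp m n) : Module.End ℝ (HarmSum m n S T) :=
  LinearMap.prodMap (DirectSum.lmap fun ℓ : S => genHarmAct (ℓ : ℕ) A)
    (DirectSum.lmap fun ℓ : T => harmAct (ℓ : ℕ) A)

/-- The summandwise parity involution of `HarmSum m n S T`. -/
def harmSumParity (m n : ℕ) (S T : Set ℕ) : Module.End ℝ (HarmSum m n S T) :=
  LinearMap.prodMap (DirectSum.lmap fun ℓ : S => genHarmParity m n ℓ)
    (DirectSum.lmap fun ℓ : T => harmParity m n ℓ)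

end SuperHarmonic

end

open SuperHarmonic

/-! Here the large space is ℝ^{m+1|2n} and the small one ℝ^{m|2n}, of superdimension M. Two ideas
carry the decomposition, and a cyclic-vector argument carries indecomposability.

Cauchy-Kovalevskaya. A harmonic superpolynomial is determined by its restriction to x_{m+1} = 0 and
by that of its normal derivative, and both can be prescribed (`ck`, `eq_ck_add_ck`). Hence ℋ_k of
the large space is 𝒫_k ⊕ 𝒫_{k-1} of the small one, equivariantly.

Casimir. It remains to decompose 𝒫_d of the small space. The operator C = 𝔼(𝔼+M-2) - R²Δ commutes
with 𝔬𝔰𝔭(m|2n), R², Δ and 𝔼, and acts on ℋ_ℓ by ℓ(ℓ+M-2). This value is shared by at most two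
degrees, ℓ and 2-M-ℓ (`cas_eq_iff`), so 𝒫_d is the direct sum of the spaces on which (C-c)² = 0
(`Homog_le_iSup`, `iSupIndep_casEigen`). Multiplication by R² is bijective from degree k to degree
k+2 on such a space unless c is the value of degree k+2. So each of these spaces is R^{2j} times the
one in the largest degree ℓ ≤ d with value c. If no smaller degree of the same parity has the value
c, that space is ℋ_ℓ. Otherwise ℓ is exceptional and it is ℋ̃_ℓ (`mem_Harm_iff_mem_casEigen`,
`mem_GenHarm_iff_mem_casEigen`). Both kinds of summand are thus full generalized eigenspaces of C.

Indecomposability, general case. In a space with a bosonic coordinate x, the power x^ℓ generates 𝒫_ℓ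
(`Homog_le_of_lastPow_mem`). If a generalized eigenspace of C splits as U₁ ⊕ U₂, the U₁-component of
x^ℓ is invariant under the subalgebra not touching x, so its coefficients in x are invariants of
that subalgebra. If these are polynomials in the R² of the remaining variables, the component equals
q(C)x^ℓ for a polynomial q. Hence q(C) is the projection to U₁ on all of 𝒫_ℓ, equal to 1 on U₁ and 0
on U₂. Since C has the single eigenvalue c there, one of the two is zero
(`eq_bot_or_eq_bot_of_invariants`).

The invariants are computed from Cf = 0 for invariant f: outside the critical degree 2-M, f is a
multiple of R²Δf. The critical degree is handled by restriction to a hyperplane when there are at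
least two bosonic variables (`isRsqPow_of_two_le`).

Special cases. For ℋ_ℓ(ℝ^{2|2n}) with ℓ > 2n, extra invariants in one bosonic variable would
interfere; instead every nonzero submodule contains Re z^ℓ and Im z^ℓ (`mulZ_pow_mem`). For
ℋ_ℓ(ℝ^{0|2n}) with ℓ ≤ n, every nonzero submodule contains the highest weight vector θ₁θ₃⋯θ_{2ℓ-1}
(`exists_isExtremal`). No argument uses that the submodules are graded. -/

noncomputable section

namespace SuperHarmonic

variable {m n : ℕ}

/-! ### Dual derivatives and the 𝔰𝔩₂ relations between Δ, R² and 𝔼 -/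

/-- The derivative `∂^a = ∑ g_{aj} ∂_j` dual to the coordinate `X_a`. -/
def Dd (a : Idx m n) : Module.End ℝ (SuperPoly m n) := ∑ j, gLow m n a j • D j

/-- The sign `(-1)^{|a|}` of a coordinate. -/
def sgn (a : Idx m n) : ℝ := sg a a

theorem sgn_mul_self (a : Idx m n) : sgn a * sgn a = 1 := sg_mul_self a a

theorem gUp_gLow_sum (i k : Idx m n) :
    ∑ j, gUp m n i j * gLow m n j k = if i = k then 1 else 0 := by
  rw [← Matrix.mul_apply, gUp_mul_gLow, Matrix.one_apply]

theorem gLow_par (b a c : Idx m n) : gLow m n b a * sg b c = gLow m n b a * sg a c := by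
  rcases b with b | b <;> rcases a with a | a <;> simp [gLow, sg, par]

theorem gLow_symm (b a : Idx m n) : gLow m n a b = sgn b * gLow m n b a := by
  rw [← gLow_swap b a, gLow_par b a a, mul_comm]
  rcases b with b | b <;> rcases a with a | a <;> simp [gLow, sg, sgn, par]

theorem sum_sgn (m n : ℕ) : ∑ a : Idx m n, sgn a = (superdim m n : ℝ) := by
  simp [sgn, sg, par, superdim, mul_comm]
  ring

theorem sum_gUp_smul_Dd (i : Idx m n) : ∑ a, gUp m n i a • Dd a = D i := by
  simp only [Dd, Finset.smul_sum, smul_smul]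
  rw [Finset.sum_comm]
  simp only [← Finset.sum_smul, gUp_gLow_sum]
  simp

theorem Dd_mul_X (a b : Idx m n) :
    (Dd a * X b : Module.End ℝ (SuperPoly m n)) = sg a b • (X b * Dd a) + gLow m n a b • 1 := by
  simp only [Dd, Finset.sum_mul, Finset.mul_sum, smul_mul_assoc, mul_smul_comm, D_mul_X, smul_add,
    Finset.sum_add_distrib, Finset.smul_sum]
  congr 1
  · refine Finset.sum_congr rfl fun j _ => ?_
    rw [smul_smul, smul_smul, ← gLow_par, mul_comm]
  · simp [ite_smul]

theorem D_mul_Dd (a b : Idx m n) :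
    (D b * Dd a : Module.End ℝ (SuperPoly m n)) = sg b a • (Dd a * D b) := by
  simp only [Dd, Finset.sum_mul, Finset.mul_sum, smul_mul_assoc, mul_smul_comm, Finset.smul_sum]
  refine Finset.sum_congr rfl fun j _ => ?_
  rw [D_mul_D b j, smul_smul, smul_smul, sg_comm b j, ← gLow_par, mul_comm, sg_comm a b]

theorem lap_eq_sum (m n : ℕ) : lap m n = ∑ a, sgn a • (D a * Dd a) := by
  rw [lap_eq, Finset.sum_comm]
  refine Finset.sum_congr rfl fun a _ => ?_
  simp only [Dd, Finset.mul_sum, Finset.smul_sum, mul_smul_comm, smul_smul]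
  refine Finset.sum_congr rfl fun b _ => ?_
  rw [gLow_symm]

theorem lap_mul_X' (a : Idx m n) : lap m n * X a = X a * lap m n + (2 : ℝ) • Dd a :=
  lap_mul_X a

theorem euler_eq_sum (m n : ℕ) : euler m n = ∑ i, ∑ a, gUp m n i a • (X i * Dd a) := by
  rw [euler]
  refine Finset.sum_congr rfl fun i _ => ?_
  rw [← sum_gUp_smul_Dd, Finset.mul_sum]
  simp only [mul_smul_comm]

theorem gUp_symm (b a : Idx m n) : gUp m n a b = sgn b * gUp m n b a := by
  rw [← gUp_swap b a, gUp_par b a a, mul_comm]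
  rcases b with b | b <;> rcases a with a | a <;> simp [gUp, sg, sgn, par]

/-- Moving Δ through X_i X_j leaves X_i∂^j and ∂^iX_j. Contracted with g^{ij}, the first gives 𝔼,
and the second gives 𝔼 + M after reordering, M being the signed count of the coordinates. -/
theorem lap_mul_Rsq (m n : ℕ) :
    lap m n * Rsq m n = Rsq m n * lap m n + (4 : ℝ) • euler m n
      + (2 * (superdim m n : ℝ)) • 1 := by
  have h1 : ∀ i j : Idx m n, lap m n * (X i * X j) = (X i * X j) * lap m n
      + (2 : ℝ) • (X i * Dd j) + (2 : ℝ) • (Dd i * X j) := by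
    intro i j
    rw [← mul_assoc, lap_mul_X', add_mul, mul_assoc, lap_mul_X', mul_add, mul_assoc,
      mul_smul_comm, smul_mul_assoc]
  have h2 : ∑ i, ∑ j, gUp m n i j • (Dd i * X j : Module.End ℝ (SuperPoly m n))
      = euler m n + (superdim m n : ℝ) • 1 := by
    rw [Finset.sum_comm, ← sum_sgn, Finset.sum_smul, euler, ← Finset.sum_add_distrib]
    refine Finset.sum_congr rfl fun j _ => ?_
    have : ∑ i, gUp m n i j • Dd i = sgn j • (D j : Module.End ℝ (SuperPoly m n)) := by
      rw [← sum_gUp_smul_Dd, Finset.smul_sum]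
      refine Finset.sum_congr rfl fun i _ => ?_
      rw [gUp_symm j i, smul_smul]
    simp only [← smul_mul_assoc, ← Finset.sum_mul, this]
    rw [smul_mul_assoc, D_mul_X, smul_add, smul_smul, smul_smul, if_pos rfl, mul_one,
      ← sgn, sgn_mul_self, one_smul]
  have h3 : ∑ i, ∑ j, gUp m n i j • (lap m n * (X i * X j)) = Rsq m n * lap m n
      + (2 : ℝ) • euler m n + (2 : ℝ) • (euler m n + (superdim m n : ℝ) • 1) := by
    rw [← h2, Rsq_eq, euler_eq_sum]
    simp only [h1, smul_add, Finset.sum_add_distrib, Finset.sum_mul, Finset.smul_sum,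
      smul_mul_assoc, smul_comm (2 : ℝ)]
  calc lap m n * Rsq m n = ∑ i, ∑ j, gUp m n i j • (lap m n * (X i * X j)) := by
        rw [Rsq_eq]; simp only [Finset.mul_sum, mul_smul_comm]
    _ = _ := by rw [h3]; module

theorem euler_mul_D (b : Idx m n) : euler m n * D b = D b * euler m n - D b := by
  rw [D_mul_euler]; abel

theorem euler_mul_Dd (b : Idx m n) : euler m n * Dd b = Dd b * euler m n - Dd b := by
  simp only [Dd, Finset.mul_sum, Finset.sum_mul, mul_smul_comm, smul_mul_assoc, euler_mul_D,
    smul_sub, Finset.sum_sub_distrib]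

theorem euler_mul_lap (m n : ℕ) :
    euler m n * lap m n = lap m n * euler m n - (2 : ℝ) • lap m n := by
  have h : ∀ i j : Idx m n, euler m n * (D i * D j) = (D i * D j) * euler m n
      - (2 : ℝ) • (D i * D j) := by
    intro i j
    rw [← mul_assoc, euler_mul_D, sub_mul, mul_assoc, euler_mul_D, mul_sub, mul_assoc, two_smul]
    abel
  rw [lap_eq]
  simp only [Finset.mul_sum, Finset.sum_mul, mul_smul_comm, smul_mul_assoc, h, smul_sub,
    Finset.sum_sub_distrib, Finset.smul_sum, smul_comm (2 : ℝ)]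

theorem euler_mul_Rsq (m n : ℕ) :
    euler m n * Rsq m n = Rsq m n * euler m n + (2 : ℝ) • Rsq m n := by
  have h : ∀ i j : Idx m n, euler m n * (X i * X j) = (X i * X j) * euler m n
      + (2 : ℝ) • (X i * X j) := by
    intro i j
    rw [← mul_assoc, euler_mul_X, add_mul, mul_assoc, euler_mul_X, mul_add, mul_assoc, two_smul]
    abel
  rw [Rsq_eq]
  simp only [Finset.mul_sum, Finset.sum_mul, mul_smul_comm, smul_mul_assoc, h, smul_add,
    Finset.sum_add_distrib, Finset.smul_sum, smul_comm (2 : ℝ)]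

/-! ### The Casimir operator -/

/-- The Casimir operator `𝔼(𝔼 + M - 2) - R²Δ`. -/
def casimir (m n : ℕ) : Module.End ℝ (SuperPoly m n) :=
  euler m n * euler m n + ((superdim m n : ℝ) - 2) • euler m n - Rsq m n * lap m n

/-- The shift of the quadratic expression in 𝔼 caused by lowering the degree by two cancels [Δ,
R²]Δ; the constant M - 2 is what makes this work. -/
theorem casimir_comm_lap (m n : ℕ) : Commute (casimir m n) (lap m n) := by
  have hE := euler_mul_lap m n
  have hEE : euler m n * euler m n * lap m n = lap m n * (euler m n * euler m n)
      - (4 : ℝ) • (lap m n * euler m n) + (4 : ℝ) • lap m n := by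
    rw [mul_assoc, hE, mul_sub, ← mul_assoc, hE, sub_mul, mul_smul_comm, hE, mul_assoc,
      smul_mul_assoc]
    module
  have hR : lap m n * (Rsq m n * lap m n) = Rsq m n * lap m n * lap m n
      + (4 : ℝ) • (lap m n * euler m n) - (8 : ℝ) • lap m n
      + (2 * (superdim m n : ℝ)) • lap m n := by
    rw [← mul_assoc, lap_mul_Rsq, add_mul, add_mul, smul_mul_assoc, hE, smul_mul_assoc, one_mul]
    module
  rw [Commute, SemiconjBy, casimir, sub_mul, add_mul, hEE, smul_mul_assoc, hE, mul_sub, mul_add,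
    mul_smul_comm, hR]
  module

theorem casimir_comm_Rsq (m n : ℕ) : Commute (casimir m n) (Rsq m n) := by
  have hE := euler_mul_Rsq m n
  have hEE : euler m n * euler m n * Rsq m n = Rsq m n * (euler m n * euler m n)
      + (4 : ℝ) • (Rsq m n * euler m n) + (4 : ℝ) • Rsq m n := by
    rw [mul_assoc, hE, mul_add, ← mul_assoc, hE, add_mul, mul_smul_comm, hE, mul_assoc,
      smul_mul_assoc]
    module
  have hR : Rsq m n * lap m n * Rsq m n = Rsq m n * (Rsq m n * lap m n)
      + (4 : ℝ) • (Rsq m n * euler m n) + (2 * (superdim m n : ℝ)) • Rsq m n := by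
    rw [mul_assoc, lap_mul_Rsq, mul_add, mul_add, mul_smul_comm, mul_smul_comm, mul_one]
  rw [Commute, SemiconjBy, casimir, sub_mul, add_mul, hEE, smul_mul_assoc, hE, mul_sub, mul_add,
    mul_smul_comm, hR]
  module

theorem euler_comm_Rsq_lap (m n : ℕ) : Commute (euler m n) (Rsq m n * lap m n) := by
  rw [Commute, SemiconjBy, ← mul_assoc, euler_mul_Rsq, add_mul, mul_assoc, euler_mul_lap, mul_sub,
    mul_smul_comm, smul_mul_assoc, mul_assoc]
  abel

theorem casimir_comm_euler (m n : ℕ) : Commute (casimir m n) (euler m n) := by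
  unfold casimir
  refine Commute.sub_left (Commute.add_left ?_ ?_) (euler_comm_Rsq_lap m n).symm
  · exact (Commute.refl _).mul_left (Commute.refl _)
  · exact (Commute.refl _).smul_left _

theorem casimir_comm {T : Module.End ℝ (SuperPoly m n)} (hE : Commute (euler m n) T)
    (hL : Commute (lap m n) T) (hR : Commute (Rsq m n) T) : Commute (casimir m n) T := by
  unfold casimir
  exact Commute.sub_left ((hE.mul_left hE).add_left (hE.smul_left _)) (hR.mul_left hL)

theorem casimir_comm_act {A : Matrix (Idx m n) (Idx m n) ℝ} (hA : A ∈ osp m n) :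
    Commute (casimir m n) (act A) :=
  casimir_comm (euler_act A) (lap_act hA) (Rsq_act hA)

/-! ### The generators X_a∂^b ∓ X_b∂^a and their contraction -/

/-- The element `X_a ∂^b - (-1)^{|a||b|} X_b ∂^a` of `𝔬𝔰𝔭(m|2n)`, as an operator. -/
def rot (a b : Idx m n) : Module.End ℝ (SuperPoly m n) := X a * Dd b - sg a b • (X b * Dd a)

/-- The matrix of `rot a b`. -/
def rotMatrix (a b : Idx m n) : Matrix (Idx m n) (Idx m n) ℝ :=
  Matrix.of fun i j => (if i = a then gLow m n b j else 0)
    - sg a b * (if i = b then gLow m n a j else 0)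

theorem act_rotMatrix (a b : Idx m n) : act (rotMatrix a b) = rot a b := by
  simp only [act, rotMatrix, rot, Matrix.of_apply, sub_smul, Finset.sum_sub_distrib, Dd,
    Finset.mul_sum, Finset.smul_sum, mul_smul_comm, smul_smul]
  rw [Finset.sum_comm, Finset.sum_comm (f := fun i j => (sg a b * _) • _)]
  simp [ite_smul]

theorem rotMatrix_mem (a b : Idx m n) : rotMatrix a b ∈ osp m n := by
  apply mem_osp_of_antisymm
  have h : ∀ i j, ((rotMatrix a b).transpose * gLow m n) i j
      = gLow m n b i * gLow m n a j - sg a b * (gLow m n a i * gLow m n b j) := by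
    intro i j
    simp [Matrix.mul_apply, rotMatrix, sub_mul, Finset.sum_sub_distrib, mul_assoc]
  intro i j
  rw [h, h]
  have h1 := gLow_par b i a
  have h2 := gLow_par a j i
  have h3 : sg a b * sg a b = 1 := sg_mul_self a b
  have h4 := gLow_par b j a
  have h5 := gLow_par a i j
  rcases a with a | a <;> rcases b with b | b <;> rcases i with i | i <;> rcases j with j | j <;>
    simp [gLow, sg, par] <;> ring

/-- Moving ∂_b past X_a produces X_aΔ and the single term ∂^a, while the reordered sum of ∂_b X_b is
𝔼 + M. This contraction is the source of the invariants below and of the vanishing statements in the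
plane and in the fermionic case. -/
theorem sum_D_mul_rot (a : Idx m n) :
    ∑ b, (sgn b * sg a b) • (D b * rot a b)
      = X a * lap m n + Dd a - (euler m n + (superdim m n : ℝ) • 1) * Dd a := by
  have h1 : ∀ b : Idx m n, (sgn b * sg a b) • (D b * rot a b)
      = X a * (sgn b • (D b * Dd b)) + (if b = a then 1 else 0 : ℝ) • Dd a
        - (X b * D b + sgn b • 1) * Dd a := by
    intro b
    have e1 : sgn b * sg a b * sg b a = sgn b := by
      rw [sg_comm b a, mul_assoc, sg_mul_self, mul_one]
    have e2 : sgn b * sg a b * sg a b = sgn b := by rw [mul_assoc, sg_mul_self, mul_one]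
    have e3 : (sgn b * sg a b) * (if b = a then 1 else 0) = if b = a then 1 else 0 := by
      split_ifs with h
      · subst h; rw [mul_one]; exact sgn_mul_self b
      · simp
    rw [rot, mul_sub, mul_smul_comm, ← mul_assoc, ← mul_assoc, D_mul_X, D_mul_X, add_mul, add_mul,
      if_pos rfl, one_smul, smul_mul_assoc, smul_mul_assoc, one_mul, smul_sub, smul_add, smul_smul,
      smul_smul, e1, smul_mul_assoc, smul_smul, e2, smul_add, smul_smul, e3, add_mul,
      smul_mul_assoc, one_mul, mul_assoc, mul_assoc, show sg b b = sgn b from rfl, sgn_mul_self,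
      one_smul, mul_smul_comm]
    congr 2
    split_ifs with h
    · rw [h]
    · simp
  simp only [h1, Finset.sum_sub_distrib, Finset.sum_add_distrib, ← Finset.mul_sum, ← Finset.sum_mul,
    ← lap_eq_sum, ← Finset.sum_smul, sum_sgn]
  simp [euler]

/-- The contraction of the vanishing rotations says X_aΔf = ∂^a(𝔼 + M - 2)f; multiplying by
g^{ia}X_i and summing turns ∂^a into 𝔼. Equivalently, the Casimir operator annihilates f. -/
theorem rot_eq_zero_lap {f : SuperPoly m n} (h : ∀ a b, rot a b f = 0) :
    Rsq m n (lap m n f) = euler m n (euler m n f) + ((superdim m n : ℝ) - 2) • euler m n f := by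
  have h1 : ∀ a, X a (lap m n f) = Dd a (euler m n f) + ((superdim m n : ℝ) - 2) • Dd a f := by
    intro a
    have := LinearMap.congr_fun (sum_D_mul_rot a) f
    simp only [LinearMap.sum_apply, LinearMap.smul_apply, Module.End.mul_apply, h, map_zero,
      smul_zero, Finset.sum_const_zero, LinearMap.sub_apply, LinearMap.add_apply] at this
    have h2 := LinearMap.congr_fun (euler_mul_Dd a) f
    simp only [Module.End.mul_apply, LinearMap.sub_apply] at h2
    rw [h2] at this
    have h3 := (sub_eq_zero.mp this.symm)
    rw [eq_sub_of_add_eq h3, Module.End.one_apply]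
    module
  have h2 : Rsq m n (lap m n f) = ∑ i, ∑ a, gUp m n i a • X i (X a (lap m n f)) := by
    rw [Rsq_eq]; simp [LinearMap.sum_apply]
  have h3 : ∀ g, euler m n g = ∑ i, ∑ a, gUp m n i a • X i (Dd a g) := by
    intro g; rw [euler_eq_sum]; simp [LinearMap.sum_apply]
  rw [h2]
  simp only [h1, map_add, map_smul, smul_add, Finset.sum_add_distrib, ← h3,
    smul_comm _ ((superdim m n : ℝ) - 2), ← Finset.smul_sum]

/-! ### Induction over coordinates, and the possible degrees -/

/-- The elementary superpolynomial `p ⊗ u`. -/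
def mk (p : MvPolynomial (Fin m) ℝ) (u : ExteriorAlgebra ℝ (Fin n × Fin 2 → ℝ)) : SuperPoly m n :=
  p ⊗ₜ[ℝ] u

/-- The constant superpolynomial `1`. -/
def one (m n : ℕ) : SuperPoly m n := mk 1 1

theorem X_inl_mk (j : Fin m) (p : MvPolynomial (Fin m) ℝ)
    (u : ExteriorAlgebra ℝ (Fin n × Fin 2 → ℝ)) :
    X (Sum.inl j) (mk p u) = mk (MvPolynomial.X j * p) u := rfl

theorem X_inr_mk (t : Fin n × Fin 2) (p : MvPolynomial (Fin m) ℝ)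
    (u : ExteriorAlgebra ℝ (Fin n × Fin 2 → ℝ)) :
    X (Sum.inr t) (mk p u) = mk p (theta t * u) := rfl

theorem onX_mk (f : Module.End ℝ (MvPolynomial (Fin m) ℝ)) (p : MvPolynomial (Fin m) ℝ)
    (u : ExteriorAlgebra ℝ (Fin n × Fin 2 → ℝ)) : onX f (mk p u) = mk (f p) u := rfl

theorem onTheta_mk (f : Module.End ℝ (ExteriorAlgebra ℝ (Fin n × Fin 2 → ℝ)))
    (p : MvPolynomial (Fin m) ℝ) (u : ExteriorAlgebra ℝ (Fin n × Fin 2 → ℝ)) :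
    onTheta f (mk p u) = mk p (f u) := rfl

theorem mk_zero_left (u : ExteriorAlgebra ℝ (Fin n × Fin 2 → ℝ)) :
    (mk 0 u : SuperPoly m n) = 0 := TensorProduct.zero_tmul _ _

theorem mk_zero_right (p : MvPolynomial (Fin m) ℝ) :
    (mk p 0 : SuperPoly m n) = 0 := TensorProduct.tmul_zero _ _

theorem D_one (i : Idx m n) : D i (one m n) = 0 := by
  rcases i with i | i
  · rw [D, one, onX_mk, Derivation.coeFn_coe, Derivation.map_one_eq_zero, mk_zero_left]
  · rw [D, one, onTheta_mk, dTheta, CliffordAlgebra.contractLeft_one, mk_zero_right]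

theorem parity_one : parity m n (one m n) = one m n := by
  rw [parity, one, onTheta_mk, AlgHom.toLinearMap_apply, map_one]

/-- The coordinates generate both tensor factors, so identities between operators reduce to the
constant 1 and to commutation with each X_i. -/
theorem superPoly_induction {p : SuperPoly m n → Prop} (h1 : p (one m n))
    (hadd : ∀ f g, p f → p g → p (f + g)) (hsmul : ∀ (c : ℝ) f, p f → p (c • f))
    (hX : ∀ i f, p f → p (X i f)) (f : SuperPoly m n) : p f := by
  have h0 : p 0 := by simpa using hsmul 0 _ h1
  have hu : ∀ u : ExteriorAlgebra ℝ (Fin n × Fin 2 → ℝ), p (mk 1 u) := by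
    intro u
    induction u using CliffordAlgebra.left_induction with
    | algebraMap r =>
      have : (mk 1 (algebraMap ℝ _ r) : SuperPoly m n) = r • one m n := by
        rw [Algebra.algebraMap_eq_smul_one]
        exact TensorProduct.tmul_smul r _ _
      rw [this]; exact hsmul _ _ h1
    | add x y hx hy =>
      have : (mk 1 (x + y) : SuperPoly m n) = mk 1 x + mk 1 y := TensorProduct.tmul_add _ _ _
      rw [this]; exact hadd _ _ hx hy
    | ι_mul x v hx =>
      have hv : (CliffordAlgebra.ι (0 : QuadraticForm ℝ (Fin n × Fin 2 → ℝ))) v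
          = ∑ t, v t • theta t := by
        conv_lhs => rw [← Finset.univ_sum_single v]
        rw [map_sum]
        refine Finset.sum_congr rfl fun t _ => ?_
        have : Pi.single t (v t) = v t • (Pi.single t 1 : Fin n × Fin 2 → ℝ) := by
          rw [← Pi.single_smul, smul_eq_mul, mul_one]
        rw [this, map_smul]; rfl
      have : (mk 1 (CliffordAlgebra.ι (0 : QuadraticForm ℝ (Fin n × Fin 2 → ℝ)) v * x)
          : SuperPoly m n) = ∑ t, v t • X (Sum.inr t) (mk 1 x) := by
        rw [hv, Finset.sum_mul]
        simp only [smul_mul_assoc]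
        refine (TensorProduct.tmul_sum _ _ _).trans ?_
        exact Finset.sum_congr rfl fun t _ => TensorProduct.tmul_smul _ _ _
      rw [this]
      exact Finset.sum_induction _ p hadd h0 fun t _ => hsmul _ _ (hX _ _ hx)
  have hp : ∀ (q : MvPolynomial (Fin m) ℝ) (u : ExteriorAlgebra ℝ (Fin n × Fin 2 → ℝ)),
      p (mk q u) := by
    intro q u
    induction q using MvPolynomial.induction_on with
    | C a =>
      have : (mk (MvPolynomial.C a) u : SuperPoly m n) = a • mk 1 u := by
        rw [MvPolynomial.C_eq_smul_one]
        exact TensorProduct.smul_tmul' _ _ _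
      rw [this]; exact hsmul _ _ (hu u)
    | add a b ha hb =>
      have : (mk (a + b) u : SuperPoly m n) = mk a u + mk b u := TensorProduct.add_tmul _ _ _
      rw [this]; exact hadd _ _ ha hb
    | mul_X a i ha =>
      rw [mul_comm, ← X_inl_mk]; exact hX _ _ ha
  exact TensorProduct.induction_on (motive := p) f h0 hp fun x y hx hy => hadd _ _ hx hy

section apply

variable (f : SuperPoly m n)

theorem D_X_apply (i j : Idx m n) :
    D i (X j f) = sg i j • X j (D i f) + (if i = j then 1 else 0 : ℝ) • f :=
  LinearMap.congr_fun (D_mul_X i j) f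

theorem X_X_apply (i j : Idx m n) : X i (X j f) = sg i j • X j (X i f) :=
  LinearMap.congr_fun (X_mul_X i j) f

theorem D_D_apply (i j : Idx m n) : D i (D j f) = sg i j • D j (D i f) :=
  LinearMap.congr_fun (D_mul_D i j) f

theorem euler_X_apply (i : Idx m n) : euler m n (X i f) = X i (euler m n f) + X i f :=
  LinearMap.congr_fun (euler_mul_X i) f

theorem euler_apply : euler m n f = ∑ i, X i (D i f) := by
  simp [euler, LinearMap.sum_apply]

end apply

theorem euler_one : euler m n (one m n) = 0 := by simp [euler_apply, D_one]

theorem euler_X_of {f : SuperPoly m n} {μ : ℝ} (h : euler m n f = μ • f) (i : Idx m n) :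
    euler m n (X i f) = (μ + 1) • X i f := by
  rw [euler_X_apply, h, map_smul]; module

theorem euler_D_of {f : SuperPoly m n} {μ : ℝ} (h : euler m n f = μ • f) (i : Idx m n) :
    euler m n (D i f) = (μ - 1) • D i f := by
  have := LinearMap.congr_fun (euler_mul_D i) f
  simp only [Module.End.mul_apply, LinearMap.sub_apply, h, map_smul] at this
  rw [this]; module

theorem euler_Dd_of {f : SuperPoly m n} {μ : ℝ} (h : euler m n f = μ • f) (i : Idx m n) :
    euler m n (Dd i f) = (μ - 1) • Dd i f := by
  have := LinearMap.congr_fun (euler_mul_Dd i) f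
  simp only [Module.End.mul_apply, LinearMap.sub_apply, h, map_smul] at this
  rw [this]; module

theorem euler_lap_of {f : SuperPoly m n} {μ : ℝ} (h : euler m n f = μ • f) :
    euler m n (lap m n f) = (μ - 2) • lap m n f := by
  have := LinearMap.congr_fun (euler_mul_lap m n) f
  simp only [Module.End.mul_apply, LinearMap.sub_apply, LinearMap.smul_apply, h, map_smul] at this
  rw [this]; module

theorem euler_Rsq_of {f : SuperPoly m n} {μ : ℝ} (h : euler m n f = μ • f) :
    euler m n (Rsq m n f) = (μ + 2) • Rsq m n f := by
  have := LinearMap.congr_fun (euler_mul_Rsq m n) f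
  simp only [Module.End.mul_apply, LinearMap.add_apply, LinearMap.smul_apply, h, map_smul] at this
  rw [this]; module

theorem euler_comm_of {T : Module.End ℝ (SuperPoly m n)} (hT : Commute (euler m n) T)
    {f : SuperPoly m n} {μ : ℝ} (h : euler m n f = μ • f) :
    euler m n (T f) = μ • T f := by
  rw [← Module.End.mul_apply, hT.eq, Module.End.mul_apply, h, map_smul]

theorem lap_one : lap m n (one m n) = 0 := by
  simp [lap, LinearMap.sum_apply, D_one]

-- Replaces a grading: every f is a finite sum of homogeneous parts of degrees in ℕ, and a
-- polynomial in 𝔼 with only positive integer roots can remove all parts but the constant one.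
open Polynomial in
theorem exists_aeval_euler (f : SuperPoly m n) :
    ∃ q : ℝ[X], (∀ μ, q.eval μ = 0 → ∃ r : ℕ, μ = r + 1) ∧
      ∃ c : ℝ, aeval (euler m n) q f = c • one m n := by
  have hE : ∀ q : ℝ[X], ∃ c : ℝ, aeval (euler m n) q (one m n) = c • one m n := by
    intro q
    induction q using Polynomial.induction_on' with
    | add p q hp hq =>
      obtain ⟨c, hc⟩ := hp
      obtain ⟨d, hd⟩ := hq
      exact ⟨c + d, by rw [map_add, LinearMap.add_apply, hc, hd, add_smul]⟩
    | monomial k a =>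
      rcases k with _ | k
      · exact ⟨a, by simp⟩
      · refine ⟨0, ?_⟩
        rw [aeval_monomial, pow_succ, Module.End.mul_apply, Module.End.mul_apply, euler_one]
        simp
  induction f using superPoly_induction with
  | h1 => exact ⟨1, by simp, 1, by simp⟩
  | hadd f g hf hg =>
    obtain ⟨p, hp, c, hc⟩ := hf
    obtain ⟨q, hq, d, hd⟩ := hg
    obtain ⟨c', hc'⟩ := hE q
    obtain ⟨d', hd'⟩ := hE p
    refine ⟨p * q, fun μ h => ?_, c * c' + d * d', ?_⟩
    · rw [eval_mul, mul_eq_zero] at h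
      exact h.elim (hp μ) (hq μ)
    · rw [map_add]
      conv_lhs => enter [1]; rw [mul_comm, map_mul, Module.End.mul_apply, hc, map_smul, hc']
      rw [map_mul, Module.End.mul_apply, hd, map_smul, hd', smul_smul, smul_smul, add_smul]
  | hsmul a f hf =>
    obtain ⟨p, hp, c, hc⟩ := hf
    exact ⟨p, hp, a * c, by rw [map_smul, hc, smul_smul]⟩
  | hX i f hf =>
    obtain ⟨p, hp, c, hc⟩ := hf
    have hshift : ∀ (q : ℝ[X]) (g : SuperPoly m n), aeval (euler m n) 
        (q.comp (Polynomial.X - C 1)) (SuperHarmonic.X i g)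
        = SuperHarmonic.X i (aeval (euler m n) q g) := by
      intro q g
      have hc : (euler m n - 1) * SuperHarmonic.X i = SuperHarmonic.X i * euler m n := by
        rw [sub_mul, euler_mul_X, one_mul, add_sub_cancel_right]
      have : ∀ k : ℕ, (euler m n - 1) ^ k * SuperHarmonic.X i
          = SuperHarmonic.X i * euler m n ^ k := by
        intro k
        induction k with
        | zero => simp
        | succ k ih => rw [pow_succ, mul_assoc, hc, ← mul_assoc, ih, mul_assoc, ← pow_succ]
      rw [aeval_comp]
      simp only [map_sub, aeval_X, map_one]
      induction q using Polynomial.induction_on' with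
      | add p q hp hq => simp only [map_add, LinearMap.add_apply, hp, hq]
      | monomial k a =>
        have h2 := LinearMap.congr_fun (this k) g
        simp only [Module.End.mul_apply] at h2
        simp only [aeval_monomial, Module.End.mul_apply, Module.algebraMap_end_apply, h2, map_smul]
    -- Substituting T - 1 moves the polynomial past X_i, and the extra factor T kills the constant
    -- that p(𝔼) leaves of f.
    refine ⟨(p * Polynomial.X).comp (Polynomial.X - C 1), fun μ h => ?_, 0, ?_⟩
    · simp only [eval_comp, eval_mul, eval_X, eval_sub, eval_C, mul_eq_zero] at h
      rcases h with h | h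
      · obtain ⟨r, hr⟩ := hp _ h
        exact ⟨r + 1, by push_cast; linarith⟩
      · exact ⟨0, by push_cast; linarith⟩
    · rw [hshift, mul_comm, map_mul, aeval_X, Module.End.mul_apply, hc, map_smul, euler_one]
      simp

theorem aeval_apply_of_eigen {V : Type*} [AddCommGroup V] [Module ℝ V] {T : Module.End ℝ V}
    {f : V} {μ : ℝ} (h : T f = μ • f) (q : Polynomial ℝ) :
    Polynomial.aeval T q f = q.eval μ • f := by
  induction q using Polynomial.induction_on' with
  | add p q hp hq => simp only [map_add, LinearMap.add_apply, hp, hq, Polynomial.eval_add, add_smul]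
  | monomial k a =>
    have : (T ^ k) f = μ ^ k • f := by
      induction k with
      | zero => simp
      | succ k ih => rw [pow_succ', Module.End.mul_apply, ih, map_smul, h, smul_smul, pow_succ]
    simp [Polynomial.aeval_monomial, this, smul_smul, mul_comm]

/-- On an eigenvector the polynomial q(𝔼) acts by q(μ), which is nonzero when μ is not a positive
integer. This covers degree zero and, below, the absence of negative degrees. -/
theorem exists_smul_one {f : SuperPoly m n} {μ : ℝ} (h : euler m n f = μ • f)
    (hμ : ∀ r : ℕ, μ ≠ r + 1) : ∃ c : ℝ, f = c • one m n := by
  obtain ⟨q, hq, c, hc⟩ := exists_aeval_euler f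
  rw [aeval_apply_of_eigen h] at hc
  have h0 : q.eval μ ≠ 0 := fun h0 => by
    obtain ⟨r, hr⟩ := hq μ h0
    exact hμ r hr
  exact ⟨(q.eval μ)⁻¹ * c, by rw [← smul_smul, ← hc, inv_smul_smul₀ h0]⟩

theorem eq_zero_of_euler_neg {f : SuperPoly m n} {μ : ℝ} (h : euler m n f = μ • f)
    (hμ : μ < 0) : f = 0 := by
  obtain ⟨c, rfl⟩ := exists_smul_one h fun r hr => by
    have : (0 : ℝ) ≤ r := r.cast_nonneg
    linarith
  rw [map_smul, euler_one, smul_zero] at h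
  exact (smul_eq_zero.mp h.symm).resolve_left hμ.ne

/-- The constant term of a superpolynomial. -/
def constTerm (m n : ℕ) : SuperPoly m n →ₗ[ℝ] ℝ :=
  (TensorProduct.lid ℝ ℝ).toLinearMap ∘ₗ TensorProduct.map
    (MvPolynomial.aeval (0 : Fin m → ℝ)).toLinearMap
    (ExteriorAlgebra.algebraMapInv (R := ℝ) (M := Fin n × Fin 2 → ℝ)).toLinearMap

theorem one_ne_zero' : one m n ≠ 0 := by
  intro h
  have h1 : constTerm m n (one m n) = (MvPolynomial.aeval (0 : Fin m → ℝ) 1 : ℝ)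
      • ExteriorAlgebra.algebraMapInv (R := ℝ) (M := Fin n × Fin 2 → ℝ) 1 := rfl
  rw [h, map_zero, map_one, map_one] at h1
  simp at h1

/-! ### Inclusion, restriction and Taylor expansion in the last bosonic coordinate -/

/-- The index of the last bosonic coordinate of `ℝ^{m+1|2n}`. -/
def lastIdx (m n : ℕ) : Idx (m + 1) n := Sum.inl (Fin.last m)

theorem idx_cases {p : Idx (m + 1) n → Prop} (h1 : p (lastIdx m n)) (h2 : ∀ i, p (emb i)) (i) :
    p i := by
  rcases i with i | i
  · exact Fin.lastCases (motive := fun i => p (Sum.inl i)) h1 (fun j => h2 (Sum.inl j)) i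
  · exact h2 (Sum.inr i)

theorem sum_idx_succ {V : Type*} [AddCommMonoid V] (F : Idx (m + 1) n → V) :
    ∑ i, F i = F (lastIdx m n) + ∑ i, F (emb i) := by
  rw [Fintype.sum_sum_type, Fintype.sum_sum_type, Fin.sum_univ_castSucc]
  rw [add_comm (∑ i, _) (F (Sum.inl (Fin.last m))), add_assoc]
  rfl

theorem par_emb (i : Idx m n) : par (emb i) = par i := by rcases i with i | i <;> rfl

theorem sg_emb (i j : Idx m n) : sg (emb i) (emb j) = sg i j := by
  rw [sg, par_emb, par_emb, sg]

theorem sg_last (i : Idx (m + 1) n) : sg i (lastIdx m n) = 1 := by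
  simp [sg, lastIdx, par]

theorem sg_last' (i : Idx (m + 1) n) : sg (lastIdx m n) i = 1 := by
  simp [sg, lastIdx, par]

theorem emb_injective : Function.Injective (emb : Idx m n → Idx (m + 1) n) :=
  Function.Injective.sumMap (Fin.castSucc_injective m) Function.injective_id

theorem emb_ne_last (i : Idx m n) : emb i ≠ lastIdx m n := by
  rcases i with i | i
  · simp [emb, lastIdx]
  · simp [emb, lastIdx]

/-- The inclusion `𝒫(ℝ^{m|2n}) → 𝒫(ℝ^{m+1|2n})`. -/
def incl (m n : ℕ) : SuperPoly m n →ₗ[ℝ] SuperPoly (m + 1) n :=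
  LinearMap.rTensor (ExteriorAlgebra ℝ (Fin n × Fin 2 → ℝ))
    (MvPolynomial.rename (R := ℝ) (Fin.castSucc (n := m))).toLinearMap

/-- The restriction `𝒫(ℝ^{m+1|2n}) → 𝒫(ℝ^{m|2n})` to the hyperplane `x_{m+1} = 0`. -/
def res (m n : ℕ) : SuperPoly (m + 1) n →ₗ[ℝ] SuperPoly m n :=
  LinearMap.rTensor (ExteriorAlgebra ℝ (Fin n × Fin 2 → ℝ))
    (MvPolynomial.aeval (R := ℝ)
      (Fin.lastCases (motive := fun _ => MvPolynomial (Fin m) ℝ) 0 MvPolynomial.X)).toLinearMap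

theorem incl_mk (p : MvPolynomial (Fin m) ℝ) (u : ExteriorAlgebra ℝ (Fin n × Fin 2 → ℝ)) :
    incl m n (mk p u) = mk (MvPolynomial.rename (Fin.castSucc (n := m)) p) u := rfl

theorem res_mk (p : MvPolynomial (Fin (m + 1)) ℝ) (u : ExteriorAlgebra ℝ (Fin n × Fin 2 → ℝ)) :
    res m n (mk p u) = mk (MvPolynomial.aeval (R := ℝ)
      (Fin.lastCases (motive := fun _ => MvPolynomial (Fin m) ℝ) 0 MvPolynomial.X) p) u := rfl

theorem linearMap_ext_mk {V : Type*} [AddCommGroup V] [Module ℝ V] {S T : SuperPoly m n →ₗ[ℝ] V}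
    (h : ∀ p u, S (mk p u) = T (mk p u)) : S = T :=
  TensorProduct.ext' h

theorem incl_one : incl m n (one m n) = one (m + 1) n := by
  rw [one, incl_mk, map_one]; rfl

theorem res_one : res m n (one (m + 1) n) = one m n := by
  rw [one, res_mk, map_one]; rfl

theorem incl_X (i : Idx m n) (f : SuperPoly m n) : incl m n (X i f) = X (emb i) (incl m n f) := by
  have : incl m n ∘ₗ X i = X (emb i) ∘ₗ incl m n := by
    refine linearMap_ext_mk fun p u => ?_
    rcases i with i | i
    · simp only [LinearMap.comp_apply, emb, Sum.map_inl, X_inl_mk, incl_mk, map_mul,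
        MvPolynomial.rename_X]
    · simp only [LinearMap.comp_apply, emb, Sum.map_inr, id, X_inr_mk, incl_mk]
  exact LinearMap.congr_fun this f

theorem res_X (i : Idx m n) (f : SuperPoly (m + 1) n) :
    res m n (X (emb i) f) = X i (res m n f) := by
  have : res m n ∘ₗ X (emb i) = X i ∘ₗ res m n := by
    refine linearMap_ext_mk fun p u => ?_
    rcases i with i | i
    · simp only [LinearMap.comp_apply, emb, Sum.map_inl, X_inl_mk, res_mk, map_mul,
        MvPolynomial.aeval_X, Fin.lastCases_castSucc]
    · simp only [LinearMap.comp_apply, emb, Sum.map_inr, id, X_inr_mk, res_mk]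
  exact LinearMap.congr_fun this f

theorem res_X_last (f : SuperPoly (m + 1) n) : res m n (X (lastIdx m n) f) = 0 := by
  have : res m n ∘ₗ X (lastIdx m n) = 0 := by
    refine linearMap_ext_mk fun p u => ?_
    simp only [LinearMap.comp_apply, lastIdx, X_inl_mk, res_mk, map_mul,
        MvPolynomial.aeval_X, Fin.lastCases_last, zero_mul, mk_zero_left, LinearMap.zero_apply]
  exact LinearMap.congr_fun this f

theorem incl_D (i : Idx m n) (f : SuperPoly m n) : incl m n (D i f) = D (emb i) (incl m n f) := by
  induction f using superPoly_induction with
  | h1 => rw [D_one, incl_one, D_one, map_zero]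
  | hadd f g hf hg => simp only [map_add, hf, hg]
  | hsmul c f hf => simp only [map_smul, hf]
  | hX j f hf =>
    rw [incl_X, D_X_apply, D_X_apply, map_add, map_smul, map_smul, incl_X, hf, sg_emb]
    simp only [emb_injective.eq_iff]

theorem D_last_incl (f : SuperPoly m n) : D (lastIdx m n) (incl m n f) = 0 := by
  induction f using superPoly_induction with
  | h1 => rw [incl_one, D_one]
  | hadd f g hf hg => simp only [map_add, hf, hg, add_zero]
  | hsmul c f hf => simp only [map_smul, hf, smul_zero]
  | hX j f hf =>
    rw [incl_X, D_X_apply, hf, if_neg (emb_ne_last j).symm]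
    simp

theorem res_D (i : Idx m n) (f : SuperPoly (m + 1) n) :
    res m n (D (emb i) f) = D i (res m n f) := by
  induction f using superPoly_induction with
  | h1 => rw [D_one, res_one, D_one, map_zero]
  | hadd f g hf hg => simp only [map_add, hf, hg]
  | hsmul c f hf => simp only [map_smul, hf]
  | hX j f hf =>
    induction j using idx_cases with
    | h1 =>
      rw [res_X_last, D_X_apply, map_add, map_smul, map_smul, res_X_last, if_neg (emb_ne_last i)]
      simp
    | h2 j =>
      rw [res_X, D_X_apply, D_X_apply, map_add, map_smul, map_smul, res_X, hf, sg_emb]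
      simp only [emb_injective.eq_iff]

theorem res_incl (f : SuperPoly m n) : res m n (incl m n f) = f := by
  induction f using superPoly_induction with
  | h1 => rw [incl_one, res_one]
  | hadd f g hf hg => simp only [map_add, hf, hg]
  | hsmul c f hf => simp only [map_smul, hf]
  | hX j f hf => rw [incl_X, res_X, hf]

theorem X_X_last_comm (i : Idx (m + 1) n) (f : SuperPoly (m + 1) n) :
    X i (X (lastIdx m n) f) = X (lastIdx m n) (X i f) := by
  rw [X_X_apply, sg_last, one_smul]

theorem D_D_last_comm (i : Idx (m + 1) n) (f : SuperPoly (m + 1) n) :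
    D i (D (lastIdx m n) f) = D (lastIdx m n) (D i f) := by
  rw [D_D_apply, sg_last, one_smul]

theorem D_emb_X_last (i : Idx m n) (f : SuperPoly (m + 1) n) :
    D (emb i) (X (lastIdx m n) f) = X (lastIdx m n) (D (emb i) f) := by
  rw [D_X_apply, sg_last, one_smul, if_neg (emb_ne_last i), zero_smul, add_zero]

theorem D_last_X_emb (i : Idx m n) (f : SuperPoly (m + 1) n) :
    D (lastIdx m n) (X (emb i) f) = X (emb i) (D (lastIdx m n) f) := by
  rw [D_X_apply, sg_last', one_smul, if_neg (emb_ne_last i).symm, zero_smul, add_zero]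

theorem D_last_X_last (f : SuperPoly (m + 1) n) :
    D (lastIdx m n) (X (lastIdx m n) f) = X (lastIdx m n) (D (lastIdx m n) f) + f := by
  rw [D_X_apply, sg_last', one_smul, if_pos rfl, one_smul]

theorem D_emb_X_last_pow (i : Idx m n) (j : ℕ) (f : SuperPoly (m + 1) n) :
    D (emb i) ((X (lastIdx m n) ^ j) f) = (X (lastIdx m n) ^ j) (D (emb i) f) := by
  induction j with
  | zero => rfl
  | succ j ih => rw [pow_succ', Module.End.mul_apply, D_emb_X_last, ih]; rfl

theorem X_X_last_pow (i : Idx (m + 1) n) (j : ℕ) (f : SuperPoly (m + 1) n) :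
    X i ((X (lastIdx m n) ^ j) f) = (X (lastIdx m n) ^ j) (X i f) := by
  induction j with
  | zero => rfl
  | succ j ih => rw [pow_succ', Module.End.mul_apply, X_X_last_comm, ih]; rfl

theorem D_last_pow_X_emb (i : Idx m n) (j : ℕ) (f : SuperPoly (m + 1) n) :
    (D (lastIdx m n) ^ j) (X (emb i) f) = X (emb i) ((D (lastIdx m n) ^ j) f) := by
  induction j with
  | zero => rfl
  | succ j ih => rw [pow_succ', Module.End.mul_apply, ih, D_last_X_emb]; rfl

theorem D_last_X_last_pow (j : ℕ) (f : SuperPoly (m + 1) n) :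
    D (lastIdx m n) ((X (lastIdx m n) ^ j) f)
      = (X (lastIdx m n) ^ j) (D (lastIdx m n) f) + (j : ℝ) • (X (lastIdx m n) ^ (j - 1)) f := by
  induction j with
  | zero => simp
  | succ j ih =>
    rw [pow_succ', Module.End.mul_apply, D_last_X_last, ih, map_add, map_smul,
      Module.End.mul_apply, add_assoc]
    congr 1
    rcases j with _ | j
    · simp
    · rw [Nat.add_sub_cancel, Nat.add_sub_cancel, ← Module.End.mul_apply (X (lastIdx m n)),
        ← pow_succ']
      push_cast
      module

theorem D_last_X_last_pow_incl (j : ℕ) (f : SuperPoly m n) :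
    D (lastIdx m n) ((X (lastIdx m n) ^ j) (incl m n f))
      = (j : ℝ) • (X (lastIdx m n) ^ (j - 1)) (incl m n f) := by
  rw [D_last_X_last_pow, D_last_incl, map_zero, zero_add]

theorem D_last_pow_X_last (j : ℕ) (f : SuperPoly (m + 1) n) :
    (D (lastIdx m n) ^ j) (X (lastIdx m n) f)
      = X (lastIdx m n) ((D (lastIdx m n) ^ j) f) + (j : ℝ) • (D (lastIdx m n) ^ (j - 1)) f := by
  induction j with
  | zero => simp
  | succ j ih =>
    rw [pow_succ', Module.End.mul_apply, ih, map_add, map_smul, D_last_X_last,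
      Module.End.mul_apply, add_assoc]
    congr 1
    rcases j with _ | j
    · simp
    · rw [Nat.add_sub_cancel, Nat.add_sub_cancel, ← Module.End.mul_apply (D (lastIdx m n)),
        ← pow_succ']
      push_cast
      module

theorem res_X_last_pow_incl (j : ℕ) (f : SuperPoly m n) :
    res m n ((X (lastIdx m n) ^ j) (incl m n f)) = if j = 0 then f else 0 := by
  rcases j with _ | j
  · simp [res_incl]
  · rw [pow_succ', Module.End.mul_apply, res_X_last, if_neg (Nat.succ_ne_zero j)]

/-- The `j`-th coefficient of a superpolynomial with respect to the last bosonic coordinate. -/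
def coeff (j : ℕ) (f : SuperPoly (m + 1) n) : SuperPoly m n :=
  ((j.factorial : ℝ)⁻¹) • res m n ((D (lastIdx m n) ^ j) f)

/-- Since f is not assumed homogeneous, the length of the expansion is a threshold rather than one
value; two expansions can then be added at a common length. -/
theorem exists_taylor (f : SuperPoly (m + 1) n) : ∃ K₀ : ℕ, ∀ K, K₀ ≤ K →
    ∑ j ∈ Finset.range K, (X (lastIdx m n) ^ j) (incl m n (coeff j f)) = f := by
  induction f using superPoly_induction with
  | h1 =>
    refine ⟨1, fun K hK => ?_⟩
    obtain ⟨K, rfl⟩ := Nat.exists_eq_add_of_le' hK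
    rw [Finset.sum_range_succ', Finset.sum_eq_zero]
    · simp [coeff, res_one, incl_one]
    · intro j _
      rw [coeff, pow_succ (D _) j, Module.End.mul_apply, D_one]
      simp
  | hadd f g hf hg =>
    obtain ⟨K₁, h₁⟩ := hf
    obtain ⟨K₂, h₂⟩ := hg
    refine ⟨max K₁ K₂, fun K hK => ?_⟩
    have h1 := h₁ K (le_of_max_le_left hK)
    have h2 := h₂ K (le_of_max_le_right hK)
    conv_rhs => rw [← h1, ← h2]
    rw [← Finset.sum_add_distrib]
    simp only [coeff, map_add, smul_add]
  | hsmul c f hf =>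
    obtain ⟨K₁, h₁⟩ := hf
    refine ⟨K₁, fun K hK => ?_⟩
    conv_rhs => rw [← h₁ K hK]
    rw [Finset.smul_sum]
    refine Finset.sum_congr rfl fun j _ => ?_
    simp only [coeff, map_smul]
    rw [smul_comm]
  | hX i f hf =>
    obtain ⟨K₁, h₁⟩ := hf
    induction i using idx_cases with
    | h1 =>
      refine ⟨K₁ + 1, fun K hK => ?_⟩
      obtain ⟨K, rfl⟩ : ∃ K', K = K' + 1 := ⟨K - 1, by omega⟩
      conv_rhs => rw [← h₁ K (by omega)]
      rw [Finset.sum_range_succ', map_sum]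
      have h0 : coeff 0 (X (lastIdx m n) f) = 0 := by simp [coeff, res_X_last]
      rw [h0, map_zero, map_zero, add_zero]
      refine Finset.sum_congr rfl fun j _ => ?_
      have : coeff (j + 1) (X (lastIdx m n) f) = coeff j f := by
        rw [coeff, D_last_pow_X_last, map_add, res_X_last, zero_add, map_smul, smul_smul, coeff,
          Nat.add_sub_cancel, Nat.factorial_succ]
        congr 1
        have : ((j + 1 : ℕ) : ℝ) ≠ 0 := by positivity
        have : ((j.factorial : ℕ) : ℝ) ≠ 0 := by positivity
        push_cast
        field_simp
      rw [this, pow_succ', Module.End.mul_apply]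
    | h2 i =>
      refine ⟨K₁, fun K hK => ?_⟩
      conv_rhs => rw [← h₁ K hK]
      rw [map_sum]
      refine Finset.sum_congr rfl fun j _ => ?_
      rw [X_X_last_pow, ← incl_X, coeff, coeff, D_last_pow_X_emb, res_X, map_smul (X i)]

theorem eq_zero_of_res_D_pow {f : SuperPoly (m + 1) n}
    (h : ∀ j, res m n ((D (lastIdx m n) ^ j) f) = 0) : f = 0 := by
  obtain ⟨K, hK⟩ := exists_taylor f
  rw [← hK K le_rfl]
  exact Finset.sum_eq_zero fun j _ => by simp [coeff, h]

theorem euler_succ_apply (f : SuperPoly (m + 1) n) :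
    euler (m + 1) n f = X (lastIdx m n) (D (lastIdx m n) f) + ∑ i, X (emb i) (D (emb i) f) := by
  rw [euler_apply, sum_idx_succ]

theorem euler_incl (f : SuperPoly m n) :
    euler (m + 1) n (incl m n f) = incl m n (euler m n f) := by
  rw [euler_succ_apply, D_last_incl, map_zero, zero_add, euler_apply, map_sum]
  simp only [incl_X, incl_D]

theorem euler_res (f : SuperPoly (m + 1) n) :
    euler m n (res m n f) = res m n (euler (m + 1) n f) := by
  rw [euler_succ_apply, map_add, res_X_last, zero_add, euler_apply, map_sum]
  simp only [res_X, res_D]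

theorem euler_pow_of {f : SuperPoly m n} {μ ν : ℝ} {T : Module.End ℝ (SuperPoly m n)}
    (hT : ∀ (g : SuperPoly m n) (μ : ℝ), euler m n g = μ • g →
      euler m n (T g) = (μ + ν) • T g) (h : euler m n f = μ • f) (j : ℕ) :
    euler m n ((T ^ j) f) = (μ + j * ν) • (T ^ j) f := by
  induction j with
  | zero => simpa using h
  | succ j ih =>
    rw [pow_succ', Module.End.mul_apply, hT _ _ ih]
    push_cast
    congr 1
    ring

theorem euler_D_pow_of {f : SuperPoly m n} {μ : ℝ} (h : euler m n f = μ • f) (i : Idx m n)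
    (j : ℕ) : euler m n ((D i ^ j) f) = (μ - j) • (D i ^ j) f := by
  have := euler_pow_of (ν := -1) (fun g μ hg => by simpa [sub_eq_add_neg] using euler_D_of hg i) h j
  rw [this]; congr 1; ring

theorem euler_X_pow_of {f : SuperPoly m n} {μ : ℝ} (h : euler m n f = μ • f) (i : Idx m n)
    (j : ℕ) : euler m n ((X i ^ j) f) = (μ + j) • (X i ^ j) f := by
  have := euler_pow_of (ν := 1) (fun g μ hg => euler_X_of hg i) h j
  rw [this]; congr 1; ring

theorem euler_lap_pow_of {f : SuperPoly m n} {μ : ℝ} (h : euler m n f = μ • f)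
    (j : ℕ) : euler m n ((lap m n ^ j) f) = (μ - 2 * j) • (lap m n ^ j) f := by
  have := euler_pow_of (ν := -2)
    (fun g μ hg => by simpa [sub_eq_add_neg] using euler_lap_of hg) h j
  rw [this]; congr 1; ring

theorem euler_Rsq_pow_of {f : SuperPoly m n} {μ : ℝ} (h : euler m n f = μ • f)
    (j : ℕ) : euler m n ((Rsq m n ^ j) f) = (μ + 2 * j) • (Rsq m n ^ j) f := by
  have := euler_pow_of (ν := 2) (fun g μ hg => euler_Rsq_of hg) h j
  rw [this]; congr 1; ring

theorem euler_coeff {f : SuperPoly (m + 1) n} {μ : ℝ} (h : euler (m + 1) n f = μ • f) (j : ℕ) :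
    euler m n (coeff j f) = (μ - j) • coeff j f := by
  rw [coeff, map_smul, euler_res, euler_D_pow_of h, map_smul, smul_comm]

theorem taylor {f : SuperPoly (m + 1) n} {k : ℕ} (h : euler (m + 1) n f = (k : ℝ) • f) :
    ∑ j ∈ Finset.range (k + 1), (X (lastIdx m n) ^ j) (incl m n (coeff j f)) = f := by
  obtain ⟨K, hK⟩ := exists_taylor f
  refine Eq.trans ?_ (hK (K + (k + 1)) (by omega))
  refine Finset.sum_subset (Finset.range_mono (by omega)) fun j _ hj => ?_
  rw [eq_zero_of_euler_neg (euler_coeff h j), map_zero, map_zero]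
  have : k < j := by simpa using hj
  have : (k : ℝ) < j := by exact_mod_cast this
  linarith

theorem lap_succ_apply (f : SuperPoly (m + 1) n) :
    lap (m + 1) n f = D (lastIdx m n) (D (lastIdx m n) f)
      + (∑ j : Fin m, D (emb (Sum.inl j)) (D (emb (Sum.inl j)) f)
        - (4 : ℝ) • ∑ j : Fin n, D (emb (Sum.inr (j, 0))) (D (emb (Sum.inr (j, 1))) f)) := by
  rw [lap, Fin.sum_univ_castSucc]
  simp only [LinearMap.sub_apply, LinearMap.add_apply, LinearMap.sum_apply, Module.End.mul_apply,
    LinearMap.smul_apply, lastIdx, emb, Sum.map_inl, Sum.map_inr, id]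
  abel

theorem lap_apply (f : SuperPoly m n) : lap m n f =
    ∑ j : Fin m, D (Sum.inl j) (D (Sum.inl j) f)
        - (4 : ℝ) • ∑ j : Fin n, D (Sum.inr (j, 0)) (D (Sum.inr (j, 1)) f) := by
  simp [lap, LinearMap.sum_apply]

/-- Δ is ∂² in the last variable plus the Laplacian of the hyperplane. The truncated exponent j - 2
is harmless, its coefficient being zero for j ≤ 1. -/
theorem lap_X_last_pow_incl (j : ℕ) (f : SuperPoly m n) :
    lap (m + 1) n ((X (lastIdx m n) ^ j) (incl m n f))
      = ((j : ℝ) * ((j - 1 : ℕ) : ℝ)) • (X (lastIdx m n) ^ (j - 2)) (incl m n f)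
        + (X (lastIdx m n) ^ j) (incl m n (lap m n f)) := by
  rw [lap_succ_apply, D_last_X_last_pow_incl, map_smul, D_last_X_last_pow_incl, smul_smul,
    lap_apply]
  simp only [D_emb_X_last_pow, ← incl_D, map_sub, map_sum, map_smul]
  rfl

theorem res_lap (f : SuperPoly (m + 1) n) :
    res m n (lap (m + 1) n f) = res m n (D (lastIdx m n) (D (lastIdx m n) f))
      + lap m n (res m n f) := by
  rw [lap_succ_apply, lap_apply]
  simp only [map_add, map_sub, map_sum, map_smul, res_D]

theorem Rsq_succ_apply (f : SuperPoly (m + 1) n) :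
    Rsq (m + 1) n f = X (lastIdx m n) (X (lastIdx m n) f)
      + (∑ j : Fin m, X (emb (Sum.inl j)) (X (emb (Sum.inl j)) f)
        - ∑ j : Fin n, X (emb (Sum.inr (j, 0))) (X (emb (Sum.inr (j, 1))) f)) := by
  rw [Rsq, Fin.sum_univ_castSucc]
  simp only [LinearMap.sub_apply, LinearMap.add_apply, LinearMap.sum_apply, Module.End.mul_apply,
    lastIdx, emb, Sum.map_inl, Sum.map_inr, id]
  abel

theorem Rsq_apply (f : SuperPoly m n) : Rsq m n f =
    ∑ j : Fin m, X (Sum.inl j) (X (Sum.inl j) f)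
        - ∑ j : Fin n, X (Sum.inr (j, 0)) (X (Sum.inr (j, 1)) f) := by
  simp [Rsq, LinearMap.sum_apply]

theorem Rsq_incl (f : SuperPoly m n) :
    Rsq (m + 1) n (incl m n f) = X (lastIdx m n) (X (lastIdx m n) (incl m n f))
      + incl m n (Rsq m n f) := by
  rw [Rsq_succ_apply, Rsq_apply]
  simp only [map_sub, map_sum, incl_X]

theorem parity_incl (f : SuperPoly m n) :
    parity (m + 1) n (incl m n f) = incl m n (parity m n f) := by
  have hX : ∀ {m : ℕ} (i : Idx m n) (f : SuperPoly m n),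
      parity m n (X i f) = (-1 : ℝ) ^ par i • X i (parity m n f) := fun i f =>
    LinearMap.congr_fun (parity_X i) f
  induction f using superPoly_induction with
  | h1 => rw [incl_one, parity_one, parity_one, incl_one]
  | hadd f g hf hg => simp only [map_add, hf, hg]
  | hsmul c f hf => simp only [map_smul, hf]
  | hX j f hf => rw [incl_X, hX, hf, hX, map_smul, incl_X, par_emb]

theorem parity_X_last_pow (j : ℕ) (f : SuperPoly (m + 1) n) :
    parity (m + 1) n ((X (lastIdx m n) ^ j) f) = (X (lastIdx m n) ^ j) (parity (m + 1) n f) := by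
  have hX : ∀ f, parity (m + 1) n (X (lastIdx m n) f) = X (lastIdx m n) (parity (m + 1) n f) := by
    intro f
    have := LinearMap.congr_fun (parity_X (lastIdx m n)) f
    simpa [par, lastIdx] using this
  induction j with
  | zero => rfl
  | succ j ih => rw [pow_succ', Module.End.mul_apply, hX, ih]; rfl

theorem act_apply (A : Matrix (Idx m n) (Idx m n) ℝ) (f : SuperPoly m n) :
    act A f = ∑ i, ∑ j, A i j • X i (D j f) := by
  simp [act, LinearMap.sum_apply]

theorem extendMatrix_emb (A : Matrix (Idx m n) (Idx m n) ℝ) (i j : Idx m n) :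
    extendMatrix A (emb i) (emb j) = A i j := by
  simp [extendMatrix, Matrix.mul_apply, embMatrix, emb_injective.eq_iff]

theorem extendMatrix_last (A : Matrix (Idx m n) (Idx m n) ℝ) (i : Idx (m + 1) n) :
    extendMatrix A (lastIdx m n) i = 0 := by
  simp [extendMatrix, Matrix.mul_apply, embMatrix, (emb_ne_last _).symm]

theorem extendMatrix_last' (A : Matrix (Idx m n) (Idx m n) ℝ) (i : Idx (m + 1) n) :
    extendMatrix A i (lastIdx m n) = 0 := by
  simp [extendMatrix, Matrix.mul_apply, embMatrix, (emb_ne_last _).symm]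

theorem act_extendMatrix_apply (A : Matrix (Idx m n) (Idx m n) ℝ) (f : SuperPoly (m + 1) n) :
    act (extendMatrix A) f = ∑ i, ∑ j, A i j • X (emb i) (D (emb j) f) := by
  rw [act_apply, sum_idx_succ]
  simp only [extendMatrix_last, zero_smul, Finset.sum_const_zero, zero_add]
  refine Finset.sum_congr rfl fun i _ => ?_
  rw [sum_idx_succ]
  simp only [extendMatrix_last', zero_smul, zero_add, extendMatrix_emb]

theorem act_X_last_pow_incl (A : Matrix (Idx m n) (Idx m n) ℝ) (j : ℕ) (f : SuperPoly m n) :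
    act (extendMatrix A) ((X (lastIdx m n) ^ j) (incl m n f))
      = (X (lastIdx m n) ^ j) (incl m n (act A f)) := by
  rw [act_extendMatrix_apply, act_apply]
  simp only [map_sum, map_smul, incl_X, D_emb_X_last_pow, X_X_last_pow, incl_D]

theorem res_act (A : Matrix (Idx m n) (Idx m n) ℝ) (f : SuperPoly (m + 1) n) :
    res m n (act (extendMatrix A) f) = act A (res m n f) := by
  rw [act_extendMatrix_apply, act_apply]
  simp only [map_sum, map_smul, res_X, res_D]

theorem D_last_act (A : Matrix (Idx m n) (Idx m n) ℝ) (f : SuperPoly (m + 1) n) :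
    D (lastIdx m n) (act (extendMatrix A) f) = act (extendMatrix A) (D (lastIdx m n) f) := by
  rw [act_extendMatrix_apply, act_extendMatrix_apply]
  simp only [map_sum, map_smul, D_last_X_emb, D_D_last_comm]

theorem euler_X_last_pow_incl {f : SuperPoly m n} {μ : ℝ} (h : euler m n f = μ • f) (j : ℕ) :
    euler (m + 1) n ((X (lastIdx m n) ^ j) (incl m n f))
      = (μ + j) • (X (lastIdx m n) ^ j) (incl m n f) :=
  euler_X_pow_of (by rw [euler_incl, h, map_smul]) _ j

/-! ### Cauchy-Kovalevskaya extension -/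

/-- The harmonic extension of `f(x')·x^s / s!` (`s = 0, 1`), up to the order `K`. -/
def ck (s K : ℕ) : SuperPoly m n →ₗ[ℝ] SuperPoly (m + 1) n :=
  ∑ j ∈ Finset.range (K + 1), ((-1 : ℝ) ^ j / ((2 * j + s).factorial : ℝ)) •
    ((X (lastIdx m n) ^ (2 * j + s)) ∘ₗ incl m n ∘ₗ (lap m n ^ j))

theorem ck_apply (s K : ℕ) (f : SuperPoly m n) : ck s K f =
    ∑ j ∈ Finset.range (K + 1), ((-1 : ℝ) ^ j / ((2 * j + s).factorial : ℝ)) •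
      (X (lastIdx m n) ^ (2 * j + s)) (incl m n ((lap m n ^ j) f)) := by
  simp [ck, LinearMap.sum_apply]

/-- The sum telescopes: ∂² of each term cancels the hyperplane Laplacian of the preceding one. For s
≤ 1 the first term has no ∂², so only the tail remains. -/
theorem lap_ck {s : ℕ} (hs : s ≤ 1) (K : ℕ) (f : SuperPoly m n) :
    lap (m + 1) n (ck s K f) = ((-1 : ℝ) ^ K / ((2 * K + s).factorial : ℝ)) •
      (X (lastIdx m n) ^ (2 * K + s)) (incl m n ((lap m n ^ (K + 1)) f)) := by
  rw [ck_apply, map_sum]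
  induction K with
  | zero =>
    rw [Finset.sum_range_one, map_smul, lap_X_last_pow_incl]
    interval_cases s <;> simp
  | succ K ih =>
    rw [Finset.sum_range_succ, ih, map_smul, lap_X_last_pow_incl, smul_add, smul_smul]
    rw [← add_assoc, ← Module.End.mul_apply (lap m n) ((lap m n) ^ (K + 1)), ← pow_succ']
    convert zero_add _ using 2
    rw [show 2 * (K + 1) + s - 2 = 2 * K + s by omega, ← add_smul]
    convert zero_smul ℝ _ using 2
    rw [show 2 * (K + 1) + s - 1 = 2 * K + s + 1 by omega,
      show 2 * (K + 1) + s = 2 * K + s + 1 + 1 by omega, Nat.factorial_succ, Nat.factorial_succ]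
    have h1 : ((2 * K + s + 1 + 1 : ℕ) : ℝ) ≠ 0 := by positivity
    have h2 : ((2 * K + s + 1 : ℕ) : ℝ) ≠ 0 := by positivity
    have h3 : ((2 * K + s).factorial : ℝ) ≠ 0 := by positivity
    push_cast at h1 h2 ⊢
    field_simp
    ring

theorem euler_ck {f : SuperPoly m n} {μ : ℝ} (h : euler m n f = μ • f) (s K : ℕ) :
    euler (m + 1) n (ck s K f) = (μ + s) • ck s K f := by
  rw [ck_apply, map_sum, Finset.smul_sum]
  refine Finset.sum_congr rfl fun j _ => ?_
  rw [map_smul, euler_X_last_pow_incl (euler_lap_pow_of h j), smul_comm]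
  congr 1
  push_cast
  ring

theorem act_ck {A : Matrix (Idx m n) (Idx m n) ℝ} (hA : A ∈ osp m n) (s K : ℕ)
    (f : SuperPoly m n) : act (extendMatrix A) (ck s K f) = ck s K (act A f) := by
  rw [ck_apply, map_sum, ck_apply]
  refine Finset.sum_congr rfl fun j _ => ?_
  rw [map_smul, act_X_last_pow_incl]
  congr 3
  exact LinearMap.congr_fun (((lap_act hA).pow_left j).eq).symm f

theorem parity_ck (s K : ℕ) (f : SuperPoly m n) :
    parity (m + 1) n (ck s K f) = ck s K (parity m n f) := by
  rw [ck_apply, map_sum, ck_apply]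
  refine Finset.sum_congr rfl fun j _ => ?_
  rw [map_smul, parity_X_last_pow, parity_incl]
  congr 3
  exact LinearMap.congr_fun (((parity_lap m n).pow_left j).eq).symm f

theorem res_ck_zero (K : ℕ) (f : SuperPoly m n) : res m n (ck 0 K f) = f := by
  rw [ck_apply, map_sum, Finset.sum_range_succ', Finset.sum_eq_zero]
  · simp [res_incl]
  · intro j _
    rw [map_smul, res_X_last_pow_incl, if_neg (by omega), smul_zero]

theorem res_ck_one (K : ℕ) (f : SuperPoly m n) : res m n (ck 1 K f) = 0 := by
  rw [ck_apply, map_sum, Finset.sum_eq_zero]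
  intro j _
  rw [map_smul, res_X_last_pow_incl, if_neg (by omega), smul_zero]

theorem res_D_ck_zero (K : ℕ) (f : SuperPoly m n) :
    res m n (D (lastIdx m n) (ck 0 K f)) = 0 := by
  rw [ck_apply, map_sum, map_sum, Finset.sum_eq_zero]
  intro j _
  rw [map_smul, D_last_X_last_pow_incl, map_smul, map_smul, res_X_last_pow_incl]
  split_ifs with h
  · obtain rfl : j = 0 := by omega
    simp
  · simp

theorem res_D_ck_one (K : ℕ) (f : SuperPoly m n) :
    res m n (D (lastIdx m n) (ck 1 K f)) = f := by
  rw [ck_apply, map_sum, map_sum, Finset.sum_range_succ', Finset.sum_eq_zero]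
  · simp [D_last_X_last, D_last_incl, res_incl]
  · intro j _
    rw [map_smul, D_last_X_last_pow_incl, map_smul, map_smul, res_X_last_pow_incl,
      if_neg (by omega), smul_zero, smul_zero]

/-- The remaining tail contains Δ^{K+1}f, which would have negative degree. -/
theorem lap_ck_eq_zero {f : SuperPoly m n} {μ : ℝ} (h : euler m n f = μ • f) {s K : ℕ}
    (hs : s ≤ 1) (hK : μ ≤ K) : lap (m + 1) n (ck s K f) = 0 := by
  rw [lap_ck hs, eq_zero_of_euler_neg (euler_lap_pow_of h (K + 1)), map_zero, map_zero, smul_zero]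
  push_cast
  have : (0 : ℝ) ≤ K := K.cast_nonneg
  linarith

/-- Uniqueness in the Cauchy problem. All derivatives ∂^j f are harmonic, so on the hyperplane
∂^{j+2}f is minus the hyperplane Laplacian of ∂^j f; two vanishing data kill every Taylor
coefficient. -/
theorem eq_zero_of_lap_of_res {f : SuperPoly (m + 1) n} (h : lap (m + 1) n f = 0)
    (h0 : res m n f = 0) (h1 : res m n (D (lastIdx m n) f) = 0) : f = 0 := by
  have hD : ∀ j : ℕ, lap (m + 1) n ((D (lastIdx m n) ^ j) f) = 0 := by
    intro j
    have : Commute (lap (m + 1) n) (D (lastIdx m n) ^ j) :=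
      Commute.pow_right (lap_mul_D (lastIdx m n)) j
    rw [← Module.End.mul_apply, this.eq, Module.End.mul_apply, h, map_zero]
  refine eq_zero_of_res_D_pow fun j => ?_
  induction j using Nat.twoStepInduction with
  | zero => simpa using h0
  | one => simpa using h1
  | more j ih _ =>
    have := res_lap ((D (lastIdx m n) ^ j) f)
    rw [hD, map_zero, ih, map_zero, add_zero] at this
    rw [pow_succ', pow_succ', Module.End.mul_apply, Module.End.mul_apply, ← this]

/-! ### Harmonics as generalized eigenspaces of the Casimir operator -/

theorem mem_Homog {k : ℕ} {f : SuperPoly m n} :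
    f ∈ Homog m n k ↔ euler m n f = (k : ℝ) • f := Module.End.mem_eigenspace_iff

theorem mem_Harm {k : ℕ} {f : SuperPoly m n} :
    f ∈ Harm m n k ↔ euler m n f = (k : ℝ) • f ∧ lap m n f = 0 := by
  rw [Harm, Submodule.mem_inf, mem_Homog, LinearMap.mem_ker]

theorem mem_GenHarm {k : ℕ} {f : SuperPoly m n} :
    f ∈ GenHarm m n k ↔ euler m n f = (k : ℝ) • f ∧ lap m n (Rsq m n (lap m n f)) = 0 := by
  rw [GenHarm, Submodule.mem_inf, mem_Homog, LinearMap.mem_ker]; rfl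

/-- The eigenvalue `ℓ(ℓ + M - 2)` of the Casimir operator on `ℋ_ℓ`. -/
def cas (m n l : ℕ) : ℝ := l * (l + (superdim m n : ℝ) - 2)

/-- The difference of the values factors as (a - b)(a + b - (2 - M)). That at most two degrees share
a value is the origin of the exceptional indices and the reason why (C - c)² suffices. -/
theorem cas_eq_iff (a b : ℕ) : cas m n a = cas m n b ↔ a = b ∨ (a : ℤ) + b = 2 - superdim m n := by
  have h : cas m n a = cas m n b ↔ ((a : ℝ) - b) * ((a : ℝ) + b - (2 - superdim m n)) = 0 := by
    rw [cas, cas]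
    constructor <;> intro h <;> linarith
  rw [h, mul_eq_zero, sub_eq_zero, sub_eq_zero, Nat.cast_inj]
  refine or_congr Iff.rfl ?_
  rw [← @Int.cast_inj ℝ]
  push_cast
  rfl

theorem casimir_apply (f : SuperPoly m n) : casimir m n f = euler m n (euler m n f)
    + ((superdim m n : ℝ) - 2) • euler m n f - Rsq m n (lap m n f) := rfl

theorem Rsq_lap_of {k : ℕ} {f : SuperPoly m n} (h : euler m n f = (k : ℝ) • f) :
    Rsq m n (lap m n f) = cas m n k • f - casimir m n f := by
  rw [casimir_apply, h, map_smul, h, cas]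
  module

/-- With `Rsq_lap_of` in degree k + 2, both composites of R² and Δ between degrees k and k + 2 are
`cas m n (k + 2)` - C, hence invertible on eigenspaces for any other value. -/
theorem lap_Rsq_of {k : ℕ} {f : SuperPoly m n} (h : euler m n f = (k : ℝ) • f) :
    lap m n (Rsq m n f) = cas m n (k + 2) • f - casimir m n f := by
  have := LinearMap.congr_fun (lap_mul_Rsq m n) f
  simp only [Module.End.mul_apply, LinearMap.add_apply, LinearMap.smul_apply, Module.End.one_apply,
    h, Rsq_lap_of h] at this
  rw [this, cas, cas]
  push_cast
  module

theorem casimir_of_lap_eq_zero {k : ℕ} {f : SuperPoly m n} (h : euler m n f = (k : ℝ) • f)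
    (hl : lap m n f = 0) : casimir m n f = cas m n k • f := by
  have := Rsq_lap_of h
  rw [hl, map_zero] at this
  exact (sub_eq_zero.mp this.symm).symm

/-- The generalized eigenspace `{f ∈ 𝒫_k | (C - c)² f = 0}` of the Casimir operator `C`. -/
def casEigen (m n k : ℕ) (c : ℝ) : Submodule ℝ (SuperPoly m n) :=
  Homog m n k ⊓ LinearMap.ker ((casimir m n - c • 1) * (casimir m n - c • 1))

theorem sub_smul_one_apply {V : Type*} [AddCommGroup V] [Module ℝ V] (T : Module.End ℝ V) (c : ℝ)
    (f : V) : (T - c • 1) f = T f - c • f := rfl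

theorem mem_casEigen {k : ℕ} {c : ℝ} {f : SuperPoly m n} : f ∈ casEigen m n k c ↔
    euler m n f = (k : ℝ) • f ∧ casimir m n (casimir m n f - c • f)
      = c • (casimir m n f - c • f) := by
  rw [casEigen, Submodule.mem_inf, mem_Homog, LinearMap.mem_ker, Module.End.mul_apply,
    sub_smul_one_apply, sub_smul_one_apply, sub_eq_zero]

theorem mem_casEigen_of_casimir {k : ℕ} {c : ℝ} {f : SuperPoly m n}
    (h : euler m n f = (k : ℝ) • f) (hc : casimir m n f = c • f) : f ∈ casEigen m n k c := by
  rw [mem_casEigen, hc, sub_self, map_zero, smul_zero]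
  exact ⟨h, rfl⟩

theorem casEigen_map {k l : ℕ} {c : ℝ} {T : Module.End ℝ (SuperPoly m n)}
    (hT : Commute (casimir m n) T)
    (hE : ∀ f, euler m n f = (k : ℝ) • f → euler m n (T f) = (l : ℝ) • T f)
    {f : SuperPoly m n} (hf : f ∈ casEigen m n k c) : T f ∈ casEigen m n l c := by
  have hT' : ∀ g, casimir m n (T g) = T (casimir m n g) := LinearMap.congr_fun hT.eq
  rw [mem_casEigen] at hf ⊢
  refine ⟨hE f hf.1, ?_⟩
  rw [hT', ← map_smul, ← map_sub, hT', hf.2, map_smul]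

theorem casimir_mem_casEigen {k : ℕ} {c : ℝ} {f : SuperPoly m n} (hf : f ∈ casEigen m n k c) :
    casimir m n f ∈ casEigen m n k c :=
  casEigen_map (Commute.refl _) (fun _ h => euler_comm_of (casimir_comm_euler m n).symm h) hf

theorem Rsq_mem_casEigen {k : ℕ} {c : ℝ} {f : SuperPoly m n} (hf : f ∈ casEigen m n k c) :
    Rsq m n f ∈ casEigen m n (k + 2) c :=
  casEigen_map (casimir_comm_Rsq m n) (fun _ h => by rw [euler_Rsq_of h]; push_cast; rfl) hf

theorem lap_mem_casEigen {k : ℕ} {c : ℝ} {f : SuperPoly m n} (hf : f ∈ casEigen m n (k + 2) c) :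
    lap m n f ∈ casEigen m n k c :=
  casEigen_map (casimir_comm_lap m n)
    (fun _ h => by rw [euler_lap_of h]; push_cast; congr 1; ring) hf

theorem Rsq_pow_mem_casEigen {k : ℕ} {c : ℝ} {f : SuperPoly m n} (hf : f ∈ casEigen m n k c)
    (j : ℕ) : (Rsq m n ^ j) f ∈ casEigen m n (k + 2 * j) c := by
  induction j with
  | zero => exact hf
  | succ j ih =>
    rw [pow_succ', Module.End.mul_apply]
    exact Rsq_mem_casEigen ih

theorem eq_zero_of_mem_casEigen_of_casimir {k : ℕ} {c d : ℝ} (hcd : c ≠ d) {f : SuperPoly m n}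
    (hf : f ∈ casEigen m n k c) (h : casimir m n f = d • f) : f = 0 := by
  have h2 := (mem_casEigen.mp hf).2
  rw [h, ← sub_smul, map_smul, h, smul_smul, smul_smul, ← sub_eq_zero, ← sub_smul] at h2
  refine (smul_eq_zero.mp h2).resolve_left ?_
  rw [show (d - c) * d - c * (d - c) = (d - c) * (d - c) by ring]
  exact mul_ne_zero (sub_ne_zero.mpr hcd.symm) (sub_ne_zero.mpr hcd.symm)

theorem eq_zero_of_Rsq_eq_zero {k : ℕ} {c : ℝ} (hc : c ≠ cas m n (k + 2)) {f : SuperPoly m n}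
    (hf : f ∈ casEigen m n k c) (h : Rsq m n f = 0) : f = 0 := by
  have h1 := lap_Rsq_of (mem_casEigen.mp hf).1
  rw [h, map_zero] at h1
  exact eq_zero_of_mem_casEigen_of_casimir hc hf (sub_eq_zero.mp h1.symm).symm

theorem exists_sub_casimir {k : ℕ} {c d : ℝ} (hc : c ≠ d) {f : SuperPoly m n}
    (hf : f ∈ casEigen m n k c) : ∃ g ∈ casEigen m n k c, d • g - casimir m n g = f := by
  have h2 := (mem_casEigen.mp hf).2
  have hδ : d - c ≠ 0 := sub_ne_zero.mpr hc.symm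
  -- With N = C - c and N² = 0, the inverse of d - C = (d - c) - N is (d - c)⁻²((d - c) + N).
  refine ⟨((d - c)⁻¹ * (d - c)⁻¹) • ((d - c) • f + (casimir m n f - c • f)),
    Submodule.smul_mem _ _ (Submodule.add_mem _ (Submodule.smul_mem _ _ hf)
      (Submodule.sub_mem _ (casimir_mem_casEigen hf) (Submodule.smul_mem _ _ hf))), ?_⟩
  rw [map_smul, map_add, h2, map_smul]
  have : ((d - c)⁻¹ * (d - c)⁻¹ * ((d - c) * (d - c))) • f = f := by
    rw [show (d - c)⁻¹ * (d - c)⁻¹ * ((d - c) * (d - c)) = 1 by field_simp, one_smul]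
  conv_rhs => rw [← this]
  module

/-- In degree k + 2 one has R²Δ = `cas m n (k + 2)` - C, so the preimage is Δ applied to the inverse
of this operator at f. -/
theorem exists_Rsq_eq {k : ℕ} {c : ℝ} (hc : c ≠ cas m n (k + 2)) {f : SuperPoly m n}
    (hf : f ∈ casEigen m n (k + 2) c) : ∃ g ∈ casEigen m n k c, Rsq m n g = f := by
  obtain ⟨g, hg, h⟩ := exists_sub_casimir hc hf
  exact ⟨lap m n g, lap_mem_casEigen hg, by rw [Rsq_lap_of (mem_casEigen.mp hg).1, h]⟩

theorem lap_eq_zero_of_lt_two {k : ℕ} (hk : k < 2) {f : SuperPoly m n}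
    (hf : euler m n f = (k : ℝ) • f) : lap m n f = 0 := by
  refine eq_zero_of_euler_neg (euler_lap_of hf) ?_
  have : (k : ℝ) < 2 := by exact_mod_cast hk
  linarith

/-- R² lets an element descend two degrees at a time as long as the value is not met, down to degree
0 or 1, where everything is harmonic. -/
theorem casEigen_eq_zero {k : ℕ} {c : ℝ} (hc : ∀ l ≤ k, l % 2 = k % 2 → c ≠ cas m n l)
    {f : SuperPoly m n} (hf : f ∈ casEigen m n k c) : f = 0 := by
  induction k using Nat.strong_induction_on generalizing f with
  | _ k ih =>
    rcases lt_or_ge k 2 with hk | hk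
    · have h1 := (mem_casEigen.mp hf).1
      exact eq_zero_of_mem_casEigen_of_casimir (hc k le_rfl rfl) hf
        (casimir_of_lap_eq_zero h1 (lap_eq_zero_of_lt_two hk h1))
    · obtain ⟨k, rfl⟩ := Nat.exists_eq_add_of_le' hk
      obtain ⟨g, hg, rfl⟩ := exists_Rsq_eq (hc _ le_rfl rfl) hf
      rw [ih k (by omega) (fun l hl h => hc l (by omega) (by omega)) hg, map_zero]

theorem exists_Rsq_pow_eq {q j : ℕ} {c : ℝ}
    (hc : ∀ l ≤ q + 2 * j, q < l → l % 2 = q % 2 → c ≠ cas m n l) {f : SuperPoly m n}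
    (hf : f ∈ casEigen m n (q + 2 * j) c) : ∃ g ∈ casEigen m n q c, (Rsq m n ^ j) g = f := by
  induction j generalizing f with
  | zero => exact ⟨f, hf, rfl⟩
  | succ j ih =>
    obtain ⟨g, hg, rfl⟩ := exists_Rsq_eq (k := q + 2 * j) (hc _ le_rfl (by omega) (by omega)) hf
    obtain ⟨h, hh, rfl⟩ := ih (fun l hl => hc l (by omega)) hg
    exact ⟨h, hh, by rw [pow_succ', Module.End.mul_apply]⟩

theorem eq_zero_of_Rsq_pow_eq_zero {q j : ℕ} {c : ℝ}
    (hc : ∀ l ≤ q + 2 * j, q < l → l % 2 = q % 2 → c ≠ cas m n l) {f : SuperPoly m n}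
    (hf : f ∈ casEigen m n q c) (h : (Rsq m n ^ j) f = 0) : f = 0 := by
  induction j with
  | zero => exact h
  | succ j ih =>
    refine ih (fun l hl => hc l (by omega)) ?_
    rw [pow_succ', Module.End.mul_apply] at h
    exact eq_zero_of_Rsq_eq_zero (k := q + 2 * j) (hc _ le_rfl (by omega) (by omega))
      (Rsq_pow_mem_casEigen hf j) h

theorem lap_eq_zero_of_mem_casEigen {q : ℕ}
    (hc : ∀ l < q, l % 2 = q % 2 → cas m n q ≠ cas m n l) {f : SuperPoly m n}
    (hf : f ∈ casEigen m n q (cas m n q)) : lap m n f = 0 := by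
  rcases lt_or_ge q 2 with hk | hk
  · exact lap_eq_zero_of_lt_two hk (mem_casEigen.mp hf).1
  · obtain ⟨k, rfl⟩ := Nat.exists_eq_add_of_le' hk
    exact casEigen_eq_zero (fun l hl h => hc l (by omega) (by omega)) (lap_mem_casEigen hf)

theorem mem_Harm_iff_mem_casEigen {q : ℕ}
    (hc : ∀ l < q, l % 2 = q % 2 → cas m n q ≠ cas m n l) {f : SuperPoly m n} :
    f ∈ Harm m n q ↔ f ∈ casEigen m n q (cas m n q) := by
  constructor
  · intro h
    rw [mem_Harm] at h
    exact mem_casEigen_of_casimir h.1 (casimir_of_lap_eq_zero h.1 h.2)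
  · intro h
    exact mem_Harm.mpr ⟨(mem_casEigen.mp h).1, lap_eq_zero_of_mem_casEigen hc h⟩

/-- When only one degree q carries the value, every element is a power of R² times a harmonic of
degree q, and C is a scalar on these. -/
theorem casimir_eq_of_unique {k q : ℕ} (hqk : q ≤ k) (hpar : q % 2 = k % 2)
    (hc : ∀ l ≤ k, l % 2 = k % 2 → l ≠ q → cas m n q ≠ cas m n l) {f : SuperPoly m n}
    (hf : f ∈ casEigen m n k (cas m n q)) : casimir m n f = cas m n q • f := by
  obtain ⟨j, rfl⟩ : ∃ j, k = q + 2 * j := ⟨(k - q) / 2, by omega⟩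
  obtain ⟨g, hg, rfl⟩ := exists_Rsq_pow_eq
    (fun l hl hq hp => hc l hl (by omega) (by omega)) hf
  have h1 := lap_eq_zero_of_mem_casEigen
    (fun l hl hp => hc l (by omega) (by omega) (by omega)) hg
  rw [← Module.End.mul_apply, ((casimir_comm_Rsq m n).pow_right j).eq, Module.End.mul_apply,
    casimir_of_lap_eq_zero (mem_casEigen.mp hg).1 h1, map_smul]

/-- At most one degree q ≤ k shares the value of degree k + 2, so in degree k there is no room for a
nilpotent part. This is what bounds the nilpotency of C - c by two in degree k + 2. -/
theorem casimir_eq_of_mem_lower {k : ℕ} {f : SuperPoly m n}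
    (hf : f ∈ casEigen m n k (cas m n (k + 2))) : casimir m n f = cas m n (k + 2) • f := by
  by_cases h : ∃ q ≤ k, q % 2 = k % 2 ∧ cas m n (k + 2) = cas m n q
  · obtain ⟨q, hq, hp, hc⟩ := h
    rw [hc] at hf ⊢
    refine casimir_eq_of_unique hq hp (fun l hl hlp hne h2 => ?_) hf
    have h3 := (cas_eq_iff _ _).mp hc
    have h4 := (cas_eq_iff _ _).mp h2
    have h5 := (cas_eq_iff _ _).mp (hc.trans h2)
    omega
  · push Not at h
    rw [casEigen_eq_zero h hf, map_zero, smul_zero]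

/-- On 𝒫_k the operator C - `cas m n k` is -R²Δ. If ΔR²Δf = 0, then R²Δf is harmonic, hence an
eigenvector. Conversely Δf has degree k - 2, where C is scalar for this value, so ΔR² kills it. -/
theorem mem_GenHarm_iff_mem_casEigen {k : ℕ} (h : ∃ q < k, q % 2 = k % 2 ∧ cas m n q = cas m n k)
    {f : SuperPoly m n} : f ∈ GenHarm m n k ↔ f ∈ casEigen m n k (cas m n k) := by
  obtain ⟨q, hq, hp, -⟩ := h
  obtain ⟨k, rfl⟩ : ∃ k', k = k' + 2 := ⟨k - 2, by omega⟩
  constructor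
  · intro h
    rw [mem_GenHarm] at h
    rw [mem_casEigen]
    refine ⟨h.1, ?_⟩
    have h1 : casimir m n f - cas m n (k + 2) • f = - Rsq m n (lap m n f) := by
      rw [Rsq_lap_of h.1]; abel
    have h3 : euler m n (Rsq m n (lap m n f)) = ((k + 2 : ℕ) : ℝ) • Rsq m n (lap m n f) := by
      rw [euler_Rsq_of (euler_lap_of h.1)]; congr 1; ring
    rw [h1, map_neg, smul_neg, casimir_of_lap_eq_zero h3 h.2]
  · intro h
    have h1 := lap_mem_casEigen h
    rw [mem_GenHarm, lap_Rsq_of (mem_casEigen.mp h1).1, casimir_eq_of_mem_lower h1, sub_self]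
    exact ⟨(mem_casEigen.mp h).1, rfl⟩

/-- Induction on the degree through Δ: decompose Δf, multiply by R², and correct f by solving (`cas`
- C)h = R²y on the components where this is possible. -/
theorem Homog_le_iSup (k : ℕ) :
    Homog m n k ≤ ⨆ l : {l : ℕ // l ≤ k ∧ l % 2 = k % 2}, casEigen m n k (cas m n l) := by
  induction k using Nat.strong_induction_on with
  | _ k ih =>
    intro f hf
    rw [mem_Homog] at hf
    rcases lt_or_ge k 2 with hk | hk
    · exact Submodule.mem_iSup_of_mem ⟨k, le_rfl, rfl⟩ (mem_casEigen_of_casimir hf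
        (casimir_of_lap_eq_zero hf (lap_eq_zero_of_lt_two hk hf)))
    · obtain ⟨k, rfl⟩ := Nat.exists_eq_add_of_le' hk
      -- Components with another value are absorbed into h by inverting `cas m n (k + 2)` - C; the
      -- component g with the value of degree k + 2 itself is the obstruction.
      have key : ∀ y ∈ ⨆ l : {l : ℕ // l ≤ k ∧ l % 2 = k % 2}, casEigen m n k (cas m n l),
          ∃ h ∈ ⨆ l : {l : ℕ // l ≤ k + 2 ∧ l % 2 = (k + 2) % 2}, casEigen m n (k + 2) (cas m n l),
          ∃ g ∈ casEigen m n k (cas m n (k + 2)),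
            cas m n (k + 2) • h - casimir m n h = Rsq m n y - Rsq m n g := by
        intro y hy
        induction hy using Submodule.iSup_induction' with
        | mem l y hy =>
          by_cases hl : cas m n l = cas m n (k + 2)
          · exact ⟨0, zero_mem _, y, hl ▸ hy, by simp⟩
          · obtain ⟨h, hh, e⟩ := exists_sub_casimir hl (Rsq_mem_casEigen hy)
            have h1 := l.2
            exact ⟨h, Submodule.mem_iSup_of_mem ⟨l, by omega, by omega⟩ hh, 0, zero_mem _,
              by rw [e]; simp⟩
        | zero => exact ⟨0, zero_mem _, 0, zero_mem _, by simp⟩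
        | add x y _ _ hx hy =>
          obtain ⟨h, hh, g, hg, e⟩ := hx
          obtain ⟨h', hh', g', hg', e'⟩ := hy
          refine ⟨h + h', add_mem hh hh', g + g', add_mem hg hg', ?_⟩
          rw [map_add, map_add, map_add, smul_add, add_sub_add_comm, e, e']
          abel
      have hΔ : lap m n f ∈ Homog m n k := by
        rw [mem_Homog, euler_lap_of hf]; push_cast; congr 1; ring
      obtain ⟨h, hh, g, hg, e⟩ := key _ (ih k (by omega) hΔ)
      have hhH : euler m n h = ((k + 2 : ℕ) : ℝ) • h := by
        have : (⨆ l : {l : ℕ // l ≤ k + 2 ∧ l % 2 = (k + 2) % 2}, casEigen m n (k + 2) (cas m n l))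
            ≤ Homog m n (k + 2) := iSup_le fun l => inf_le_left
        exact mem_Homog.mp (this hh)
      rw [← add_sub_cancel h f]
      -- The remainder f - h satisfies (C - `cas m n (k + 2)`)(f - h) = -R²g, and R²g is an honest
      -- eigenvector because g is.
      refine add_mem hh (Submodule.mem_iSup_of_mem ⟨k + 2, le_rfl, rfl⟩ ?_)
      rw [mem_casEigen]
      refine ⟨by rw [map_sub, hf, hhH, smul_sub], ?_⟩
      have h1 : casimir m n (f - h) - cas m n (k + 2) • (f - h) = - Rsq m n g := by
        have h2 := Rsq_lap_of hf
        rw [h2] at e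
        rw [map_sub, smul_sub]
        linear_combination (norm := module) e
      rw [h1, map_neg, smul_neg, ← Module.End.mul_apply, (casimir_comm_Rsq m n).eq,
        Module.End.mul_apply, casimir_eq_of_mem_lower hg, map_smul]

/-- These are subspaces of the joint generalized eigenspaces of the commuting operators 𝔼 and C,
which are independent. -/
theorem iSupIndep_casEigen (m n : ℕ) :
    iSupIndep fun p : ℕ × ℝ => casEigen m n p.1 p.2 := by
  have h := Module.End.independent_iInf_maxGenEigenspace_of_forall_mapsTo
    (![euler m n, casimir m n]) (fun i j φ => by
      have hc : Commute (![euler m n, casimir m n] i) (![euler m n, casimir m n] j) := by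
        have := casimir_comm_euler m n
        fin_cases i <;> fin_cases j <;> simp [this, this.symm]
      exact Module.End.mapsTo_maxGenEigenspace_of_comm hc.symm φ)
  have hinj : Function.Injective (fun p : ℕ × ℝ => (![(p.1 : ℝ), p.2] : Fin 2 → ℝ)) := by
    intro p q hpq
    have h0 := congrFun hpq 0
    have h1 := congrFun hpq 1
    simp at h0 h1
    exact Prod.ext h0 h1
  refine (h.comp hinj).mono fun p f hf => ?_
  simp only [Function.comp_apply, Submodule.mem_iInf]
  intro i
  fin_cases i
  · exact Module.End.mem_maxGenEigenspace _ _ _ |>.mpr ⟨1, by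
      simpa [sub_eq_zero] using (mem_casEigen.mp hf).1⟩
  · exact Module.End.mem_maxGenEigenspace _ _ _ |>.mpr ⟨2, by
      have := hf.2
      rw [pow_two]
      exact this⟩

/-! ### Injectivity on direct sums, and the index sets -/

theorem toModule_injective_and_range_le {ι M : Type*} [DecidableEq ι] [AddCommGroup M] [Module ℝ M]
    {p : ι → Submodule ℝ M} (hp : iSupIndep p) {A : ι → Type*} [∀ i, AddCommGroup (A i)]
    [∀ i, Module ℝ (A i)] (f : ∀ i, A i →ₗ[ℝ] M) (hf : ∀ i a, f i a ∈ p i)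
    (hf' : ∀ i, Function.Injective (f i)) :
    Function.Injective (DirectSum.toModule ℝ ι M f) ∧
      LinearMap.range (DirectSum.toModule ℝ ι M f) ≤ ⨆ i, p i := by
  have e : DirectSum.toModule ℝ ι M f = DirectSum.coeLinearMap p ∘ₗ
      DirectSum.lmap fun i => (f i).codRestrict (p i) (hf i) := by
    refine DirectSum.linearMap_ext _ fun i => LinearMap.ext fun a => ?_
    simp
  rw [e]
  constructor
  · rw [LinearMap.coe_comp]
    refine Function.Injective.comp hp.dfinsupp_lsum_injective
      ((DirectSum.lmap_injective _).mpr fun i a b hab => hf' i ?_)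
    exact congrArg Subtype.val hab
  · rw [← DirectSum.range_coeLinearMap]
    exact LinearMap.range_comp_le_range _ _

theorem injective_coprod_toModule {ι κ M : Type*} [DecidableEq ι] [DecidableEq κ] [AddCommGroup M]
    [Module ℝ M] {p : ι ⊕ κ → Submodule ℝ M} (hp : iSupIndep p) {A : ι → Type*} {B : κ → Type*}
    [∀ i, AddCommGroup (A i)] [∀ i, Module ℝ (A i)] [∀ i, AddCommGroup (B i)]
    [∀ i, Module ℝ (B i)] (f : ∀ i, A i →ₗ[ℝ] M) (g : ∀ i, B i →ₗ[ℝ] M)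
    (hf : ∀ i a, f i a ∈ p (Sum.inl i)) (hg : ∀ i b, g i b ∈ p (Sum.inr i))
    (hf' : ∀ i, Function.Injective (f i)) (hg' : ∀ i, Function.Injective (g i)) :
    Function.Injective (LinearMap.coprod (DirectSum.toModule ℝ ι M f)
      (DirectSum.toModule ℝ κ M g)) := by
  obtain ⟨h1, h2⟩ := toModule_injective_and_range_le (hp.comp Sum.inl_injective) f hf hf'
  obtain ⟨h3, h4⟩ := toModule_injective_and_range_le (hp.comp Sum.inr_injective) g hg hg'
  have hd : Disjoint (⨆ i, p (Sum.inl i)) (⨆ i, p (Sum.inr i)) := by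
    have := hp.disjoint_biSup_biSup (s := Set.range Sum.inl) (t := Set.range Sum.inr)
      Set.isCompl_range_inl_range_inr.disjoint
    rwa [iSup_range, iSup_range] at this
  rw [← LinearMap.ker_eq_bot, LinearMap.ker_coprod_of_disjoint_range _ _ (hd.mono h2 h4),
    LinearMap.ker_eq_bot.mpr h1, LinearMap.ker_eq_bot.mpr h3, Submodule.prod_bot]

/-- An exceptional index is the larger member of a pair of distinct degrees with the same parity and
the same Casimir value; the partner is 2 - N - ℓ, and evenness of N is equality of the parities. -/
theorem mem_exceptional_iff {N : ℤ} {l : ℕ} :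
    l ∈ exceptional N ↔ ∃ q < l, q % 2 = l % 2 ∧ (q : ℤ) + l = 2 - N := by
  simp only [exceptional, Set.mem_ofPred_eq]
  constructor
  · rintro ⟨h1, ⟨t, rfl⟩, h3, h4⟩
    exact ⟨(2 - (t + t) - l).toNat, by omega, by omega, by omega⟩
  · rintro ⟨q, h1, h2, h3⟩
    exact ⟨by omega, ⟨N / 2, by omega⟩, by omega, by omega⟩

theorem superdim_succ (m n : ℕ) : superdim (m + 1) n = superdim m n + 1 := by
  simp only [superdim]; push_cast; ring

theorem mem_tildeB_iff {k l : ℕ} : l ∈ tildeB (superdim (m + 1) n) k ↔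
    l ≤ k ∧ ∃ q < l, q % 2 = l % 2 ∧ (q : ℤ) + l = 2 - superdim m n := by
  rw [tildeB, superdim_succ, add_sub_cancel_right, Set.mem_inter_iff, mem_exceptional_iff,
    Set.mem_Iic]

/-- A regular index is not the larger member of a pair, and may be the smaller one only if its
partner exceeds k. -/
theorem mem_regularB_iff {k l : ℕ} : l ∈ regularB (superdim (m + 1) n) k ↔
    l ≤ k ∧ (¬ ∃ q < l, q % 2 = l % 2 ∧ (q : ℤ) + l = 2 - superdim m n) ∧
      ∀ p ≤ k, l < p → p % 2 = l % 2 → (p : ℤ) + l ≠ 2 - superdim m n := by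
  simp only [regularB, Set.mem_sdiff, Set.mem_union, Set.mem_Iic, Set.mem_ofPred_eq,
    mem_tildeB_iff]
  have hs := superdim_succ m n
  constructor
  · rintro ⟨h1, h2⟩
    refine ⟨h1, fun h => h2 (Or.inl ⟨h1, h⟩), fun p hp hlp hpar h => h2 (Or.inr ?_)⟩
    exact ⟨p, ⟨hp, l, hlp, hpar.symm, by omega⟩, by omega⟩
  · rintro ⟨h1, h2, h3⟩
    refine ⟨h1, ?_⟩
    rintro (⟨-, h⟩ | ⟨p, ⟨hp, q, hq, hpar, hs⟩, h⟩)
    · exact h2 h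
    · obtain rfl : l = q := by omega
      exact h3 p hp hq hpar.symm (by omega)

theorem cas_ne_of_mem_tildeB {k l : ℕ} (hl : l ∈ tildeB (superdim (m + 1) n) k) :
    ∀ p ≤ k, l < p → p % 2 = l % 2 → cas m n l ≠ cas m n p := by
  obtain ⟨h1, q, hq, hpar, h⟩ := mem_tildeB_iff.mp hl
  intro p hp hlp _ hc
  have := (cas_eq_iff _ _).mp hc
  omega

theorem cas_ne_of_mem_regularB {k l : ℕ} (hl : l ∈ regularB (superdim (m + 1) n) k) :
    ∀ p ≤ k, l < p → p % 2 = l % 2 → cas m n l ≠ cas m n p := by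
  obtain ⟨h1, -, h⟩ := mem_regularB_iff.mp hl
  intro p hp hlp hpar hc
  have h2 := (cas_eq_iff _ _).mp hc
  have := h p hp hlp hpar
  omega

theorem mem_GenHarm_of_mem_tildeB {k l : ℕ} (hl : l ∈ tildeB (superdim (m + 1) n) k)
    {f : SuperPoly m n} : f ∈ GenHarm m n l ↔ f ∈ casEigen m n l (cas m n l) := by
  obtain ⟨-, q, hq, hpar, h⟩ := mem_tildeB_iff.mp hl
  exact mem_GenHarm_iff_mem_casEigen ⟨q, hq, hpar, (cas_eq_iff _ _).mpr (Or.inr h)⟩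

theorem mem_Harm_of_mem_regularB {k l : ℕ} (hl : l ∈ regularB (superdim (m + 1) n) k)
    {f : SuperPoly m n} : f ∈ Harm m n l ↔ f ∈ casEigen m n l (cas m n l) := by
  obtain ⟨-, h, -⟩ := mem_regularB_iff.mp hl
  refine mem_Harm_iff_mem_casEigen fun q hq hpar hc => h ⟨q, hq, hpar, ?_⟩
  have := (cas_eq_iff _ _).mp hc
  omega

/-- The largest degree up to d with the given value and parity. Since d is k or k - 1, the parity
makes the bounds d and k equivalent, so the index sets for k serve both pieces of Cauchy data. -/
theorem exists_top {k d l : ℕ} (hd : d ≤ k) (hk : k ≤ d + 1) (hl : l ≤ d) (hpar : l % 2 = d % 2) :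
    ∃ l', l' ≤ d ∧ l' % 2 = d % 2 ∧ cas m n l' = cas m n l ∧
      (l' ∈ tildeB (superdim (m + 1) n) k ∨ l' ∈ regularB (superdim (m + 1) n) k) := by
  by_cases h : ∃ p ≤ d, l < p ∧ p % 2 = l % 2 ∧ (p : ℤ) + l = 2 - superdim m n
  · obtain ⟨p, h1, h2, h3, h4⟩ := h
    exact ⟨p, h1, by omega, (cas_eq_iff _ _).mpr (Or.inr h4), Or.inl (mem_tildeB_iff.mpr
      ⟨by omega, l, h2, h3.symm, by omega⟩)⟩
  · refine ⟨l, hl, hpar, rfl, ?_⟩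
    by_cases h2 : ∃ q < l, q % 2 = l % 2 ∧ (q : ℤ) + l = 2 - superdim m n
    · exact Or.inl (mem_tildeB_iff.mpr ⟨by omega, h2⟩)
    · refine Or.inr (mem_regularB_iff.mpr ⟨by omega, h2, fun p hp hlp hpp h4 => h ⟨p, ?_, hlp, hpp, h4⟩⟩)
      omega

/-! ### The decomposition of ℋ_k -/

/-- The embedding of the summand of degree `ℓ` into `ℋ_k`: multiplication by a power of `R²`,
followed by harmonic extension. -/
def summandMap (m n k l : ℕ) : SuperPoly m n →ₗ[ℝ] SuperPoly (m + 1) n :=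
  ck ((k - l) % 2) k ∘ₗ (Rsq m n ^ ((k - l) / 2))

/-- The sum of the restrictions to `x_{m+1} = 0` of `f` and of its normal derivative. -/
def boundary (m n : ℕ) : SuperPoly (m + 1) n →ₗ[ℝ] SuperPoly m n :=
  res m n + res m n ∘ₗ D (lastIdx m n)

theorem boundary_ck {s : ℕ} (hs : s < 2) (K : ℕ) (f : SuperPoly m n) :
    boundary m n (ck s K f) = f := by
  rw [boundary, LinearMap.add_apply, LinearMap.comp_apply]
  interval_cases s
  · rw [res_ck_zero, res_D_ck_zero, add_zero]
  · rw [res_ck_one, res_D_ck_one, zero_add]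

theorem boundary_summandMap (k l : ℕ) (f : SuperPoly m n) :
    boundary m n (summandMap m n k l f) = (Rsq m n ^ ((k - l) / 2)) f := by
  rw [summandMap, LinearMap.comp_apply, boundary_ck (Nat.mod_lt _ two_pos)]

theorem summandMap_mem_Harm {k l : ℕ} (hl : l ≤ k) {f : SuperPoly m n}
    (hf : euler m n f = (l : ℝ) • f) : summandMap m n k l f ∈ Harm (m + 1) n k := by
  have h1 := euler_Rsq_pow_of hf ((k - l) / 2)
  have h2 : l + 2 * ((k - l) / 2) + (k - l) % 2 = k := by omega
  have h3 : (l : ℝ) + 2 * ((k - l) / 2 : ℕ) + ((k - l) % 2 : ℕ) = k := by exact_mod_cast h2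
  rw [mem_Harm, summandMap, LinearMap.comp_apply]
  refine ⟨by rw [euler_ck h1, h3], lap_ck_eq_zero h1 (by omega) ?_⟩
  rw [← h3]
  have : (0 : ℝ) ≤ ((k - l) % 2 : ℕ) := Nat.cast_nonneg _
  linarith

theorem act_summandMap {A : Matrix (Idx m n) (Idx m n) ℝ} (hA : A ∈ osp m n) (k l : ℕ)
    (f : SuperPoly m n) :
    act (extendMatrix A) (summandMap m n k l f) = summandMap m n k l (act A f) := by
  rw [summandMap, LinearMap.comp_apply, LinearMap.comp_apply, act_ck hA, ← Module.End.mul_apply,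
    ← ((Rsq_act hA).pow_left _).eq]
  rfl

theorem parity_summandMap (k l : ℕ) (f : SuperPoly m n) :
    parity (m + 1) n (summandMap m n k l f) = summandMap m n k l (parity m n f) := by
  rw [summandMap, LinearMap.comp_apply, LinearMap.comp_apply, parity_ck, ← Module.End.mul_apply,
    ← ((parity_Rsq m n).pow_left _).eq]
  rfl

/-- The map `⨁ ℋ̃_ℓ ⊕ ⨁ ℋ_ℓ → 𝒫(ℝ^{m+1|2n})` with the components `summandMap`. -/
def sumMap (m n k : ℕ) (S T : Set ℕ) : HarmSum m n S T →ₗ[ℝ] SuperPoly (m + 1) n :=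
  LinearMap.coprod
    (DirectSum.toModule ℝ S _ fun l => summandMap m n k l ∘ₗ (GenHarm m n l).subtype)
    (DirectSum.toModule ℝ T _ fun l => summandMap m n k l ∘ₗ (Harm m n l).subtype)

theorem toModule_mem {ι M : Type*} [DecidableEq ι] [AddCommGroup M] [Module ℝ M] {A : ι → Type*}
    [∀ i, AddCommGroup (A i)] [∀ i, Module ℝ (A i)] {f : ∀ i, A i →ₗ[ℝ] M} {p : Submodule ℝ M}
    (h : ∀ i a, f i a ∈ p) (x : ⨁ i, A i) : DirectSum.toModule ℝ ι M f x ∈ p := by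
  induction x using DirectSum.induction_on with
  | zero => rw [map_zero]; exact zero_mem _
  | of i a => rw [← DirectSum.lof_eq_of ℝ, DirectSum.toModule_lof]; exact h i a
  | add x y hx hy => rw [map_add]; exact add_mem hx hy

theorem sumMap_mem_Harm (m n k : ℕ) {S T : Set ℕ} (hS : ∀ l ∈ S, l ≤ k) (hT : ∀ l ∈ T, l ≤ k)
    (x : HarmSum m n S T) : sumMap m n k S T x ∈ Harm (m + 1) n k := by
  rw [sumMap, LinearMap.coprod_apply]
  exact add_mem
    (toModule_mem (fun (l : S) (a : GenHarm m n l) => summandMap_mem_Harm (hS l l.2) (mem_GenHarm.mp a.2).1) _)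
    (toModule_mem (fun (l : T) (a : Harm m n l) => summandMap_mem_Harm (hT l l.2) (mem_Harm.mp a.2).1) _)

theorem sumMap_act (m n k : ℕ) (S T : Set ℕ) (A : osp m n) (x : HarmSum m n S T) :
    sumMap m n k S T (harmSumAct S T A x)
      = act (extendMatrix (A : Matrix (Idx m n) (Idx m n) ℝ)) (sumMap m n k S T x) := by
  have : sumMap m n k S T ∘ₗ harmSumAct S T A
      = act (extendMatrix (A : Matrix (Idx m n) (Idx m n) ℝ)) ∘ₗ sumMap m n k S T := by
    refine LinearMap.prod_ext (DirectSum.linearMap_ext _ fun l => LinearMap.ext fun a => ?_)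
      (DirectSum.linearMap_ext _ fun l => LinearMap.ext fun a => ?_)
    · simp [sumMap, harmSumAct, act_summandMap A.2, genHarmAct]
    · simp [sumMap, harmSumAct, act_summandMap A.2, harmAct]
  exact LinearMap.congr_fun this x

theorem sumMap_parity (m n k : ℕ) (S T : Set ℕ) (x : HarmSum m n S T) :
    sumMap m n k S T (harmSumParity m n S T x) = parity (m + 1) n (sumMap m n k S T x) := by
  have : sumMap m n k S T ∘ₗ harmSumParity m n S T = parity (m + 1) n ∘ₗ sumMap m n k S T := by
    refine LinearMap.prod_ext (DirectSum.linearMap_ext _ fun l => LinearMap.ext fun a => ?_)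
      (DirectSum.linearMap_ext _ fun l => LinearMap.ext fun a => ?_)
    · simp [sumMap, harmSumParity, parity_summandMap, genHarmParity]
    · simp [sumMap, harmSumParity, parity_summandMap, harmParity]
  exact LinearMap.congr_fun this x

/-- After passing to the Cauchy data, the summand of degree ℓ is multiplied by a power of R²,
injectively because no later degree up to k of the same parity repeats its value. The images lie in
eigenspaces for distinct pairs of degree and Casimir value. -/
theorem sumMap_injective (m n k : ℕ) : Function.Injective
    (sumMap m n k (tildeB (superdim (m + 1) n) k) (regularB (superdim (m + 1) n) k)) := by
  set S := tildeB (superdim (m + 1) n) k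
  set T := regularB (superdim (m + 1) n) k
  have e : boundary m n ∘ₗ sumMap m n k S T = LinearMap.coprod
      (DirectSum.toModule ℝ S _ fun l => (Rsq m n ^ ((k - l) / 2)) ∘ₗ (GenHarm m n l).subtype)
      (DirectSum.toModule ℝ T _ fun l => (Rsq m n ^ ((k - l) / 2)) ∘ₗ (Harm m n l).subtype) := by
    refine LinearMap.prod_ext (DirectSum.linearMap_ext _ fun l => LinearMap.ext fun a => ?_)
      (DirectSum.linearMap_ext _ fun l => LinearMap.ext fun a => ?_)
    · simp [sumMap, boundary_summandMap]
    · simp [sumMap, boundary_summandMap]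
  refine Function.Injective.of_comp (f := boundary m n) ?_
  rw [← LinearMap.coe_comp, e]
  let idx : S ⊕ T → ℕ := Sum.elim Subtype.val Subtype.val
  have hidx : ∀ i, idx i ≤ k := by
    rintro (i | i)
    · exact (mem_tildeB_iff.mp i.2).1
    · exact (mem_regularB_iff.mp i.2).1
  have hne : ∀ i, ∀ p ≤ k, idx i < p → p % 2 = idx i % 2 → cas m n (idx i) ≠ cas m n p := by
    rintro (i | i)
    · exact cas_ne_of_mem_tildeB i.2
    · exact cas_ne_of_mem_regularB i.2
  have hinj0 : Function.Injective idx := by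
    rintro (i | i) (j | j) h
    · exact congrArg _ (Subtype.ext h)
    · refine absurd i.2 fun hi => (mem_regularB_iff.mp j.2).2.1 ?_
      have := (mem_tildeB_iff.mp hi).2
      rwa [show (i : ℕ) = j from h] at this
    · refine absurd j.2 fun hi => (mem_regularB_iff.mp i.2).2.1 ?_
      have := (mem_tildeB_iff.mp hi).2
      rwa [show (j : ℕ) = i from h.symm] at this
    · exact congrArg _ (Subtype.ext h)
  -- The degree ℓ + 2⌊(k-ℓ)/2⌋ is k or k - 1 according to the parity of k - ℓ, so equal pairs have
  -- equal parity and equal value; this forces equal indices.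
  have hinj : Function.Injective fun i : S ⊕ T =>
      ((idx i + 2 * ((k - idx i) / 2), cas m n (idx i)) : ℕ × ℝ) := by
    intro i j h
    simp only [Prod.mk.injEq] at h
    obtain ⟨h1, h2⟩ := h
    have hi := hidx i
    have hj := hidx j
    apply hinj0
    rcases lt_trichotomy (idx i) (idx j) with hlt | heq | hlt
    · exact absurd h2 (hne i _ hj hlt (by omega))
    · exact heq
    · exact absurd h2.symm (hne j _ hi hlt (by omega))
  refine injective_coprod_toModule ((iSupIndep_casEigen m n).comp hinj) _ _
    (fun l a => ?_) (fun l a => ?_) (fun l => ?_) (fun l => ?_)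
  · exact Rsq_pow_mem_casEigen ((mem_GenHarm_of_mem_tildeB l.2).mp a.2) _
  · exact Rsq_pow_mem_casEigen ((mem_Harm_of_mem_regularB l.2).mp a.2) _
  · refine (injective_iff_map_eq_zero _).mpr fun a ha => Subtype.ext ?_
    have := hidx (Sum.inl l)
    simp only [idx, Sum.elim_inl] at this
    exact eq_zero_of_Rsq_pow_eq_zero (fun p hp hlp hpar => cas_ne_of_mem_tildeB l.2 p (by omega) hlp hpar)
      ((mem_GenHarm_of_mem_tildeB l.2).mp a.2) ha
  · refine (injective_iff_map_eq_zero _).mpr fun a ha => Subtype.ext ?_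
    have := hidx (Sum.inr l)
    simp only [idx, Sum.elim_inr] at this
    exact eq_zero_of_Rsq_pow_eq_zero (fun p hp hlp hpar => cas_ne_of_mem_regularB l.2 p (by omega) hlp hpar)
      ((mem_Harm_of_mem_regularB l.2).mp a.2) ha

/-- Each Casimir component of g is a power of R² times an element of the largest degree carrying its
value, which is one of the summands. -/
theorem ck_mem_range_sumMap {k d : ℕ} (hd : d ≤ k) (hk : k ≤ d + 1) {g : SuperPoly m n}
    (hg : g ∈ Homog m n d) : ck (k - d) k g ∈ LinearMap.range
      (sumMap m n k (tildeB (superdim (m + 1) n) k) (regularB (superdim (m + 1) n) k)) := by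
  have h := Homog_le_iSup d hg
  clear hg
  induction h using Submodule.iSup_induction' with
  | mem l g hg =>
    obtain ⟨l, hl, hpar⟩ := l
    obtain ⟨l', h1, h2, h3, h4⟩ := exists_top (m := m) (n := n) hd hk hl hpar
    rw [← h3] at hg
    obtain ⟨j, rfl⟩ : ∃ j, d = l' + 2 * j := ⟨(d - l') / 2, by omega⟩
    have e1 : (k - l') % 2 = k - (l' + 2 * j) := by omega
    have e2 : (k - l') / 2 = j := by omega
    rcases h4 with h4 | h4
    · obtain ⟨f, hf, rfl⟩ := exists_Rsq_pow_eq
        (fun p hp hlp hpar => cas_ne_of_mem_tildeB h4 p (by omega) hlp hpar) hg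
      refine ⟨(DirectSum.lof ℝ _ (fun l : tildeB (superdim (m + 1) n) k => GenHarm m n l) ⟨l', h4⟩
        ⟨f, (mem_GenHarm_of_mem_tildeB h4).mpr hf⟩, 0), ?_⟩
      simp [sumMap, summandMap, e1, e2]
    · obtain ⟨f, hf, rfl⟩ := exists_Rsq_pow_eq
        (fun p hp hlp hpar => cas_ne_of_mem_regularB h4 p (by omega) hlp hpar) hg
      refine ⟨(0, DirectSum.lof ℝ _ (fun l : regularB (superdim (m + 1) n) k => Harm m n l) ⟨l', h4⟩
        ⟨f, (mem_Harm_of_mem_regularB h4).mpr hf⟩), ?_⟩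
      simp [sumMap, summandMap, e1, e2]
  | zero => rw [map_zero]; exact zero_mem _
  | add x y _ _ hx hy => rw [map_add]; exact add_mem hx hy

/-- Both sides are harmonic with the same Cauchy data. -/
theorem eq_ck_add_ck {k : ℕ} {f : SuperPoly (m + 1) n} (hf : f ∈ Harm (m + 1) n k) :
    f = ck 0 k (res m n f) + ck 1 k (res m n (D (lastIdx m n) f)) := by
  obtain ⟨h1, h2⟩ := mem_Harm.mp hf
  have e0 : euler m n (res m n f) = (k : ℝ) • res m n f := by rw [euler_res, h1, map_smul]
  have e1 : euler m n (res m n (D (lastIdx m n) f)) = ((k : ℝ) - 1) • res m n (D (lastIdx m n) f) := by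
    rw [euler_res, euler_D_of h1, map_smul]
  rw [← sub_eq_zero]
  apply eq_zero_of_lap_of_res
  · rw [map_sub, map_add, h2, lap_ck_eq_zero e0 zero_le_one le_rfl,
      lap_ck_eq_zero e1 le_rfl (by linarith)]
    simp
  · rw [map_sub, map_add, res_ck_zero, res_ck_one]; simp
  · rw [map_sub, map_add, map_sub, map_add, res_D_ck_zero, res_D_ck_one]; simp

theorem range_sumMap (m n k : ℕ) : LinearMap.range
    (sumMap m n k (tildeB (superdim (m + 1) n) k) (regularB (superdim (m + 1) n) k))
      = Harm (m + 1) n k := by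
  refine le_antisymm ?_ fun f hf => ?_
  · rintro _ ⟨x, rfl⟩
    exact sumMap_mem_Harm m n k (fun l hl => (mem_tildeB_iff.mp hl).1)
      (fun l hl => (mem_regularB_iff.mp hl).1) x
  · obtain ⟨h1, h2⟩ := mem_Harm.mp hf
    have e0 : euler m n (res m n f) = (k : ℝ) • res m n f := by rw [euler_res, h1, map_smul]
    have e1 : euler m n (res m n (D (lastIdx m n) f))
        = ((k : ℝ) - 1) • res m n (D (lastIdx m n) f) := by
      rw [euler_res, euler_D_of h1, map_smul]
    rw [eq_ck_add_ck hf]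
    refine add_mem ?_ ?_
    · simpa using ck_mem_range_sumMap (d := k) le_rfl (by omega) (mem_Homog.mpr e0)
    -- The normal derivative has degree k - 1; for k = 0 this is negative and the term vanishes.
    · rcases k with _ | k
      · rw [eq_zero_of_euler_neg e1 (by simp), map_zero]
        exact zero_mem _
      · have := ck_mem_range_sumMap (k := k + 1) (d := k) (by omega) le_rfl
          (mem_Homog.mpr (e1.trans (by push_cast; congr 1; ring)))
        simpa using this

/-- The decomposition `ℋ_k(ℝ^{m+1|2n}) ≃ ⨁ ℋ̃_ℓ(ℝ^{m|2n}) ⊕ ⨁ ℋ_ℓ(ℝ^{m|2n})`. -/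
def harmEquiv (m n k : ℕ) : HarmSum m n (tildeB (superdim (m + 1) n) k)
    (regularB (superdim (m + 1) n) k) ≃ₗ[ℝ] Harm (m + 1) n k :=
  (LinearEquiv.ofInjective _ (sumMap_injective m n k)).trans
    (LinearEquiv.ofEq _ _ (range_sumMap m n k))

theorem coe_harmEquiv (m n k : ℕ) (x) : (harmEquiv m n k x : SuperPoly (m + 1) n)
    = sumMap m n k _ _ x := rfl

theorem exists_decomposition (m n k : ℕ) : ∃ e : Harm (m + 1) n k ≃ₗ[ℝ]
    HarmSum m n (tildeB (superdim (m + 1) n) k) (regularB (superdim (m + 1) n) k),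
      (∀ (A : osp m n) (f : Harm (m + 1) n k),
        e (harmAct k (ospIncl A) f) = harmSumAct _ _ A (e f)) ∧
      (∀ f : Harm (m + 1) n k,
        e (harmParity (m + 1) n k f) = harmSumParity m n _ _ (e f)) := by
  refine ⟨(harmEquiv m n k).symm, fun A f => ?_, fun f => ?_⟩
  · rw [LinearEquiv.symm_apply_eq]
    apply Subtype.ext
    rw [coe_harmEquiv, sumMap_act, ← coe_harmEquiv, LinearEquiv.apply_symm_apply]
    rfl
  · rw [LinearEquiv.symm_apply_eq]
    apply Subtype.ext
    rw [coe_harmEquiv, sumMap_parity, ← coe_harmEquiv, LinearEquiv.apply_symm_apply]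
    rfl

/-! ### Invariant superpolynomials -/

/-- `f` is annihilated by `𝔬𝔰𝔭(m|2n)`. -/
def IsInvariant (f : SuperPoly m n) : Prop := ∀ A ∈ osp m n, act A f = 0

theorem IsInvariant.rot_eq_zero {f : SuperPoly m n} (h : IsInvariant f) (a b : Idx m n) :
    rot a b f = 0 := by
  rw [← act_rotMatrix]; exact h _ (rotMatrix_mem a b)

theorem IsInvariant.map {f : SuperPoly m n} (h : IsInvariant f) {T : Module.End ℝ (SuperPoly m n)}
    (hT : ∀ A ∈ osp m n, Commute T (act A)) : IsInvariant (T f) := by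
  intro A hA
  rw [← Module.End.mul_apply, ← (hT A hA).eq, Module.End.mul_apply, h A hA, map_zero]

theorem isInvariant_one : IsInvariant (one m n) := by
  intro A _
  simp [act_apply, D_one]

theorem IsInvariant.lap {f : SuperPoly m n} (h : IsInvariant f) : IsInvariant (lap m n f) :=
  h.map fun _ hA => lap_act hA

theorem IsInvariant.Rsq_lap {f : SuperPoly m n} (h : IsInvariant f) {a : ℕ}
    (hf : euler m n f = (a : ℝ) • f) : Rsq m n (SuperHarmonic.lap m n f) = cas m n a • f := by
  rw [rot_eq_zero_lap h.rot_eq_zero, hf, map_smul, hf, cas]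
  module

theorem cas_eq_zero_iff (a : ℕ) : cas m n a = 0 ↔ a = 0 ∨ (a : ℤ) = 2 - superdim m n := by
  have h0 : cas m n 0 = 0 := by simp [cas]
  rw [← h0, cas_eq_iff]
  simp

/-- `f` is a multiple of `R^a`; in particular it vanishes if `a` is odd. -/
def IsRsqPow (a : ℕ) (f : SuperPoly m n) : Prop :=
  (a % 2 = 1 → f = 0) ∧ ∃ c : ℝ, f = c • (Rsq m n ^ (a / 2)) (one m n)

theorem isRsqPow_zero (a : ℕ) : IsRsqPow a (0 : SuperPoly m n) := ⟨fun _ => rfl, 0, by simp⟩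

/-- An invariant of degree a satisfies R²Δf = a(a + M - 2)f, and Δf is again invariant, so induction
in steps of two applies. It fails only in the critical degree 2 - M, if positive, which is delegated
to `hcrit`. -/
theorem isRsqPow_of_isInvariant {Q : SuperPoly m n → Prop} (hQ : ∀ f, Q f → Q (lap m n f)) {a : ℕ}
    (hcrit : ∀ b ≤ a, 0 < b → (b : ℤ) = 2 - superdim m n → ∀ f, euler m n f = (b : ℝ) • f →
      IsInvariant f → Q f → IsRsqPow b f)
    {f : SuperPoly m n} (hf : euler m n f = (a : ℝ) • f) (hinv : IsInvariant f) (hQf : Q f) :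
    IsRsqPow a f := by
  induction a using Nat.twoStepInduction generalizing f with
  | zero =>
    obtain ⟨c, rfl⟩ := exists_smul_one hf (fun r h => by
      have : (0 : ℝ) ≤ r := r.cast_nonneg
      simp at h; linarith)
    exact ⟨by simp, c, by simp⟩
  | one =>
    have hl := lap_eq_zero_of_lt_two one_lt_two hf
    by_cases hc : ((1 : ℕ) : ℤ) = 2 - superdim m n
    · exact hcrit 1 le_rfl one_pos hc f hf hinv hQf
    · have := hinv.Rsq_lap hf
      rw [hl, map_zero] at this
      have h0 : f = 0 := (smul_eq_zero.mp this.symm).resolve_left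
        fun h => ((cas_eq_zero_iff 1).mp h).elim one_ne_zero hc
      rw [h0]
      exact isRsqPow_zero 1
  | more a ih _ =>
    have hE : euler m n (lap m n f) = (a : ℝ) • lap m n f := by
      rw [euler_lap_of hf]; push_cast; congr 1; ring
    have hl := ih (fun b hb => hcrit b (by omega)) hE hinv.lap (hQ f hQf)
    by_cases hc : ((a + 2 : ℕ) : ℤ) = 2 - superdim m n
    · exact hcrit (a + 2) le_rfl (by omega) hc f hf hinv hQf
    · have h1 := hinv.Rsq_lap hf
      have h0 : cas m n (a + 2) ≠ 0 := fun h =>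
        ((cas_eq_zero_iff (a + 2)).mp h).elim (by omega) hc
      refine ⟨fun h => ?_, ?_⟩
      · rw [hl.1 (by omega), map_zero] at h1
        exact (smul_eq_zero.mp h1.symm).resolve_left h0
      · obtain ⟨c, hcc⟩ := hl.2
        refine ⟨(cas m n (a + 2))⁻¹ * c, ?_⟩
        rw [hcc, map_smul] at h1
        rw [show (a + 2) / 2 = a / 2 + 1 by omega, pow_succ', Module.End.mul_apply, ← smul_smul, h1,
          inv_smul_smul₀ h0]

theorem isRsqPow_of_lt {a : ℕ} (ha : (a : ℤ) < 2 - superdim m n) {f : SuperPoly m n}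
    (hf : euler m n f = (a : ℝ) • f) (hinv : IsInvariant f) : IsRsqPow a f :=
  isRsqPow_of_isInvariant (Q := fun _ => True) (fun _ _ => trivial)
    (fun b hb _ h => by omega) hf hinv trivial

theorem coeff_add (j : ℕ) (f g : SuperPoly (m + 1) n) :
    coeff j (f + g) = coeff j f + coeff j g := by
  simp only [coeff, map_add, smul_add]

theorem coeff_X_last_zero (f : SuperPoly (m + 1) n) : coeff 0 (X (lastIdx m n) f) = 0 := by
  simp [coeff, res_X_last]

theorem coeff_X_last_succ (j : ℕ) (f : SuperPoly (m + 1) n) :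
    coeff (j + 1) (X (lastIdx m n) f) = coeff j f := by
  rw [coeff, D_last_pow_X_last, map_add, res_X_last, zero_add, map_smul, smul_smul, coeff,
    Nat.add_sub_cancel, Nat.factorial_succ]
  congr 1
  have : ((j + 1 : ℕ) : ℝ) ≠ 0 := by positivity
  have : ((j.factorial : ℕ) : ℝ) ≠ 0 := by positivity
  push_cast
  field_simp

theorem eq_zero_of_coeff {f : SuperPoly (m + 1) n} (h : ∀ j, coeff j f = 0) : f = 0 := by
  obtain ⟨K, hK⟩ := exists_taylor f
  rw [← hK K le_rfl]
  exact Finset.sum_eq_zero fun j _ => by rw [h, map_zero, map_zero]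

theorem exists_coeff_eq_zero (f : SuperPoly (m + 1) n) : ∃ K, ∀ j, K ≤ j → coeff j f = 0 := by
  obtain ⟨K, hK⟩ := exists_taylor f
  refine ⟨K, fun j hj => ?_⟩
  have h := hK j hj
  have h' := hK (j + 1) (by omega)
  rw [Finset.sum_range_succ, h, add_eq_left] at h'
  have : ∀ i (g : SuperPoly m n), (X (lastIdx m n) ^ i) (incl m n g) = 0 → g = 0 := by
    intro i g hg
    have : ∀ i, coeff i ((X (lastIdx m n) ^ i) (incl m n g)) = g := by
      intro i
      induction i with
      | zero => simp [coeff, res_incl]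
      | succ i ih => rw [pow_succ', Module.End.mul_apply, coeff_X_last_succ, ih]
    rw [← this i, hg]
    simp [coeff]
  exact this j _ h'

theorem X_last_injective {f : SuperPoly (m + 1) n} (h : X (lastIdx m n) f = 0) : f = 0 :=
  eq_zero_of_coeff fun j => by rw [← coeff_X_last_succ, h]; simp [coeff]

theorem res_Rsq (f : SuperPoly (m + 1) n) : res m n (Rsq (m + 1) n f) = Rsq m n (res m n f) := by
  rw [Rsq_succ_apply, Rsq_apply]
  simp only [map_add, map_sub, map_sum, res_X, res_X_last, zero_add]

theorem D_last_Rsq (f : SuperPoly (m + 1) n) : D (lastIdx m n) (Rsq (m + 1) n f)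
    = Rsq (m + 1) n (D (lastIdx m n) f) + (2 : ℝ) • X (lastIdx m n) f := by
  rw [Rsq_succ_apply, Rsq_succ_apply]
  simp only [map_add, map_sub, map_sum, D_last_X_emb, D_last_X_last]
  module

theorem coeff_Rsq (j : ℕ) (f : SuperPoly (m + 1) n) :
    coeff (j + 2) (Rsq (m + 1) n f) = coeff j f + Rsq m n (coeff (j + 2) f) := by
  rw [Rsq_succ_apply, coeff_add, coeff_X_last_succ, coeff_X_last_succ]
  congr 1
  rw [coeff, coeff, map_smul, Rsq_apply]
  simp only [map_sub, map_sum, D_last_pow_X_emb, res_X]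

/-- R² is x² plus the square norm of the hyperplane. Comparing the coefficients of x^{j+2} kills the
coefficients of f from the top down. -/
theorem Rsq_injective {f : SuperPoly (m + 1) n} (h : Rsq (m + 1) n f = 0) : f = 0 := by
  obtain ⟨K, hK⟩ := exists_coeff_eq_zero f
  have key : ∀ i j, K ≤ i + j → coeff j f = 0 := by
    intro i
    induction i with
    | zero => intro j hj; exact hK j (by omega)
    | succ i ih =>
      intro j hj
      have := coeff_Rsq j f
      rw [h, ih (j + 2) (by omega), map_zero, add_zero] at this
      rw [← this]
      simp [coeff]
  exact eq_zero_of_coeff fun j => key K j (by omega)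

theorem res_Rsq_pow_one (j : ℕ) :
    res m n ((Rsq (m + 1) n ^ j) (one (m + 1) n)) = (Rsq m n ^ j) (one m n) := by
  induction j with
  | zero => simp [res_one]
  | succ j ih => rw [pow_succ', pow_succ' (Rsq m n), Module.End.mul_apply, Module.End.mul_apply, res_Rsq, ih]

theorem res_D_last_Rsq_pow_one (j : ℕ) :
    res m n (D (lastIdx m n) ((Rsq (m + 1) n ^ j) (one (m + 1) n))) = 0 := by
  induction j with
  | zero => simp [D_one]
  | succ j ih =>
    rw [pow_succ', Module.End.mul_apply, D_last_Rsq, map_add, res_Rsq, ih, map_smul, res_X_last]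
    simp

theorem IsInvariant.res {f : SuperPoly (m + 1) n} (h : IsInvariant f) :
    IsInvariant (SuperHarmonic.res m n f) := fun A hA => by
  rw [← res_act, h _ (extendMatrix_mem_osp hA), map_zero]

theorem isInvariant_Rsq_pow_one (j : ℕ) : IsInvariant ((Rsq m n ^ j) (one m n)) :=
  isInvariant_one.map fun _ hA => (Rsq_act hA).pow_left j

theorem euler_Rsq_pow_one (j : ℕ) :
    euler m n ((Rsq m n ^ j) (one m n)) = ((2 * j : ℕ) : ℝ) • (Rsq m n ^ j) (one m n) := by
  rw [euler_Rsq_pow_of (μ := 0) (by rw [euler_one, zero_smul])]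
  push_cast; rw [zero_add]

/-- In the critical degree invariants are harmonic, R² being injective, and so is R^a. The degree is
subcritical for the hyperplane, so f restricts to a multiple of its R^a; subtracting the same
multiple of R^a leaves a harmonic with zero Cauchy data. -/
theorem isRsqPow_of_critical {a : ℕ} (ha : (a : ℤ) = 2 - superdim (m + 1) n)
    {f : SuperPoly (m + 1) n} (hf : euler (m + 1) n f = (a : ℝ) • f) (hinv : IsInvariant f)
    (h1 : res m n (D (lastIdx m n) f) = 0) : IsRsqPow a f := by
  have hc := (cas_eq_zero_iff (m := m + 1) (n := n) a).mpr (Or.inr ha)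
  have hl : ∀ g : SuperPoly (m + 1) n, euler (m + 1) n g = (a : ℝ) • g → IsInvariant g →
      lap (m + 1) n g = 0 := fun g hg hinv =>
    Rsq_injective (by rw [hinv.Rsq_lap hg, hc, zero_smul])
  have h0 := isRsqPow_of_lt (m := m) (n := n) (a := a) (by rw [superdim_succ] at ha; omega)
    (by rw [euler_res, hf, map_smul]) hinv.res
  have hodd : a % 2 = 1 → f = 0 := fun h => eq_zero_of_lap_of_res (hl f hf hinv) (h0.1 h) h1
  refine ⟨hodd, ?_⟩
  rcases Nat.mod_two_eq_zero_or_one a with h | h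
  · obtain ⟨c, hcc⟩ := h0.2
    refine ⟨c, sub_eq_zero.mp (eq_zero_of_lap_of_res ?_ ?_ ?_)⟩
    · have h2 := euler_Rsq_pow_one (m := m + 1) (n := n) (a / 2)
      rw [show 2 * (a / 2) = a by omega] at h2
      rw [map_sub, map_smul, hl f hf hinv, hl _ h2 (isInvariant_Rsq_pow_one _)]
      simp
    · rw [map_sub, map_smul, res_Rsq_pow_one, hcc, sub_self]
    · rw [map_sub, map_sub, map_smul, map_smul, res_D_last_Rsq_pow_one, h1]
      simp
  · exact ⟨0, by rw [hodd h, zero_smul]⟩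

theorem gLow_inl (a : Fin m) (j : Idx m n) :
    gLow m n (Sum.inl a) j = if Sum.inl a = j then 1 else 0 := by
  rcases j with j | j <;> simp [gLow, Matrix.one_apply]

theorem Dd_inl (a : Fin m) : (Dd (Sum.inl a) : Module.End ℝ (SuperPoly m n)) = D (Sum.inl a) := by
  simp [Dd, gLow_inl, ite_smul]

/-- Restricting (x∂_y - y∂_x)f = 0 to x = 0 gives y·∂_x f = 0, and y is injective. A second bosonic
coordinate is essential here. -/
theorem res_D_last_of_isInvariant {f : SuperPoly (m + 2) n} (hinv : IsInvariant f) :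
    res (m + 1) n (D (lastIdx (m + 1) n) f) = 0 := by
  have h := hinv.rot_eq_zero (lastIdx (m + 1) n) (emb (lastIdx m n))
  rw [rot, sg_last', one_smul] at h
  have h2 : Dd (lastIdx (m + 1) n) = D (lastIdx (m + 1) n) := Dd_inl _
  rw [h2, LinearMap.sub_apply, Module.End.mul_apply, Module.End.mul_apply] at h
  have h3 := congrArg (res (m + 1) n) h
  rw [map_sub, res_X_last, zero_sub, res_X, map_zero, neg_eq_zero] at h3
  exact X_last_injective h3

/-- The invariants of `𝔬𝔰𝔭(m|2n)` for `m ≥ 2` are the polynomials in `R²`. -/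
theorem isRsqPow_of_two_le {a : ℕ} {f : SuperPoly (m + 2) n}
    (hf : euler (m + 2) n f = (a : ℝ) • f) (hinv : IsInvariant f) : IsRsqPow a f :=
  isRsqPow_of_isInvariant (Q := fun _ => True) (fun _ _ => trivial)
    (fun _ _ _ hc _ hg hi _ => isRsqPow_of_critical hc hg hi (res_D_last_of_isInvariant hi))
    hf hinv trivial

/-! ### The cyclic vector x^ℓ and indecomposability of generalized eigenspaces -/

/-- `U` is stable under the action of `𝔬𝔰𝔭(m|2n)`. -/
def IsActStable (U : Submodule ℝ (SuperPoly m n)) : Prop := ∀ A ∈ osp m n, ∀ f ∈ U, act A f ∈ U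

theorem IsActStable.rot_mem {U : Submodule ℝ (SuperPoly m n)} (hU : IsActStable U) (a b : Idx m n)
    {f : SuperPoly m n} (hf : f ∈ U) : rot a b f ∈ U := by
  rw [← act_rotMatrix]
  exact hU _ (rotMatrix_mem a b) f hf

theorem IsActStable.sup {U V : Submodule ℝ (SuperPoly m n)} (hU : IsActStable U)
    (hV : IsActStable V) : IsActStable (U ⊔ V) := by
  intro A hA f hf
  obtain ⟨u, hu, v, hv, rfl⟩ := Submodule.mem_sup.mp hf
  rw [map_add]
  exact Submodule.add_mem_sup (hU A hA u hu) (hV A hA v hv)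

theorem isActStable_casEigen (k : ℕ) (c : ℝ) : IsActStable (casEigen m n k c) :=
  fun A hA _ hf => casEigen_map (casimir_comm_act hA)
    (fun _ h => euler_comm_of (euler_act A) h) hf

theorem isActStable_iSup {ι : Sort*} {U : ι → Submodule ℝ (SuperPoly m n)}
    (hU : ∀ i, IsActStable (U i)) : IsActStable (⨆ i, U i) := by
  intro A hA f hf
  induction hf using Submodule.iSup_induction' with
  | mem i f hf => exact Submodule.mem_iSup_of_mem i (hU i A hA f hf)
  | zero => rw [map_zero]; exact zero_mem _
  | add x y _ _ hx hy => rw [map_add]; exact add_mem hx hy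

/-- The power `x_{m+1}^ℓ`. -/
def lastPow (m n l : ℕ) : SuperPoly (m + 1) n := (X (lastIdx m n) ^ l) (one (m + 1) n)

theorem lastPow_eq (l : ℕ) :
    lastPow m n l = (X (lastIdx m n) ^ l) (incl m n (one m n)) := by
  rw [lastPow, incl_one]

theorem euler_lastPow (l : ℕ) :
    euler (m + 1) n (lastPow m n l) = (l : ℝ) • lastPow m n l := by
  rw [lastPow, euler_X_pow_of (μ := 0) (by rw [euler_one, zero_smul]), zero_add]

theorem act_lastPow (A : Matrix (Idx m n) (Idx m n) ℝ) (hA : A ∈ osp m n) (l : ℕ) :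
    act (extendMatrix A) (lastPow m n l) = 0 := by
  rw [lastPow_eq, act_X_last_pow_incl, isInvariant_one A hA, map_zero, map_zero]

theorem Dd_emb (b : Idx m n) (g : SuperPoly m n) :
    Dd (emb b) (incl m n g) = incl m n (Dd b g) := by
  rw [Dd, LinearMap.sum_apply, sum_idx_succ, LinearMap.smul_apply, D_last_incl, smul_zero, zero_add,
    Dd, LinearMap.sum_apply, map_sum]
  refine Finset.sum_congr rfl fun j _ => ?_
  rw [LinearMap.smul_apply, LinearMap.smul_apply, map_smul, incl_D]
  congr 1
  rcases b with b | b <;> rcases j with j | j <;> simp [gLow, emb, Matrix.one_apply]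

theorem Dd_emb_X_last_pow (b : Idx m n) (j : ℕ) (g : SuperPoly m n) :
    Dd (emb b) ((X (lastIdx m n) ^ j) (incl m n g)) = (X (lastIdx m n) ^ j) (incl m n (Dd b g)) := by
  rw [← Dd_emb, Dd, LinearMap.sum_apply, LinearMap.sum_apply, map_sum, sum_idx_succ, sum_idx_succ]
  congr 1
  · rw [LinearMap.smul_apply, LinearMap.smul_apply]
    rcases b with b | b <;> simp [gLow, emb, lastIdx]
  · refine Finset.sum_congr rfl fun i _ => ?_
    rw [LinearMap.smul_apply, LinearMap.smul_apply, map_smul, D_emb_X_last_pow]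

theorem rot_last_emb (b : Idx m n) (j : ℕ) (g : SuperPoly m n) :
    rot (lastIdx m n) (emb b) ((X (lastIdx m n) ^ j) (incl m n g))
      = (X (lastIdx m n) ^ (j + 1)) (incl m n (Dd b g))
        - (j : ℝ) • (X (lastIdx m n) ^ (j - 1)) (incl m n (X b g)) := by
  have h2 : Dd (lastIdx m n) = D (lastIdx m n) := Dd_inl _
  rw [rot, sg_last', one_smul, h2, LinearMap.sub_apply, Module.End.mul_apply,
    Module.End.mul_apply, Dd_emb_X_last_pow, D_last_X_last_pow_incl, map_smul, incl_X, ← X_X_last_pow (emb b),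
    pow_succ' _ j, Module.End.mul_apply]

/-- `𝒫_ℓ(ℝ^{m+1|2n})` is generated by `x_{m+1}^ℓ` as an `𝔬𝔰𝔭(m+1|2n)`-module. -/
theorem Homog_le_of_lastPow_mem {U : Submodule ℝ (SuperPoly (m + 1) n)} (hU : IsActStable U) {l : ℕ}
    (h : lastPow m n l ∈ U) : Homog (m + 1) n l ≤ U := by
  -- Induction on the degree r in the other variables. Euler's formula writes g as a combination of
  -- X_b∂_b g.
  have key : ∀ r ≤ l, ∀ g : SuperPoly m n, euler m n g = (r : ℝ) • g →
      (X (lastIdx m n) ^ (l - r)) (incl m n g) ∈ U := by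
    intro r
    induction r using Nat.strong_induction_on with
    | _ r ih =>
      intro hr g hg
      rcases r with _ | r
      · obtain ⟨c, rfl⟩ := exists_smul_one hg (fun r h => by
          have : (0 : ℝ) ≤ r := r.cast_nonneg
          simp at h; linarith)
        rw [map_smul, map_smul, Nat.sub_zero, ← lastPow_eq]
        exact U.smul_mem c h
      · have hsum : g = ((r + 1 : ℕ) : ℝ)⁻¹ • ∑ b, X b (D b g) := by
          rw [← euler_apply, hg, inv_smul_smul₀ (by positivity)]
        rw [hsum, map_smul, map_smul, map_sum, map_sum]
        refine U.smul_mem _ (U.sum_mem fun b _ => ?_)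
        have hD : euler m n (D b g) = (r : ℝ) • D b g := by
          rw [euler_D_of hg]; push_cast; congr 1; ring
        -- The rotation of x and X_b, applied to x^{l-r}∂_b g, gives the wanted x^{l-r-1}X_b∂_b g
        -- with coefficient -(l-r) ≠ 0, up to a term of degree r - 1 in the other variables.
        have h1 := hU.rot_mem (lastIdx m n) (emb b) (ih r (by omega) (by omega) (D b g) hD)
        rw [rot_last_emb] at h1
        have h2 : (X (lastIdx m n) ^ (l - r + 1)) (incl m n (Dd b (D b g))) ∈ U := by
          rcases r with _ | r
          · rw [eq_zero_of_euler_neg (euler_Dd_of hD b) (by simp), map_zero, map_zero]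
            exact U.zero_mem
          · rw [show l - (r + 1) + 1 = l - r by omega]
            exact ih r (by omega) (by omega) _ (by
              rw [euler_Dd_of hD]; push_cast; congr 1; ring)
        have h3 := U.sub_mem h2 h1
        rw [sub_sub_cancel] at h3
        have hne : ((l - r : ℕ) : ℝ) ≠ 0 := by
          have : 0 < l - r := by omega
          positivity
        have h4 := U.smul_mem ((l - r : ℕ) : ℝ)⁻¹ h3
        rwa [inv_smul_smul₀ hne, show l - r - 1 = l - (r + 1) by omega] at h4
  intro f hf
  have hf' := mem_Homog.mp hf
  rw [← taylor hf']
  refine U.sum_mem fun j hj => ?_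
  have hj' : j ≤ l := by simpa [Nat.lt_succ_iff] using hj
  have := key (l - j) (by omega) (coeff j f) (by rw [euler_coeff hf', Nat.cast_sub hj'])
  rwa [Nat.sub_sub_self hj'] at this

theorem lap_lastPow (l : ℕ) :
    lap (m + 1) n (lastPow m n l) = ((l : ℝ) * ((l - 1 : ℕ) : ℝ)) • lastPow m n (l - 2) := by
  rw [lastPow_eq, lap_X_last_pow_incl, lap_one, map_zero, map_zero, add_zero, ← lastPow_eq]

/-- The submodule of the superpolynomials `q(C) f`, where `C` is the Casimir operator. -/
def casPoly (f : SuperPoly m n) : Submodule ℝ (SuperPoly m n) :=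
  LinearMap.range ((LinearMap.applyₗ f) ∘ₗ (Polynomial.aeval (casimir m n)).toLinearMap)

theorem mem_casPoly {f g : SuperPoly m n} :
    g ∈ casPoly f ↔ ∃ q : Polynomial ℝ, g = Polynomial.aeval (casimir m n) q f := by
  simp [casPoly, LinearMap.mem_range, eq_comm]

theorem casimir_mem_casPoly {f g : SuperPoly m n} (h : g ∈ casPoly f) :
    casimir m n g ∈ casPoly f := by
  obtain ⟨q, rfl⟩ := mem_casPoly.mp h
  exact mem_casPoly.mpr ⟨Polynomial.X * q, by rw [map_mul, Polynomial.aeval_X]; rfl⟩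

/-- C x^{a+2} is a combination of x^{a+2} and R²x^a, the latter with coefficient -(a+2)(a+1) ≠ 0. As
C commutes with R², each application of C trades x² for R². -/
theorem Rsq_pow_lastPow_mem (i a l : ℕ) (h : a + 2 * i = l) :
    (Rsq (m + 1) n ^ i) (lastPow m n a) ∈ casPoly (lastPow m n l) := by
  induction i generalizing a with
  | zero =>
    obtain rfl : a = l := by omega
    exact mem_casPoly.mpr ⟨1, by simp⟩
  | succ i ih =>
    have h1 := ih (a + 2) (by omega)
    have h2 := casimir_mem_casPoly h1
    have h3 : casimir (m + 1) n (lastPow m n (a + 2)) = cas (m + 1) n (a + 2) • lastPow m n (a + 2)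
        - (((a + 2 : ℕ) : ℝ) * ((a + 1 : ℕ) : ℝ)) • Rsq (m + 1) n (lastPow m n a) := by
      have := Rsq_lap_of (euler_lastPow (m := m) (n := n) (a + 2))
      rw [lap_lastPow, map_smul, Nat.add_sub_cancel, show a + 2 - 1 = a + 1 by omega] at this
      rw [this, sub_sub_cancel]
    rw [← Module.End.mul_apply, ((casimir_comm_Rsq (m + 1) n).pow_right i).eq,
      Module.End.mul_apply, h3, map_sub, map_smul, map_smul, ← Module.End.mul_apply (_ ^ i),
      ← pow_succ] at h2
    have h4 := (casPoly (lastPow m n l)).sub_mem (Submodule.smul_mem _ (cas (m + 1) n (a + 2)) h1) h2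
    rw [sub_sub_cancel] at h4
    have hne : (((a + 2 : ℕ) : ℝ) * ((a + 1 : ℕ) : ℝ)) ≠ 0 := by positivity
    have h5 := Submodule.smul_mem _ (((a + 2 : ℕ) : ℝ) * ((a + 1 : ℕ) : ℝ))⁻¹ h4
    rwa [inv_smul_smul₀ hne] at h5

theorem Rsq_X_last_pow (j : ℕ) (f : SuperPoly (m + 1) n) :
    Rsq (m + 1) n ((X (lastIdx m n) ^ j) f) = (X (lastIdx m n) ^ j) (Rsq (m + 1) n f) := by
  have : Commute (Rsq (m + 1) n) (X (lastIdx m n) ^ j) :=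
    Commute.pow_right (Rsq_mul_X (lastIdx m n)) j
  exact LinearMap.congr_fun this.eq f

/-- Substitute R² - x² for the square norm of the hyperplane until only monomials in x and the full
R² remain. -/
theorem X_last_pow_Rsq_pow_mem (i j a l : ℕ) (h : a + 2 * j + 2 * i = l) :
    (Rsq (m + 1) n ^ j) ((X (lastIdx m n) ^ a) (incl m n ((Rsq m n ^ i) (one m n))))
      ∈ casPoly (lastPow m n l) := by
  induction i generalizing j a with
  | zero =>
    rw [pow_zero, Module.End.one_apply, ← lastPow_eq]
    exact Rsq_pow_lastPow_mem j a l (by omega)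
  | succ i ih =>
    have h1 := Rsq_incl ((Rsq m n ^ i) (one m n))
    have h2 : incl m n ((Rsq m n ^ (i + 1)) (one m n))
        = Rsq (m + 1) n (incl m n ((Rsq m n ^ i) (one m n)))
          - X (lastIdx m n) (X (lastIdx m n) (incl m n ((Rsq m n ^ i) (one m n)))) := by
      rw [h1, pow_succ', Module.End.mul_apply]; abel
    rw [h2, map_sub, map_sub]
    refine Submodule.sub_mem _ ?_ ?_
    · rw [← Rsq_X_last_pow, ← Module.End.mul_apply (_ ^ j), ← pow_succ]
      exact ih (j + 1) a (by omega)
    · rw [← Module.End.mul_apply (_ ^ a), ← Module.End.mul_apply (_ ^ a * _), ← pow_succ, ← pow_succ]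
      exact ih j (a + 2) (by omega)

theorem exists_poly_of_isRsqPow {l : ℕ} {f : SuperPoly (m + 1) n}
    (hf : euler (m + 1) n f = (l : ℝ) • f) (h : ∀ j ≤ l, IsRsqPow (l - j) (coeff j f)) :
    ∃ q : Polynomial ℝ, f = Polynomial.aeval (casimir (m + 1) n) q (lastPow m n l) := by
  rw [← mem_casPoly, ← taylor hf]
  refine Submodule.sum_mem _ fun j hj => ?_
  have hj' : j ≤ l := by simpa [Nat.lt_succ_iff] using hj
  obtain ⟨h1, c, hc⟩ := h j hj'
  rcases Nat.mod_two_eq_zero_or_one (l - j) with h2 | h2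
  · rw [hc, map_smul, map_smul]
    refine Submodule.smul_mem _ c ?_
    exact X_last_pow_Rsq_pow_mem ((l - j) / 2) 0 j l (by omega)
  · rw [h1 h2, map_zero, map_zero]
    exact Submodule.zero_mem _

theorem act_coeff (A : Matrix (Idx m n) (Idx m n) ℝ) (j : ℕ) (f : SuperPoly (m + 1) n) :
    act A (coeff j f) = coeff j (act (extendMatrix A) f) := by
  have : ∀ j, (D (lastIdx m n) ^ j) (act (extendMatrix A) f)
      = act (extendMatrix A) ((D (lastIdx m n) ^ j) f) := by
    intro j
    induction j with
    | zero => rfl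
    | succ j ih => rw [pow_succ', Module.End.mul_apply, ih, D_last_act]; rfl
  rw [coeff, map_smul, ← res_act, coeff, this]

theorem aeval_casimir_comm {T : Module.End ℝ (SuperPoly m n)} (hT : Commute (casimir m n) T)
    (q : Polynomial ℝ) (f : SuperPoly m n) : Polynomial.aeval (casimir m n) q (T f)
      = T (Polynomial.aeval (casimir m n) q f) := by
  have h : Commute (Polynomial.aeval (casimir m n) q) T := by
    induction q using Polynomial.induction_on' with
    | add p q hp hq => rw [map_add]; exact hp.add_left hq
    | monomial k c =>
      rw [Polynomial.aeval_monomial]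
      exact (Algebra.commute_algebraMap_left c T).mul_left (hT.pow_left k)
  exact LinearMap.congr_fun h.eq f

/-- Either u or (C - c)u is a true nonzero eigenvector of C, and q(C) acts on it both by q(c) and by
t. -/
theorem eval_eq_of_mem_casEigen {k : ℕ} {c t : ℝ} {u : SuperPoly m n} (hu : u ∈ casEigen m n k c)
    (hu0 : u ≠ 0) {q : Polynomial ℝ} (h : Polynomial.aeval (casimir m n) q u = t • u) :
    q.eval c = t := by
  have key : ∀ v : SuperPoly m n, v ≠ 0 → casimir m n v = c • v →
      Polynomial.aeval (casimir m n) q v = t • v → q.eval c = t := by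
    intro v hv hc hq
    rw [aeval_apply_of_eigen hc] at hq
    exact smul_left_injective ℝ hv hq
  have h2 := (mem_casEigen.mp hu).2
  by_cases h0 : casimir m n u - c • u = 0
  · exact key u hu0 (sub_eq_zero.mp h0) h
  · refine key _ h0 h2 ?_
    rw [map_sub, map_smul, aeval_casimir_comm (Commute.refl _), h, map_smul, smul_sub, smul_comm]

/-- The sum of the generalized eigenspaces of the Casimir operator on `𝒫_k` for the eigenvalues
different from `c`. -/
def casCompl (m n k : ℕ) (c : ℝ) : Submodule ℝ (SuperPoly m n) :=
  ⨆ d : {d : ℝ // d ≠ c}, casEigen m n k d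

theorem isActStable_casCompl (k : ℕ) (c : ℝ) : IsActStable (casCompl m n k c) :=
  isActStable_iSup fun d => isActStable_casEigen k d

theorem Homog_le_casEigen_sup (k : ℕ) (c : ℝ) :
    Homog m n k ≤ casEigen m n k c ⊔ casCompl m n k c := by
  refine (Homog_le_iSup k).trans (iSup_le fun l => ?_)
  by_cases h : cas m n l = c
  · rw [h]; exact le_sup_left
  · exact le_sup_of_le_right (le_iSup (fun d : {d : ℝ // d ≠ c} => casEigen m n k d) ⟨_, h⟩)

theorem disjoint_casEigen (k : ℕ) (c : ℝ) : Disjoint (casEigen m n k c) (casCompl m n k c) := by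
  refine (iSupIndep_casEigen m n (k, c)).mono_right (iSup_le fun d => ?_)
  exact le_iSup₂_of_le (k, (d : ℝ)) (by simpa using d.2) le_rfl

theorem disjoint_sup_casCompl {k : ℕ} {c : ℝ} {U₁ U₂ : Submodule ℝ (SuperPoly m n)}
    (hW : U₁ ⊔ U₂ = casEigen m n k c) (hd : U₁ ⊓ U₂ = ⊥) :
    Disjoint U₁ (U₂ ⊔ casCompl m n k c) := by
  rw [Submodule.disjoint_def]
  intro x hx hx2
  obtain ⟨u, hu, w, hw, rfl⟩ := Submodule.mem_sup.mp hx2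
  have hxW : u + w ∈ casEigen m n k c := hW ▸ Submodule.mem_sup_left hx
  have huW : u ∈ casEigen m n k c := hW ▸ Submodule.mem_sup_right hu
  have hw0 : w = 0 := by
    refine Submodule.disjoint_def.mp (disjoint_casEigen k c) w ?_ hw
    have := Submodule.sub_mem _ hxW huW
    rwa [add_sub_cancel_left] at this
  rw [hw0, add_zero] at hx ⊢
  have : u ∈ U₁ ⊓ U₂ := ⟨hx, hu⟩
  rw [hd] at this
  exact (Submodule.mem_bot ℝ).mp this

/-- A decomposition of `x_{m+1}^ℓ` along a decomposition of a generalized eigenspace of the Casimir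
operator. -/
theorem exists_decomposition_lastPow {l : ℕ} {c : ℝ} {U₁ U₂ : Submodule ℝ (SuperPoly (m + 1) n)}
    (hW : U₁ ⊔ U₂ = casEigen (m + 1) n l c) :
    ∃ a ∈ U₁, ∃ b ∈ U₂ ⊔ casCompl (m + 1) n l c, a + b = lastPow m n l := by
  have h : lastPow m n l ∈ U₁ ⊔ (U₂ ⊔ casCompl (m + 1) n l c) := by
    rw [← sup_assoc, hW]
    exact Homog_le_casEigen_sup l c (mem_Homog.mpr (euler_lastPow l))
  exact Submodule.mem_sup.mp h

/-- The hyperplane algebra kills x^ℓ, so it maps a to minus the image of b, an element of U ∩ B = 0.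
-/
theorem coeff_isInvariant_of_add_eq_lastPow {l : ℕ} {U B : Submodule ℝ (SuperPoly (m + 1) n)}
    (hU : IsActStable U) (hB : IsActStable B) (hd : Disjoint U B) {a b : SuperPoly (m + 1) n}
    (ha : a ∈ U) (hb : b ∈ B) (h : a + b = lastPow m n l) {A : Matrix (Idx m n) (Idx m n) ℝ}
    (hA : A ∈ osp m n) : act (extendMatrix A) a = 0 := by
  have h1 := act_lastPow A hA l
  rw [← h, map_add] at h1
  have h2 := hU _ (extendMatrix_mem_osp hA) a ha
  refine Submodule.disjoint_def.mp hd _ h2 ?_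
  rw [eq_neg_of_add_eq_zero_left h1]
  exact B.neg_mem (hB _ (extendMatrix_mem_osp hA) b hb)

/-- The projection to U₁ is determined by its value on the generator x^ℓ. That value has invariant
coefficients and hence is q(C)x^ℓ, so the projection is a polynomial in an operator with one
eigenvalue. -/
theorem eq_bot_or_eq_bot_of_invariants {l : ℕ} {c : ℝ}
    (hinv : ∀ a ≤ l, ∀ h : SuperPoly m n, euler m n h = (a : ℝ) • h → IsInvariant h → IsRsqPow a h)
    {U₁ U₂ : Submodule ℝ (SuperPoly (m + 1) n)} (h₁ : IsActStable U₁) (h₂ : IsActStable U₂)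
    (hW : U₁ ⊔ U₂ = casEigen (m + 1) n l c) (hd : U₁ ⊓ U₂ = ⊥) : U₁ = ⊥ ∨ U₂ = ⊥ := by
  set B := U₂ ⊔ casCompl (m + 1) n l c with hBdef
  have hB : IsActStable B := h₂.sup (isActStable_casCompl l c)
  have hdB : Disjoint U₁ B := disjoint_sup_casCompl hW hd
  have hU₁ : U₁ ≤ casEigen (m + 1) n l c := hW ▸ le_sup_left
  have hU₂ : U₂ ≤ casEigen (m + 1) n l c := hW ▸ le_sup_right
  obtain ⟨a, ha, b, hb, hab⟩ := exists_decomposition_lastPow hW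
  have haE := (mem_casEigen.mp (hU₁ ha)).1
  obtain ⟨q, hq⟩ := exists_poly_of_isRsqPow haE fun j hj => hinv (l - j) (by omega) _
    (by rw [euler_coeff haE, Nat.cast_sub hj]) fun A hA => by
      rw [act_coeff, coeff_isInvariant_of_add_eq_lastPow h₁ hB hdB ha hb hab hA]
      simp [coeff]
  set T := Polynomial.aeval (casimir (m + 1) n) q with hT
  -- The elements on which q(C) acts as the projection to U₁ along B. This is a stable subspace
  -- containing x^ℓ, hence all of 𝒫_ℓ.
  let Y : Submodule ℝ (SuperPoly (m + 1) n) :=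
    U₁.comap T ⊓ B.comap (LinearMap.id - T)
  have hY : IsActStable Y := by
    intro A hA f hf
    have hc : T (act A f) = act A (T f) := aeval_casimir_comm (casimir_comm_act hA) q f
    refine ⟨?_, ?_⟩
    · rw [SetLike.mem_coe, Submodule.mem_comap, hc]
      exact h₁ A hA _ hf.1
    · rw [SetLike.mem_coe, Submodule.mem_comap, LinearMap.sub_apply, LinearMap.id_apply, hc,
        ← map_sub]
      exact hB A hA _ hf.2
  have hYl : lastPow m n l ∈ Y := by
    refine ⟨?_, ?_⟩
    · rw [SetLike.mem_coe, Submodule.mem_comap, ← hq]; exact ha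
    · rw [SetLike.mem_coe, Submodule.mem_comap, LinearMap.sub_apply, LinearMap.id_apply, ← hq,
        ← hab, add_sub_cancel_left]
      exact hb
  have hle := Homog_le_of_lastPow_mem hY hYl
  have e₁ : ∀ u ∈ U₁, T u = (1 : ℝ) • u := by
    intro u hu
    have h := hle (mem_Homog.mpr (mem_casEigen.mp (hU₁ hu)).1)
    have h0 : u - T u = 0 := Submodule.disjoint_def.mp hdB _ (U₁.sub_mem hu h.1) h.2
    rw [one_smul]
    exact (sub_eq_zero.mp h0).symm
  have e₂ : ∀ u ∈ U₂, T u = (0 : ℝ) • u := by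
    intro u hu
    have h := hle (mem_Homog.mpr (mem_casEigen.mp (hU₂ hu)).1)
    rw [zero_smul]
    refine Submodule.disjoint_def.mp hdB _ h.1 ?_
    have := B.sub_mem (Submodule.mem_sup_left hu) h.2
    rwa [LinearMap.sub_apply, LinearMap.id_apply, sub_sub_cancel] at this
  by_contra! hne
  obtain ⟨u₁, hu₁, hu₁0⟩ := Submodule.exists_mem_ne_zero_of_ne_bot hne.1
  obtain ⟨u₂, hu₂, hu₂0⟩ := Submodule.exists_mem_ne_zero_of_ne_bot hne.2
  have t₁ := eval_eq_of_mem_casEigen (hU₁ hu₁) hu₁0 (e₁ u₁ hu₁)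
  have t₂ := eval_eq_of_mem_casEigen (hU₂ hu₂) hu₂0 (e₂ u₂ hu₂)
  exact one_ne_zero (t₁.symm.trans t₂)

/-! ### The plane: ℋ_ℓ(ℝ^{2|2n}) for ℓ > 2n -/

/-- The extension of an operator on `V` to the complexification `V × V` of `V`. -/
def cpx {V : Type*} [AddCommGroup V] [Module ℝ V] : Module.End ℝ V →+* Module.End ℝ (V × V) :=
  (LinearMap.prodMapRingHom ℝ V V).comp ((RingHom.id _).prod (RingHom.id _))

/-- The multiplication by the imaginary unit on the complexification `V × V` of `V`. -/
def imag {V : Type*} [AddCommGroup V] [Module ℝ V] : Module.End ℝ (V × V) :=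
  (-LinearMap.snd ℝ V V).prod (LinearMap.fst ℝ V V)

section cpx

variable {V : Type*} [AddCommGroup V] [Module ℝ V]

theorem cpx_apply (T : Module.End ℝ V) (w : V × V) : cpx T w = (T w.1, T w.2) := rfl

theorem imag_apply (w : V × V) : imag w = (-w.2, w.1) := rfl

theorem imag_imag (w : V × V) : imag (imag w) = -w := by
  simp [imag_apply, Prod.ext_iff]

theorem cpx_imag (T : Module.End ℝ V) (w : V × V) : cpx T (imag w) = imag (cpx T w) := by
  simp [cpx_apply, imag_apply]

/-- A family of anticommuting operators has a common null vector. -/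
theorem exists_forall_apply_eq_zero {ι : Type*} (R : ι → Module.End ℝ V)
    (hR : ∀ r s w, R r (R s w) + R s (R r w) = 0) (P : V → Prop)
    (hP : ∀ r w, P w → P (R r w)) {w : V} (hw : w ≠ 0) (hPw : P w) (S : Finset ι) :
    ∃ w', w' ≠ 0 ∧ P w' ∧ ∀ r ∈ S, R r w' = 0 := by
  classical
  induction S using Finset.induction_on with
  | empty => exact ⟨w, hw, hPw, by simp⟩
  | insert r S _ ih =>
    obtain ⟨w', h0, h1, h2⟩ := ih
    by_cases h : R r w' = 0
    · exact ⟨w', h0, h1, by simpa [h] using h2⟩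
    · refine ⟨R r w', h, hP r w' h1, fun s hs => ?_⟩
      rcases Finset.mem_insert.mp hs with rfl | hs
      · have := hR s s w'
        rw [← two_smul ℝ] at this
        exact (smul_eq_zero.mp this).resolve_left two_ne_zero
      · have := hR s r w'
        rwa [h2 s hs, map_zero, add_zero] at this

end cpx

/-- The first coordinate `x` of the plane. -/
abbrev xIdx (n : ℕ) : Idx 2 n := emb (lastIdx 0 n)

/-- The second coordinate `y` of the plane. -/
abbrev yIdx (n : ℕ) : Idx 2 n := lastIdx 1 n

/-- Multiplication by `z = x + i y`. -/
def mulZ (n : ℕ) : Module.End ℝ (SuperPoly 2 n × SuperPoly 2 n) :=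
  cpx (X (xIdx n)) + imag * cpx (X (yIdx n))

/-- The derivative `∂_x + i ∂_y`. -/
def dbar (n : ℕ) : Module.End ℝ (SuperPoly 2 n × SuperPoly 2 n) :=
  cpx (D (xIdx n)) + imag * cpx (D (yIdx n))

/-- The raising operator `z ∂^r - θ_r (∂_x + i ∂_y)`. -/
def raise (r : Fin n × Fin 2) : Module.End ℝ (SuperPoly 2 n × SuperPoly 2 n) :=
  cpx (rot (xIdx n) (Sum.inr r)) + imag * cpx (rot (yIdx n) (Sum.inr r))

/-- The infinitesimal rotation `x ∂_y - y ∂_x` of the plane. -/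
def planeRot (n : ℕ) : Module.End ℝ (SuperPoly 2 n) := rot (xIdx n) (yIdx n)

section plane

variable (w : SuperPoly 2 n × SuperPoly 2 n)

theorem mulZ_apply : mulZ n w = cpx (X (xIdx n)) w + imag (cpx (X (yIdx n)) w) := rfl

theorem dbar_apply : dbar n w = cpx (D (xIdx n)) w + imag (cpx (D (yIdx n)) w) := rfl

theorem raise_apply' (r : Fin n × Fin 2) : raise r w
    = cpx (rot (xIdx n) (Sum.inr r)) w + imag (cpx (rot (yIdx n) (Sum.inr r)) w) := rfl

theorem sg_xIdx (i : Idx 2 n) : sg (xIdx n) i = 1 := by simp [sg, xIdx, emb, lastIdx, par]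

theorem sg_xIdx' (i : Idx 2 n) : sg i (xIdx n) = 1 := by rw [sg_comm, sg_xIdx]

theorem Dd_xIdx : (Dd (xIdx n) : Module.End ℝ (SuperPoly 2 n)) = D (xIdx n) := Dd_inl _

theorem Dd_yIdx : (Dd (yIdx n) : Module.End ℝ (SuperPoly 2 n)) = D (yIdx n) := Dd_inl _

theorem raise_apply (r : Fin n × Fin 2) : raise r w
    = mulZ n (cpx (Dd (Sum.inr r)) w) - cpx (X (Sum.inr r)) (dbar n w) := by
  rw [raise_apply', rot, rot, sg_xIdx, sg_last', one_smul, one_smul, Dd_xIdx, Dd_yIdx, mulZ_apply,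
    dbar_apply, map_add, cpx_imag, map_sub, map_sub, map_mul, map_mul, map_mul, map_mul]
  simp only [LinearMap.sub_apply, Module.End.mul_apply, map_sub]
  abel

theorem mulZ_cpx {T : Module.End ℝ (SuperPoly 2 n)} (hx : Commute (X (xIdx n)) T)
    (hy : Commute (X (yIdx n)) T) : mulZ n (cpx T w) = cpx T (mulZ n w) := by
  rw [mulZ_apply, mulZ_apply, map_add, cpx_imag]
  simp only [← Module.End.mul_apply, ← map_mul, hx.eq, hy.eq]

theorem dbar_cpx {T : Module.End ℝ (SuperPoly 2 n)} (hx : Commute (D (xIdx n)) T)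
    (hy : Commute (D (yIdx n)) T) : dbar n (cpx T w) = cpx T (dbar n w) := by
  rw [dbar_apply, dbar_apply, map_add, cpx_imag]
  simp only [← Module.End.mul_apply, ← map_mul, hx.eq, hy.eq]

/-- (∂_x + i∂_y)(x + iy) = 1 + i² = 0. -/
theorem dbar_mulZ : dbar n (mulZ n w) = mulZ n (dbar n w) := by
  have h : ∀ f : SuperPoly 2 n, D (xIdx n) (X (xIdx n) f) = X (xIdx n) (D (xIdx n) f) + f := by
    intro f
    rw [D_X_apply, sg_xIdx, if_pos rfl, one_smul, one_smul]
  simp only [dbar_apply, mulZ_apply, cpx_apply, imag_apply, Prod.mk_add_mk, map_add, map_neg,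
    D_last_X_emb, D_emb_X_last, D_last_X_last, h]
  ext <;> simp only <;> abel

theorem commute_X_Dd (i : Fin 2) (r : Fin n × Fin 2) :
    Commute (X (Sum.inl i) : Module.End ℝ (SuperPoly 2 n)) (Dd (Sum.inr r)) := by
  have := Dd_mul_X (m := 2) (Sum.inr r) (Sum.inl i : Idx 2 n)
  rw [Commute, SemiconjBy, this]
  simp [sg, par, gLow]

theorem commute_X_X (i : Fin 2) (j : Idx 2 n) :
    Commute (X (Sum.inl i) : Module.End ℝ (SuperPoly 2 n)) (X j) := by
  rw [Commute, SemiconjBy, X_mul_X]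
  simp [sg, par]

theorem commute_D_D (i : Fin 2) (j : Idx 2 n) :
    Commute (D (Sum.inl i) : Module.End ℝ (SuperPoly 2 n)) (D j) := by
  rw [Commute, SemiconjBy, D_mul_D]
  simp [sg, par]

theorem commute_D_Dd (i : Fin 2) (j : Idx 2 n) :
    Commute (D (Sum.inl i) : Module.End ℝ (SuperPoly 2 n)) (Dd j) := by
  rw [Commute, SemiconjBy, D_mul_Dd]
  simp [sg, par]

theorem commute_D_X (i : Fin 2) (r : Fin n × Fin 2) :
    Commute (D (Sum.inl i) : Module.End ℝ (SuperPoly 2 n)) (X (Sum.inr r)) := by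
  rw [Commute, SemiconjBy, D_mul_X]
  simp [sg, par]

/-- z and ∂_x + i∂_y commute with each other and with the fermionic operators, which anticommute up
to the constants g_{rs}; these cancel because the fermionic block of g is antisymmetric. -/
theorem raise_raise (r s : Fin n × Fin 2) : raise r (raise s w) + raise s (raise r w) = 0 := by
  have hZA : ∀ (r : Fin n × Fin 2) w, mulZ n (cpx (Dd (Sum.inr r)) w) = cpx (Dd (Sum.inr r)) (mulZ n w) :=
    fun r w => mulZ_cpx w (commute_X_Dd _ r) (commute_X_Dd _ r)
  have hZX : ∀ (r : Fin n × Fin 2) w, mulZ n (cpx (X (Sum.inr r)) w) = cpx (X (Sum.inr r)) (mulZ n w) :=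
    fun r w => mulZ_cpx w (commute_X_X _ _) (commute_X_X _ _)
  have hDA : ∀ (r : Fin n × Fin 2) w, dbar n (cpx (Dd (Sum.inr r)) w) = cpx (Dd (Sum.inr r)) (dbar n w) :=
    fun r w => dbar_cpx w (commute_D_Dd _ _) (commute_D_Dd _ _)
  have hDX : ∀ (r : Fin n × Fin 2) w, dbar n (cpx (X (Sum.inr r)) w) = cpx (X (Sum.inr r)) (dbar n w) :=
    fun r w => dbar_cpx w (commute_D_X _ _) (commute_D_X _ _)
  have hAA : ∀ w : SuperPoly 2 n × SuperPoly 2 n, cpx (Dd (Sum.inr r)) (cpx (Dd (Sum.inr s)) w)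
      = - cpx (Dd (Sum.inr s)) (cpx (Dd (Sum.inr r)) w) := by
    intro w
    have : (Dd (Sum.inr r) * Dd (Sum.inr s) : Module.End ℝ (SuperPoly 2 n))
        = - (Dd (Sum.inr s) * Dd (Sum.inr r)) := by
      have h : ∀ j : Idx 2 n, (gLow 2 n (Sum.inr r) j • (D j * Dd (Sum.inr s))
          : Module.End ℝ (SuperPoly 2 n))
          = - (gLow 2 n (Sum.inr r) j • (Dd (Sum.inr s) * D j)) := by
        intro j
        rw [D_mul_Dd]
        rcases j with j | j <;> simp [gLow, sg, par]
      rw [Dd, Finset.sum_mul, Finset.mul_sum, ← Finset.sum_neg_distrib]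
      simp only [smul_mul_assoc, mul_smul_comm, h]
    rw [← Module.End.mul_apply, ← Module.End.mul_apply, ← map_mul, ← map_mul, this, map_neg]
    rfl
  have hXX : ∀ w : SuperPoly 2 n × SuperPoly 2 n, cpx (X (Sum.inr r)) (cpx (X (Sum.inr s)) w)
      = - cpx (X (Sum.inr s)) (cpx (X (Sum.inr r)) w) := by
    intro w
    rw [← Module.End.mul_apply, ← Module.End.mul_apply, ← map_mul, ← map_mul, X_mul_X]
    simp [sg, par]
  have hAX : ∀ (r s : Fin n × Fin 2) (w : SuperPoly 2 n × SuperPoly 2 n), cpx (Dd (Sum.inr r)) (cpx (X (Sum.inr s)) w)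
      = - cpx (X (Sum.inr s)) (cpx (Dd (Sum.inr r)) w) + gLow 2 n (Sum.inr r) (Sum.inr s) • w := by
    intro r s w
    rw [← Module.End.mul_apply, ← Module.End.mul_apply, ← map_mul, ← map_mul, Dd_mul_X]
    ext <;> simp [sg, par, cpx_apply]
  have hg : gLow 2 n (Sum.inr r) (Sum.inr s) = - gLow 2 n (Sum.inr s) (Sum.inr r) := by
    rw [gLow_symm]; simp [sgn, sg, par]
  simp only [raise_apply, map_sub, hZA, hZX, hDA, hDX, dbar_mulZ, hAA, hXX, hAX, map_add, map_neg,
    map_smul, hg]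
  module

theorem planeRot_apply (f : SuperPoly 2 n) :
    planeRot n f = X (xIdx n) (D (yIdx n) f) - X (yIdx n) (D (xIdx n) f) := by
  rw [planeRot, rot, sg_last, one_smul, Dd_xIdx, Dd_yIdx]
  rfl

theorem planeRot_comm {T : Module.End ℝ (SuperPoly 2 n)}
    (hX : ∀ i : Fin 2, Commute (X (Sum.inl i)) T) (hD : ∀ i : Fin 2, Commute (D (Sum.inl i)) T) :
    Commute (planeRot n) T := by
  have h : planeRot n = X (xIdx n) * D (yIdx n) - X (yIdx n) * D (xIdx n) :=
    LinearMap.ext planeRot_apply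
  rw [h]
  exact ((hX _).mul_left (hD _)).sub_left ((hX _).mul_left (hD _))

theorem planeRot_X_inr (r : Fin n × Fin 2) (f : SuperPoly 2 n) :
    planeRot n (X (Sum.inr r) f) = X (Sum.inr r) (planeRot n f) :=
  LinearMap.congr_fun (planeRot_comm (fun i => commute_X_X i _) fun i => commute_D_X i r).eq f

theorem planeRot_Dd_inr (r : Fin n × Fin 2) (f : SuperPoly 2 n) :
    planeRot n (Dd (Sum.inr r) f) = Dd (Sum.inr r) (planeRot n f) :=
  LinearMap.congr_fun (planeRot_comm (fun i => commute_X_Dd i r) fun i => commute_D_Dd i _).eq f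

theorem planeRot_mulZ :
    cpx (planeRot n) (mulZ n w) = mulZ n (cpx (planeRot n) w) + imag (mulZ n w) := by
  have hx : ∀ f : SuperPoly 2 n, D (xIdx n) (X (xIdx n) f) = X (xIdx n) (D (xIdx n) f) + f := by
    intro f
    rw [D_X_apply, sg_xIdx, if_pos rfl, one_smul, one_smul]
  simp only [mulZ_apply, cpx_apply, imag_apply, Prod.mk_add_mk, map_add, map_neg, map_sub,
    planeRot_apply, D_last_X_emb, D_emb_X_last, D_last_X_last, hx, X_X_last_comm (xIdx n)]
  ext <;> simp only <;> abel

theorem planeRot_dbar :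
    cpx (planeRot n) (dbar n w) = dbar n (cpx (planeRot n) w) + imag (dbar n w) := by
  have hx : ∀ f : SuperPoly 2 n, D (xIdx n) (X (xIdx n) f) = X (xIdx n) (D (xIdx n) f) + f := by
    intro f
    rw [D_X_apply, sg_xIdx, if_pos rfl, one_smul, one_smul]
  simp only [dbar_apply, cpx_apply, imag_apply, Prod.mk_add_mk, map_add, map_neg, map_sub,
    planeRot_apply, D_last_X_emb, D_emb_X_last, D_last_X_last, hx, D_D_last_comm (xIdx n)]
  ext <;> simp only <;> abel

/-- z and ∂_x + i∂_y both have weight one under -iL, and the fermionic factors have weight zero. So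
raising increases the eigenvalue of -iL by one. -/
theorem planeRot_raise (r : Fin n × Fin 2) :
    cpx (planeRot n) (raise r w) = raise r (cpx (planeRot n) w) + imag (raise r w) := by
  have h1 : ∀ w : SuperPoly 2 n × SuperPoly 2 n, cpx (planeRot n) (cpx (X (Sum.inr r)) w)
      = cpx (X (Sum.inr r)) (cpx (planeRot n) w) := fun w => by
    simp only [cpx_apply, planeRot_X_inr]
  have h2 : ∀ w : SuperPoly 2 n × SuperPoly 2 n, cpx (planeRot n) (cpx (Dd (Sum.inr r)) w)
      = cpx (Dd (Sum.inr r)) (cpx (planeRot n) w) := fun w => by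
    simp only [cpx_apply, planeRot_Dd_inr]
  simp only [raise_apply, map_sub, planeRot_mulZ, h1, h2, planeRot_dbar, map_add, cpx_imag]
  abel

/-- On the harmonics of degree `ℓ`, a vector annihilated by the raising operators satisfies
`(∂_x + i ∂_y) (ℓ - 2n - i L) w = 0` where `L` is the infinitesimal rotation of the plane. -/
theorem dbar_of_raise {l : ℕ} (h1 : w.1 ∈ Harm 2 n l) (h2 : w.2 ∈ Harm 2 n l)
    (h : ∀ r, raise r w = 0) :
    dbar n (((l : ℝ) - 2 * n) • w - imag (cpx (planeRot n) w)) = 0 := by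
  obtain ⟨e1, d1⟩ := mem_Harm.mp h1
  obtain ⟨e2, d2⟩ := mem_Harm.mp h2
  have hs : ((superdim 2 n : ℤ) : ℝ) = 2 - 2 * n := by simp [superdim]
  -- The contraction identity on harmonics; the constant is 1 - (ℓ - 1) - (2 - 2n) = -(ℓ - 2n).
  have key : ∀ (a b : Idx 2 n), (∀ (F : Idx 2 n → SuperPoly 2 n), ∑ i, F i = F a + F b
      + ∑ r, F (Sum.inr r)) → (∀ c, sg a c = 1) → sgn b = 1 → Dd a = D a →
      ∀ f, euler 2 n f = (l : ℝ) • f → lap 2 n f = 0 →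
      D b (rot a b f) - ∑ r, D (Sum.inr r) (rot a (Sum.inr r) f) = -((l : ℝ) - 2 * n) • D a f := by
    intro a b hab hsg hb hDd f hE hL
    have := LinearMap.congr_fun (sum_D_mul_rot a) f
    rw [LinearMap.sum_apply, hab] at this
    have haa : rot a a f = 0 := by
      rw [rot, hsg, one_smul, sub_self]; rfl
    simp only [hsg, hDd, LinearMap.smul_apply, Module.End.mul_apply, LinearMap.sub_apply,
      LinearMap.add_apply, Module.End.one_apply, hL, map_zero, haa, hb, hs, euler_D_of hE] at this
    have h3 : ∀ r : Fin n × Fin 2, sgn (Sum.inr r : Idx 2 n) = -1 := fun r => by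
      simp [sgn, sg, par]
    simp only [h3, mul_one, neg_smul, one_smul, smul_zero, zero_add, Finset.sum_neg_distrib] at this
    rw [sub_eq_add_neg, this]
    module
  have hsum : ∀ F : Idx 2 n → SuperPoly 2 n, ∑ i, F i = F (xIdx n) + F (yIdx n)
      + ∑ r, F (Sum.inr r) := by
    intro F
    rw [Fintype.sum_sum_type, Fin.sum_univ_two]
    rfl
  have kx := key (xIdx n) (yIdx n) hsum (sg_xIdx) (sg_last _) Dd_xIdx
  have ky := key (yIdx n) (xIdx n) (fun F => by rw [hsum F, add_comm (F (xIdx n))]) sg_last'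
    (sg_xIdx _) Dd_yIdx
  have hyx : ∀ f, rot (yIdx n) (xIdx n) f = - planeRot n f := fun f => by
    rw [planeRot, rot, rot, sg_last, sg_xIdx', one_smul, one_smul, LinearMap.sub_apply,
      LinearMap.sub_apply, neg_sub]
  have a1 := kx w.1 e1 d1
  have a2 := kx w.2 e2 d2
  have b1 := ky w.1 e1 d1
  have b2 := ky w.2 e2 d2
  rw [hyx, map_neg] at b1 b2
  -- Vanishing of the raising operators makes the fermionic sums cancel in the x-identity plus i
  -- times the y-identity, leaving only derivatives of w and Lw.
  have r1 : ∀ r, rot (xIdx n) (Sum.inr r) w.1 = rot (yIdx n) (Sum.inr r) w.2 := fun r => by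
    have := congrArg Prod.fst (h r)
    simp only [raise_apply', cpx_apply, imag_apply, Prod.fst_add, Prod.fst_zero] at this
    exact (sub_eq_zero.mp (by rw [sub_eq_add_neg]; exact this))
  have r2 : ∀ r, rot (xIdx n) (Sum.inr r) w.2 = - rot (yIdx n) (Sum.inr r) w.1 := fun r => by
    have := congrArg Prod.snd (h r)
    simp only [raise_apply', cpx_apply, imag_apply, Prod.snd_add, Prod.snd_zero] at this
    exact eq_neg_of_add_eq_zero_left this
  simp only [r1, r2, map_neg, Finset.sum_neg_distrib, sub_neg_eq_add] at a1 a2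
  change D (yIdx n) (planeRot n w.1) - _ = _ at a1
  change D (yIdx n) (planeRot n w.2) + _ = _ at a2
  have c1 : D (yIdx n) (planeRot n w.1) + D (xIdx n) (planeRot n w.2)
      = -((l : ℝ) - 2 * n) • (D (xIdx n) w.1 - D (yIdx n) w.2) := by
    rw [smul_sub, ← a1, ← b2]; abel
  have c2 : D (yIdx n) (planeRot n w.2) - D (xIdx n) (planeRot n w.1)
      = -((l : ℝ) - 2 * n) • (D (xIdx n) w.2 + D (yIdx n) w.1) := by
    rw [smul_add, ← a2, ← b1]; abel
  simp only [dbar_apply, cpx_apply, imag_apply, map_sub, map_smul, map_neg]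
  refine Prod.ext ?_ ?_
  · rw [← sub_eq_zero] at c1
    simp only [Prod.fst_add, Prod.fst_sub, Prod.smul_fst, Prod.fst_zero]
    rw [← c1]
    module
  · rw [← sub_eq_zero] at c2
    simp only [Prod.snd_add, Prod.snd_sub, Prod.smul_snd, Prod.snd_zero]
    rw [← c2]
    module

/-- In the expansion in y, the j-th coefficient of zw is x·w_j + i·w_{j-1}, so the w_j vanish
successively. -/
theorem mulZ_injective {w : SuperPoly 2 n × SuperPoly 2 n} (h : mulZ n w = 0) : w = 0 := by
  have h1 := congrArg Prod.fst h
  have h2 := congrArg Prod.snd h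
  simp only [mulZ_apply, cpx_apply, imag_apply, Prod.fst_add, Prod.snd_add, Prod.fst_zero,
    Prod.snd_zero] at h1 h2
  have hc : ∀ (j : ℕ) (f : SuperPoly 2 n),
      coeff j (X (xIdx n) f) = X (lastIdx 0 n) (coeff j f) := fun j f => by
    rw [coeff, D_last_pow_X_emb, res_X, coeff, map_smul]
  have hneg : ∀ (j : ℕ) (f : SuperPoly 2 n), coeff j (-f) = -coeff j f := fun j f => by
    simp only [coeff, map_neg, smul_neg]
  have h0 : ∀ j, coeff j (0 : SuperPoly 2 n) = 0 := fun j => by simp [coeff]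
  have e1 := fun j => congrArg (coeff j) h1
  have e2 := fun j => congrArg (coeff j) h2
  simp only [coeff_add, hc, hneg, h0] at e1 e2
  have key : ∀ j, coeff j w.1 = 0 ∧ coeff j w.2 = 0 := by
    intro j
    have f1 := e1 j
    have f2 := e2 j
    induction j with
    | zero =>
      rw [coeff_X_last_zero] at f1 f2
      rw [neg_zero, add_zero] at f1
      rw [add_zero] at f2
      exact ⟨X_last_injective f1, X_last_injective f2⟩
    | succ j ih =>
      obtain ⟨g1, g2⟩ := ih (e1 j) (e2 j)
      rw [coeff_X_last_succ, g2, neg_zero, add_zero] at f1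
      rw [coeff_X_last_succ, g1, add_zero] at f2
      exact ⟨X_last_injective f1, X_last_injective f2⟩
  exact Prod.ext (eq_zero_of_coeff fun j => (key j).1) (eq_zero_of_coeff fun j => (key j).2)

/-- The homogeneous functions annihilated by `∂_x + i ∂_y` and by the fermionic derivatives are the
multiples of the powers of `z`. -/
theorem exists_eq_mulZ_pow {l : ℕ} (h1 : euler 2 n w.1 = (l : ℝ) • w.1)
    (h2 : euler 2 n w.2 = (l : ℝ) • w.2) (hd : dbar n w = 0)
    (hD : ∀ r : Fin n × Fin 2, cpx (D (Sum.inr r)) w = 0) :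
    ∃ a b : ℝ, w = (mulZ n ^ l) (a • one 2 n, b • one 2 n) := by
  induction l generalizing w with
  | zero =>
    have hz : ∀ r : ℕ, ((0 : ℕ) : ℝ) ≠ r + 1 := fun r h => by
      have : (0 : ℝ) ≤ r := r.cast_nonneg
      simp at h; linarith
    obtain ⟨a, ha⟩ := exists_smul_one h1 hz
    obtain ⟨b, hb⟩ := exists_smul_one h2 hz
    exact ⟨a, b, Prod.ext ha hb⟩
  | succ l ih =>
    have hDx : ∀ f : SuperPoly 2 n, euler 2 n f = ((l + 1 : ℕ) : ℝ) • f →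
        euler 2 n (D (xIdx n) f) = (l : ℝ) • D (xIdx n) f := fun f hf => by
      rw [euler_D_of hf]; push_cast; congr 1; ring
    have hd' := hd
    simp only [dbar_apply, cpx_apply, imag_apply, Prod.ext_iff, Prod.fst_add, Prod.snd_add,
      Prod.fst_zero, Prod.snd_zero] at hd'
    have hy1 : D (yIdx n) w.1 = - D (xIdx n) w.2 := eq_neg_of_add_eq_zero_right hd'.2
    have hy2 : D (yIdx n) w.2 = D (xIdx n) w.1 := (add_neg_eq_zero.mp hd'.1).symm
    obtain ⟨a, b, hab⟩ := ih (cpx (D (xIdx n)) w) (hDx _ h1) (hDx _ h2)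
      (by rw [dbar_cpx w (commute_D_D _ _) (commute_D_D _ _), hd, map_zero])
      (fun r => by
        have hc : Commute (D (Sum.inr r)) (D (xIdx n)) := (commute_D_D _ _).symm
        rw [← Module.End.mul_apply, ← map_mul, hc.eq, map_mul, Module.End.mul_apply, hD, map_zero])
    -- Here ∂_y w = i∂_x w and there are no fermionic terms, so Euler's operator x∂_x + y∂_y becomes
    -- z∂_x.
    have hE : ((l + 1 : ℕ) : ℝ) • w = mulZ n (cpx (D (xIdx n)) w) := by
      have hs : ∀ f : SuperPoly 2 n, (∀ r : Fin n × Fin 2, D (Sum.inr r) f = 0) →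
          euler 2 n f = X (xIdx n) (D (xIdx n) f) + X (yIdx n) (D (yIdx n) f) := by
        intro f hf
        rw [euler_apply, Fintype.sum_sum_type, Fin.sum_univ_two]
        simp only [hf, map_zero, Finset.sum_const_zero, add_zero]
        rfl
      have e1 := hs w.1 fun r => congrArg Prod.fst (hD r)
      have e2 := hs w.2 fun r => congrArg Prod.snd (hD r)
      rw [h1, hy1] at e1
      rw [h2, hy2] at e2
      refine Prod.ext ?_ ?_
      · rw [Prod.smul_fst, e1, map_neg]; rfl
      · rw [Prod.smul_snd, e2]; rfl
    have hl : ((l + 1 : ℕ) : ℝ) ≠ 0 := by positivity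
    refine ⟨((l + 1 : ℕ) : ℝ)⁻¹ * a, ((l + 1 : ℕ) : ℝ)⁻¹ * b, ?_⟩
    rw [← smul_smul, ← smul_smul, ← Prod.smul_mk, map_smul, pow_succ', Module.End.mul_apply, ← hab,
      ← hE, inv_smul_smul₀ hl]

end plane

theorem imag_mulZ_pow (l : ℕ) (w : SuperPoly 2 n × SuperPoly 2 n) :
    (mulZ n ^ l) (imag w) = imag ((mulZ n ^ l) w) := by
  have h : Commute (mulZ n) imag := LinearMap.ext fun w => by
    rw [Module.End.mul_apply, Module.End.mul_apply, mulZ_apply, mulZ_apply, map_add, cpx_imag,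
      cpx_imag]
  exact LinearMap.congr_fun (h.pow_left l).eq w

theorem mulZ_pow_injective {l : ℕ} {w : SuperPoly 2 n × SuperPoly 2 n} (h : (mulZ n ^ l) w = 0) :
    w = 0 := by
  induction l with
  | zero => exact h
  | succ l ih =>
    rw [pow_succ', Module.End.mul_apply] at h
    exact ih (mulZ_injective h)

/-- Every nonzero submodule of `ℋ_ℓ(ℝ^{2|2n})` contains the real and imaginary parts of `z^ℓ` if
`ℓ > 2n`. -/
theorem mulZ_pow_mem {l : ℕ} (hl : 2 * n < l) {U : Submodule ℝ (SuperPoly 2 n)}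
    (hU : IsActStable U) (hH : U ≤ Harm 2 n l) (h0 : U ≠ ⊥) :
    (mulZ n ^ l) (one 2 n, 0) ∈ U.prod U := by
  have hc : 0 < (l : ℝ) - 2 * n := by
    have : ((2 * n : ℕ) : ℝ) < l := by exact_mod_cast hl
    push_cast at this; linarith
  have hi : ∀ w ∈ U.prod U, imag w ∈ U.prod U := fun w hw =>
    ⟨U.neg_mem hw.2, hw.1⟩
  have hcpx : ∀ (a b : Idx 2 n), ∀ w ∈ U.prod U, cpx (rot a b) w ∈ U.prod U := fun a b w hw =>
    ⟨hU.rot_mem a b hw.1, hU.rot_mem a b hw.2⟩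
  have hraise : ∀ (r : Fin n × Fin 2), ∀ w ∈ U.prod U, raise r w ∈ U.prod U := fun r w hw =>
    (U.prod U).add_mem (hcpx _ _ w hw) (hi _ (hcpx _ _ w hw))
  -- a vector annihilated by the raising operators on which `ℓ - 2n - i L` does not vanish
  obtain ⟨w, hwU, hwR, hw⟩ : ∃ w ∈ U.prod U, (∀ r, raise r w = 0) ∧
      ((l : ℝ) - 2 * n) • w - imag (cpx (planeRot n) w) ≠ 0 := by
    obtain ⟨u, hu, hu0⟩ := Submodule.exists_mem_ne_zero_of_ne_bot h0
    obtain ⟨w, hw0, hwU, hwR⟩ := exists_forall_apply_eq_zero (raise (n := n))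
      (fun r s w => raise_raise w r s) (· ∈ U.prod U) hraise (w := (u, 0))
      (by simpa [Prod.ext_iff] using hu0) ⟨hu, U.zero_mem⟩ Finset.univ
    by_cases h : ((l : ℝ) - 2 * n) • w - imag (cpx (planeRot n) w) = 0
    -- In the bad case iLw = (ℓ-2n)w, pass to the complex conjugate, where -iL has the positive
    -- eigenvalue ℓ - 2n. Raising only increases it, to some t > 0 at the resulting null vector,
    -- where ℓ - 2n - iL acts by ℓ - 2n + t ≠ 0.
    · have hconj : ((l : ℝ) - 2 * n) • (w.1, -w.2) = -imag (cpx (planeRot n) (w.1, -w.2)) := by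
        rw [sub_eq_zero] at h
        have e1 := congrArg Prod.fst h
        have e2 := congrArg Prod.snd h
        simp only [imag_apply, cpx_apply, Prod.smul_fst, Prod.smul_snd] at e1 e2
        refine Prod.ext ?_ ?_
        · simp [imag_apply, cpx_apply, e1]
        · simp [imag_apply, cpx_apply, e2]
      obtain ⟨w', hw0', ⟨hwU', t, ht, hwt⟩, hwR'⟩ := exists_forall_apply_eq_zero (raise (n := n))
        (fun r s w => raise_raise w r s)
        (fun w => w ∈ U.prod U ∧ ∃ t : ℝ, 0 < t ∧ t • w = -imag (cpx (planeRot n) w))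
        (fun r w hw => ⟨hraise r w hw.1, by
          obtain ⟨t, ht, h⟩ := hw.2
          refine ⟨t + 1, by linarith, ?_⟩
          have h2 : raise r (imag (cpx (planeRot n) w)) = imag (raise r (cpx (planeRot n) w)) := by
            rw [raise_apply', raise_apply', map_add, cpx_imag, cpx_imag]
          rw [planeRot_raise, map_add, imag_imag, add_smul, one_smul, ← map_smul, h, map_neg, h2]
          abel⟩)
        (w := (w.1, -w.2)) (fun h => hw0 (by
          have e1 := congrArg Prod.fst h
          have e2 := congrArg Prod.snd h
          exact Prod.ext e1 (neg_eq_zero.mp e2)))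
        ⟨⟨hwU.1, U.neg_mem hwU.2⟩, _, hc, hconj⟩ Finset.univ
      refine ⟨w', hwU', fun r => hwR' r (Finset.mem_univ r), ?_⟩
      rw [sub_eq_add_neg, ← hwt, ← add_smul]
      exact smul_ne_zero (by linarith) hw0'
    · exact ⟨w, hwU, fun r => hwR r (Finset.mem_univ r), h⟩
  set g := ((l : ℝ) - 2 * n) • w - imag (cpx (planeRot n) w) with hg
  have hgU : g ∈ U.prod U := (U.prod U).sub_mem ((U.prod U).smul_mem _ hwU) (hi _ (hcpx _ _ w hwU))
  have hgd : dbar n g = 0 := dbar_of_raise w (hH hwU.1) (hH hwU.2) hwR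
  have hgR : ∀ r, raise r g = 0 := fun r => by
    have h2 : ∀ w : SuperPoly 2 n × SuperPoly 2 n, raise r (imag w) = imag (raise r w) := fun w => by
      rw [raise_apply', raise_apply', map_add, cpx_imag, cpx_imag]
    have h3 := planeRot_raise w r
    rw [hwR, map_zero, map_zero, add_zero] at h3
    rw [hg, map_sub, map_smul, hwR, smul_zero, h2, ← h3, map_zero, sub_zero]
  -- As ∂_x + i∂_y kills g, the raising operators reduce to z∂^r, and z is injective; so g does not
  -- involve the fermionic variables.
  have hgDd : ∀ r, cpx (Dd (Sum.inr r)) g = 0 := fun r => by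
    have := hgR r
    rw [raise_apply, hgd, map_zero, sub_zero] at this
    exact mulZ_injective this
  have hgD : ∀ r, cpx (D (Sum.inr r)) g = 0 := fun r => by
    have h1 : ∀ a : Idx 2 n, gUp 2 n (Sum.inr r) a • cpx (Dd a) g = 0 := by
      rintro (a | a)
      · simp [gUp]
      · rw [hgDd, smul_zero]
    rw [← sum_gUp_smul_Dd, cpx_apply]
    have h2 := fun a => congrArg Prod.fst (h1 a)
    have h3 := fun a => congrArg Prod.snd (h1 a)
    simp only [cpx_apply, Prod.smul_fst, Prod.smul_snd, Prod.fst_zero, Prod.snd_zero] at h2 h3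
    simp only [LinearMap.sum_apply, LinearMap.smul_apply, h2, h3, Finset.sum_const_zero]
    rfl
  obtain ⟨a, b, hab⟩ := exists_eq_mulZ_pow g (mem_Harm.mp (hH hgU.1)).1 (mem_Harm.mp (hH hgU.2)).1
    hgd hgD
  have hab0 : a ^ 2 + b ^ 2 ≠ 0 := by
    intro h
    have ha : a = 0 := by nlinarith [sq_nonneg a, sq_nonneg b]
    have hb : b = 0 := by nlinarith [sq_nonneg a, sq_nonneg b]
    rw [ha, hb, zero_smul, Prod.mk_zero_zero, map_zero] at hab
    exact hw hab
  -- g = (a + ib)z^ℓ, divided by the complex number a + ib.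
  have hfin : (mulZ n ^ l) (one 2 n, 0) = (a ^ 2 + b ^ 2)⁻¹ • (a • g - b • imag g) := by
    rw [hab, ← imag_mulZ_pow, ← map_smul, ← map_smul, ← map_sub, ← map_smul]
    congr 1
    refine Prod.ext ?_ ?_
    · simp only [imag_apply, Prod.smul_fst, Prod.fst_sub]
      rw [eq_inv_smul_iff₀ hab0]
      module
    · simp only [imag_apply, Prod.smul_snd, Prod.snd_sub]
      rw [eq_inv_smul_iff₀ hab0]
      module
  rw [hfin]
  exact Submodule.smul_mem _ _ (Submodule.sub_mem _ (Submodule.smul_mem _ _ hgU)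
    (Submodule.smul_mem _ _ (hi g hgU)))

theorem eq_bot_or_eq_bot_of_plane {l : ℕ} (hl : 2 * n < l) {U₁ U₂ : Submodule ℝ (SuperPoly 2 n)}
    (h₁ : IsActStable U₁) (h₂ : IsActStable U₂) (hH₁ : U₁ ≤ Harm 2 n l) (hH₂ : U₂ ≤ Harm 2 n l)
    (hd : U₁ ⊓ U₂ = ⊥) : U₁ = ⊥ ∨ U₂ = ⊥ := by
  by_contra! h
  have m₁ := mulZ_pow_mem hl h₁ hH₁ h.1
  have m₂ := mulZ_pow_mem hl h₂ hH₂ h.2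
  have e : ∀ f, f ∈ U₁ → f ∈ U₂ → f = 0 := fun f hf₁ hf₂ => by
    have : f ∈ U₁ ⊓ U₂ := ⟨hf₁, hf₂⟩
    rwa [hd, Submodule.mem_bot] at this
  have := mulZ_pow_injective (w := (one 2 n, 0)) (l := l)
    (Prod.ext (e _ m₁.1 m₂.1) (e _ m₁.2 m₂.2))
  exact one_ne_zero' (congrArg Prod.fst this)

/-! ### The purely fermionic case: ℋ_ℓ(ℝ^{0|2n}) -/

section fermionic

variable (r s : Fin n × Fin 2) (f : SuperPoly m n)

theorem X_inr_X_inr : X (Sum.inr r) (X (Sum.inr s) f) = -X (Sum.inr s) (X (Sum.inr r) f) := by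
  rw [X_X_apply]; simp [sg, par]

theorem D_inr_D_inr : D (Sum.inr r) (D (Sum.inr s) f) = -D (Sum.inr s) (D (Sum.inr r) f) := by
  rw [D_D_apply]; simp [sg, par]

theorem D_inr_X_inr_of_ne {r s : Fin n × Fin 2} (h : r ≠ s) :
    D (Sum.inr r) (X (Sum.inr s) f) = -X (Sum.inr s) (D (Sum.inr r) f) := by
  rw [D_X_apply, if_neg (by simpa using h)]; simp [sg, par]

theorem D_inr_X_inr_self :
    D (Sum.inr r) (X (Sum.inr r) f) = f - X (Sum.inr r) (D (Sum.inr r) f) := by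
  rw [D_X_apply, if_pos rfl]; simp [sg, par, sub_eq_neg_add]

theorem X_inr_self : X (Sum.inr r) (X (Sum.inr r) f) = 0 := by
  have := X_inr_X_inr r r f
  rw [eq_neg_iff_add_eq_zero, ← two_smul ℝ] at this
  exact (smul_eq_zero.mp this).resolve_left two_ne_zero

theorem D_inr_self : D (Sum.inr r) (D (Sum.inr r) f) = 0 := by
  have := D_inr_D_inr r r f
  rw [eq_neg_iff_add_eq_zero, ← two_smul ℝ] at this
  exact (smul_eq_zero.mp this).resolve_left two_ne_zero

end fermionic

theorem euler_zero_apply (f : SuperPoly 0 n) :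
    euler 0 n f = ∑ t : Fin n × Fin 2, X (Sum.inr t) (D (Sum.inr t) f) := by
  rw [euler_apply, Fintype.sum_sum_type]
  simp

/-- Each ∂_t f with t ∈ S has one degree less and depends on one variable less, so by induction all
derivatives vanish, and then f does by Euler's formula. -/
theorem eq_zero_of_card_lt {a : ℕ} {S : Finset (Fin n × Fin 2)} (hS : S.card < a)
    {f : SuperPoly 0 n} (hf : euler 0 n f = (a : ℝ) • f) (hD : ∀ t ∉ S, D (Sum.inr t) f = 0) :
    f = 0 := by
  induction a generalizing S f with
  | zero => omega
  | succ a ih =>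
    have h0 : ∀ t, D (Sum.inr t) f = 0 := by
      intro t
      by_cases ht : t ∈ S
      · refine ih (S := S.erase t) ?_ ?_ fun s hs => ?_
        · rw [Finset.card_erase_of_mem ht]
          have := Finset.card_pos.mpr ⟨t, ht⟩
          omega
        · rw [euler_D_of hf]; push_cast; congr 1; ring
        · by_cases hst : s = t
          · rw [hst, D_inr_self]
          · rw [D_inr_D_inr, hD s fun h => hs (Finset.mem_erase.mpr ⟨hst, h⟩), map_zero, neg_zero]
      · exact hD t ht
    rw [euler_zero_apply] at hf
    simp only [h0, map_zero, Finset.sum_const_zero] at hf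
    exact (smul_eq_zero.mp hf.symm).resolve_left (by positivity)

theorem eq_zero_of_two_mul_lt {a : ℕ} (ha : 2 * n < a) {f : SuperPoly 0 n}
    (hf : euler 0 n f = (a : ℝ) • f) : f = 0 :=
  eq_zero_of_card_lt (S := Finset.univ) (by simpa [mul_comm] using ha) hf fun t ht =>
    absurd (Finset.mem_univ t) ht

/-- The monomials in the fermionic variables. -/
theorem exists_monomial (S : Finset (Fin n × Fin 2)) : ∃ v : SuperPoly 0 n, v ≠ 0 ∧
    euler 0 n v = (S.card : ℝ) • v ∧ (∀ t ∉ S, D (Sum.inr t) v = 0) ∧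
    ∀ f : SuperPoly 0 n, euler 0 n f = (S.card : ℝ) • f → (∀ t ∈ S, X (Sum.inr t) f = 0) →
      ∃ c : ℝ, f = c • v := by
  induction S using Finset.induction_on with
  | empty =>
    refine ⟨one 0 n, one_ne_zero', by simp [euler_one], fun t _ => D_one _, fun f hf _ => ?_⟩
    exact exists_smul_one hf fun r h => by
      have : (0 : ℝ) ≤ r := r.cast_nonneg
      simp at h; linarith
  | insert t S ht ih =>
    obtain ⟨v, hv0, hv, hD, hX⟩ := ih
    have hDX : D (Sum.inr t) (X (Sum.inr t) v) = v := by
      rw [D_inr_X_inr_self, hD t ht, map_zero, sub_zero]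
    refine ⟨X (Sum.inr t) v, fun h => hv0 (by rw [← hDX, h, map_zero]), ?_, fun s hs => ?_,
      fun f hf hfX => ?_⟩
    · rw [euler_X_of hv, Finset.card_insert_of_notMem ht]; push_cast; rfl
    · rw [Finset.mem_insert, not_or] at hs
      rw [D_inr_X_inr_of_ne _ hs.1, hD s hs.2, map_zero, neg_zero]
    · obtain ⟨c, hc⟩ := hX (D (Sum.inr t) f) (by
        rw [euler_D_of hf, Finset.card_insert_of_notMem ht]; push_cast; congr 1; ring) fun s hs => by
          have hne : t ≠ s := fun h => ht (h ▸ hs)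
          rw [← neg_eq_zero, ← D_inr_X_inr_of_ne _ hne, hfX s (Finset.mem_insert_of_mem hs), map_zero]
      refine ⟨c, ?_⟩
      have := D_inr_X_inr_self t f
      rw [hfX t (Finset.mem_insert_self t S), map_zero, hc, map_smul] at this
      exact (sub_eq_zero.mp this.symm)

/-- Here C acts on f, hence on every R^{2j}f, by the value of degree ℓ. For large j the power
vanishes, its degree exceeding 2n. Descending, ΔR² acts on R^{2j}f by the difference of the values
of degrees ℓ+2j+2 and ℓ, nonzero because their sum 2ℓ+2j+2 exceeds 2-M = 2n+2. -/
theorem eq_zero_of_Rsq_lap_eq_zero {l : ℕ} (hl : n < l) {f : SuperPoly 0 n}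
    (hf : euler 0 n f = (l : ℝ) • f) (h : Rsq 0 n (lap 0 n f) = 0) : f = 0 := by
  have hc : casimir 0 n f = cas 0 n l • f := by
    have := Rsq_lap_of hf
    rw [h] at this
    exact (sub_eq_zero.mp this.symm).symm
  have hE : ∀ j, euler 0 n ((Rsq 0 n ^ j) f) = ((l + 2 * j : ℕ) : ℝ) • (Rsq 0 n ^ j) f := fun j => by
    rw [euler_Rsq_pow_of hf]; push_cast; rfl
  have key : ∀ i j, n < i + j → (Rsq 0 n ^ j) f = 0 := by
    intro i
    induction i with
    | zero => intro j hj; exact eq_zero_of_two_mul_lt (by omega) (hE j)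
    | succ i ih =>
      intro j hj
      have h1 := lap_Rsq_of (hE j)
      have h2 : casimir 0 n ((Rsq 0 n ^ j) f) = cas 0 n l • (Rsq 0 n ^ j) f := by
        rw [← Module.End.mul_apply, ((casimir_comm_Rsq 0 n).pow_right j).eq, Module.End.mul_apply,
          hc, map_smul]
      rw [← Module.End.mul_apply (Rsq 0 n), ← pow_succ', ih (j + 1) (by omega), map_zero, h2,
        ← sub_smul] at h1
      refine (smul_eq_zero.mp h1.symm).resolve_left (sub_ne_zero.mpr fun h3 => ?_)
      have := (cas_eq_iff _ _).mp h3
      simp only [superdim] at this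
      omega
  exact key (n + 1) 0 (by omega)

theorem Harm_zero_eq_bot {l : ℕ} (hl : n < l) : Harm 0 n l = ⊥ := by
  rw [eq_bot_iff]
  intro f hf
  obtain ⟨h1, h2⟩ := mem_Harm.mp hf
  exact eq_zero_of_Rsq_lap_eq_zero hl h1 (by rw [h2, map_zero])

/-- An exceptional ℓ exceeds n, so ℋ_ℓ = 0. For f in ℋ̃_ℓ the element R²Δf lies in ℋ_ℓ and vanishes,
which forces f = 0. -/
theorem GenHarm_zero_eq_bot {k l : ℕ} (hl : l ∈ tildeB (superdim (0 + 1) n) k) :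
    GenHarm 0 n l = ⊥ := by
  obtain ⟨-, q, hq, -, h⟩ := mem_tildeB_iff.mp hl
  have hnl : n < l := by simp only [superdim] at h; omega
  rw [eq_bot_iff]
  intro f hf
  obtain ⟨h1, h2⟩ := mem_GenHarm.mp hf
  refine eq_zero_of_Rsq_lap_eq_zero hnl h1 ?_
  have h3 : Rsq 0 n (lap 0 n f) ∈ Harm 0 n l :=
    mem_Harm.mpr ⟨euler_comm_of (euler_comm_Rsq_lap 0 n) h1, h2⟩
  rwa [Harm_zero_eq_bot hnl] at h3

theorem Dd_inr_zero (j : Fin n) :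
    (Dd (Sum.inr (j, 0)) : Module.End ℝ (SuperPoly m n)) = (2 : ℝ) • D (Sum.inr (j, 1)) := by
  rw [Dd, Finset.sum_eq_single (Sum.inr (j, 1))]
  · simp [gLow]
  · rintro (b | ⟨b, t⟩) _ hb
    · simp [gLow]
    · fin_cases t
      · simp [gLow]
      · have : j ≠ b := fun h => hb (by simp [h])
        simp [gLow, this]
  · simp

theorem Dd_inr_one (j : Fin n) :
    (Dd (Sum.inr (j, 1)) : Module.End ℝ (SuperPoly m n)) = (-2 : ℝ) • D (Sum.inr (j, 0)) := by
  rw [Dd, Finset.sum_eq_single (Sum.inr (j, 0))]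
  · simp [gLow]
  · rintro (b | ⟨b, t⟩) _ hb
    · simp [gLow]
    · fin_cases t
      · have : j ≠ b := fun h => hb (by simp [h])
        simp [gLow, this]
      · simp [gLow]
  · simp

theorem rot_inr_inr (r s : Fin n × Fin 2) (f : SuperPoly m n) : rot (Sum.inr r) (Sum.inr s) f
    = X (Sum.inr r) (Dd (Sum.inr s) f) + X (Sum.inr s) (Dd (Sum.inr r) f) := by
  simp [rot, sg, par]

/-- The superpolynomials annihilated by `θ_{2j+1}` and `∂_{θ_{2j+2}}` for all `j < p`. -/
def IsExtremal (p : ℕ) (f : SuperPoly m n) : Prop :=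
  ∀ j : Fin n, (j : ℕ) < p → X (Sum.inr (j, 0)) f = 0 ∧ D (Sum.inr (j, 1)) f = 0

theorem sum_ite_lt {V : Type*} [AddCommGroup V] [Module ℝ V] {p : ℕ} (hp : p ≤ n) (v : V) :
    ∑ i : Fin n, (if (i : ℕ) < p then v else 0) = (p : ℝ) • v := by
  rw [Fin.sum_univ_eq_sum_range (fun i => if i < p then v else 0) n, ← Finset.sum_filter,
    Finset.sum_const, Nat.cast_smul_eq_nsmul]
  congr 1
  rw [show Finset.filter (· < p) (Finset.range n) = Finset.range p by ext; simp; omega,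
    Finset.card_range]

/-- An `𝔬𝔰𝔭(0|2n)`-submodule of `ℋ_ℓ(ℝ^{0|2n})` without extremal vectors for `p + 1` has none
for `p`. -/
theorem eq_zero_of_isExtremal {l p : ℕ} (hl : l ≤ n) (hp : p < l) {U : Submodule ℝ (SuperPoly 0 n)}
    (hU : IsActStable U) (hH : U ≤ Harm 0 n l) (h : ∀ f ∈ U, IsExtremal (p + 1) f → f = 0)
    {f : SuperPoly 0 n} (hf : f ∈ U) (he : IsExtremal p f) : f = 0 := by
  obtain ⟨hE, hL⟩ := mem_Harm.mp (hH hf)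
  set i : Fin n := ⟨p, by omega⟩ with hi
  have hext : ∀ g : SuperPoly 0 n, (∀ j : Fin n, (j : ℕ) < p → X (Sum.inr (j, 0)) g = 0 ∧ D (Sum.inr (j, 1)) g = 0) →
      X (Sum.inr (i, 0)) g = 0 → D (Sum.inr (i, 1)) g = 0 → IsExtremal (p + 1) g := by
    intro g h1 h2 h3 j hj
    rcases Nat.lt_succ_iff_lt_or_eq.mp hj with hj | hj
    · exact h1 j hj
    · obtain rfl : j = i := Fin.ext hj
      exact ⟨h2, h3⟩
  -- `X_r D_s` preserves the extremal vectors
  have hXD : ∀ (r s : Fin n × Fin 2), p ≤ r.1 → p ≤ s.1 → ∀ j : Fin n, (j : ℕ) < p →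
      X (Sum.inr (j, 0)) (X (Sum.inr r) (D (Sum.inr s) f)) = 0 ∧
      D (Sum.inr (j, 1)) (X (Sum.inr r) (D (Sum.inr s) f)) = 0 := by
    intro r s hr hs j hj
    have h1 : s ≠ (j, 0) := fun h => by rw [h] at hs; simp at hs; omega
    have h2 : (j, 1) ≠ r := fun h => by rw [← h] at hr; simp at hr; omega
    have h3 := D_inr_X_inr_of_ne f h1
    rw [(he j hj).1, map_zero, eq_comm, neg_eq_zero] at h3
    rw [X_inr_X_inr, h3, D_inr_X_inr_of_ne _ h2, D_inr_D_inr, (he j hj).2]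
    simp
  -- the long root vector
  have e1 : X (Sum.inr (i, 0)) (D (Sum.inr (i, 1)) f) = 0 := by
    refine h _ ?_ (hext _ (hXD _ _ le_rfl le_rfl) (X_inr_self _ _) ?_)
    · have := hU.rot_mem (Sum.inr (i, 0)) (Sum.inr (i, 0)) hf
      rw [rot_inr_inr, Dd_inr_zero, LinearMap.smul_apply, map_smul, ← add_smul] at this
      exact (U.smul_mem_iff (by norm_num)).mp this
    · rw [D_inr_X_inr_of_ne _ (by simp), D_inr_self, map_zero, neg_zero]
  have e2 : D (Sum.inr (i, 0)) (X (Sum.inr (i, 0)) (D (Sum.inr (i, 1)) f)) = 0 := by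
    rw [e1, map_zero]
  rw [D_inr_X_inr_self, sub_eq_zero] at e2
  -- the coroot
  have e3 : X (Sum.inr (i, 0)) (D (Sum.inr (i, 0)) f) = X (Sum.inr (i, 1)) (D (Sum.inr (i, 1)) f) := by
    rw [← sub_eq_zero]
    refine h _ ?_ (hext _ (fun j hj => ?_) ?_ ?_)
    · have := hU.rot_mem (Sum.inr (i, 0)) (Sum.inr (i, 1)) hf
      rw [rot_inr_inr, Dd_inr_zero, Dd_inr_one, LinearMap.smul_apply, LinearMap.smul_apply, map_smul,
        map_smul, neg_smul, ← sub_eq_neg_add, ← smul_sub] at this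
      have h2 := U.neg_mem ((U.smul_mem_iff (by norm_num)).mp this)
      rwa [neg_sub] at h2
    · have h1 := hXD (i, 0) (i, 0) le_rfl le_rfl j hj
      have h2 := hXD (i, 1) (i, 1) le_rfl le_rfl j hj
      rw [map_sub, map_sub, h1.1, h1.2, h2.1, h2.2, sub_zero]
      exact ⟨rfl, rfl⟩
    · rw [map_sub, X_inr_self, X_inr_X_inr, e1, map_zero, neg_zero, sub_zero]
    · rw [map_sub, D_inr_X_inr_of_ne _ (by simp), D_inr_D_inr, map_neg, neg_neg, ← e2,
        D_inr_X_inr_self, D_inr_self, map_zero, sub_zero, sub_self]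
  -- the short root vectors
  have e4 : ∀ r : Fin n × Fin 2, p < r.1 → rot (Sum.inr (i, 0)) (Sum.inr r) f = 0 := by
    rintro r hr
    obtain ⟨c, s, hs, hc⟩ : ∃ (c : ℝ) (s : Fin n × Fin 2), p < s.1 ∧
        ∀ g : SuperPoly 0 n, Dd (Sum.inr r) g = c • D (Sum.inr s) g := by
      obtain ⟨j, t⟩ := r
      fin_cases t
      · exact ⟨2, (j, 1), hr, fun g => by
          rw [show ((⟨0, by omega⟩ : Fin 2)) = 0 from rfl, Dd_inr_zero]; rfl⟩
      · exact ⟨-2, (j, 0), hr, fun g => by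
          rw [show ((⟨1, by omega⟩ : Fin 2)) = 1 from rfl, Dd_inr_one]; rfl⟩
    have hs' : s ≠ (i, 0) := fun h => by rw [h] at hs; simp [hi] at hs
    have hr' : (i, 1) ≠ r := fun h => by rw [← h] at hr; simp [hi] at hr
    have hrot : rot (Sum.inr (i, 0)) (Sum.inr r) f = c • X (Sum.inr (i, 0)) (D (Sum.inr s) f)
        + (2 : ℝ) • X (Sum.inr r) (D (Sum.inr (i, 1)) f) := by
      rw [rot_inr_inr, hc, Dd_inr_zero, LinearMap.smul_apply, map_smul, map_smul]
    refine h _ (hU.rot_mem _ _ hf) ?_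
    rw [hrot]
    refine hext _ (fun j hj => ?_) ?_ ?_
    · have h1 := hXD (i, 0) s le_rfl hs.le j hj
      have h2 := hXD r (i, 1) hr.le le_rfl j hj
      simp only [map_add, map_smul, h1.1, h1.2, h2.1, h2.2, smul_zero, add_zero]
      exact ⟨trivial, trivial⟩
    · rw [map_add, map_smul, map_smul, X_inr_self, X_inr_X_inr, e1]
      simp
    · have h5 := congrArg (D (Sum.inr s)) e1
      rw [map_zero, D_inr_X_inr_of_ne _ hs', neg_eq_zero] at h5
      rw [map_add, map_smul, map_smul, D_inr_X_inr_of_ne _ (by simp), D_inr_D_inr, map_neg, h5,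
        D_inr_X_inr_of_ne _ hr', D_inr_self]
      simp
  -- contraction
  have e5 : D (Sum.inr (i, 1)) f = 0 := by
    set g := Dd (Sum.inr (i, 0)) f with hg
    have hg' : g = (2 : ℝ) • D (Sum.inr (i, 1)) f := by rw [hg, Dd_inr_zero]; rfl
    -- The j-th pair contributes g if j < p, by extremality; for j = p the two terms vanish or
    -- cancel by `e1` and `e3`, and for j > p they vanish by `e4`.
    have hF : ∀ j : Fin n, D (Sum.inr (j, 0)) (rot (Sum.inr (i, 0)) (Sum.inr (j, 0)) f)
        + D (Sum.inr (j, 1)) (rot (Sum.inr (i, 0)) (Sum.inr (j, 1)) f)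
        = if (j : ℕ) < p then g else 0 := by
      intro j
      rcases lt_trichotomy (j : ℕ) p with hj | hj | hj
      · have hij' : (i, (1 : Fin 2)) ≠ (j, 0) := by simp
        have hji : (j, (1 : Fin 2)) ≠ (i, 0) := by simp
        have f1 : X (Sum.inr (j, 0)) (D (Sum.inr (i, 1)) f) = 0 := by
          rw [← neg_eq_zero, ← D_inr_X_inr_of_ne _ hij', (he j hj).1, map_zero]
        have f2 : rot (Sum.inr (i, 0)) (Sum.inr (j, 0)) f = 0 := by
          rw [rot_inr_inr, ← hg, hg', Dd_inr_zero, LinearMap.smul_apply, (he j hj).2, map_smul, map_smul, f1]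
          simp
        rw [if_pos hj, f2, map_zero, zero_add, rot_inr_inr, ← hg, hg', Dd_inr_one,
          LinearMap.smul_apply, map_smul, map_smul, map_add, map_smul, map_smul,
          D_inr_X_inr_of_ne _ hji, D_inr_D_inr, (he j hj).2, D_inr_X_inr_self, D_inr_D_inr,
          (he j hj).2]
        simp
      · obtain rfl : j = i := Fin.ext hj
        rw [if_neg (by omega), rot_inr_inr, rot_inr_inr, Dd_inr_zero, Dd_inr_one]
        simp only [LinearMap.smul_apply, map_smul, e1, e3]
        rw [smul_zero, add_zero, map_zero, zero_add, ← add_smul]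
        simp
      · rw [if_neg (by omega), e4 _ hj, e4 _ hj, map_zero, map_zero, add_zero]
    have hsum := LinearMap.congr_fun (sum_D_mul_rot (m := 0) (Sum.inr (i, (0 : Fin 2)))) f
    have hsg : ∀ t : Fin n × Fin 2, sgn (Sum.inr t : Idx 0 n)
        * sg (Sum.inr (i, 0) : Idx 0 n) (Sum.inr t) = 1 := fun t => by simp [sgn, sg, par]
    have hM : ((superdim 0 n : ℤ) : ℝ) = - (2 * n) := by simp [superdim]
    rw [LinearMap.sum_apply, Fintype.sum_sum_type, Fintype.sum_prod_type] at hsum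
    simp only [hsg, one_smul, Module.End.mul_apply, LinearMap.sub_apply, LinearMap.add_apply,
      LinearMap.smul_apply, Module.End.one_apply, hL, map_zero, ← hg, Finset.univ_eq_empty,
      Finset.sum_empty, zero_add, Fin.sum_univ_two, hM] at hsum
    simp only [hF, sum_ite_lt (by omega : p ≤ n)] at hsum
    rw [euler_Dd_of hE] at hsum
    -- On harmonics the right side of the contraction is (1 - (ℓ - 1) + 2n)g, and the left side is
    -- p·g.
    have h6 : ((2 * n : ℝ) + 2 - l - p) • g = 0 := by
      have := sub_eq_zero.mpr hsum
      rw [← neg_eq_zero, ← this]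
      module
    have h7 : (0 : ℝ) < (2 * n : ℝ) + 2 - l - p := by
      have h8 : (l : ℝ) ≤ n := by exact_mod_cast hl
      have h9 : (p : ℝ) ≤ n := by exact_mod_cast (by omega : p ≤ n)
      linarith
    have h8 := (smul_eq_zero.mp h6).resolve_left h7.ne'
    rw [hg'] at h8
    exact (smul_eq_zero.mp h8).resolve_left two_ne_zero
  have e6 : D (Sum.inr (i, 0)) f = 0 := by
    rw [e5, map_zero] at e3
    have := D_inr_X_inr_self (i, 0) (D (Sum.inr (i, 0)) f)
    rw [e3, map_zero, D_inr_self, map_zero, sub_zero] at this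
    exact this.symm
  have e7 : ∀ r s : Fin n × Fin 2, p < r.1 → p < s.1 → ∀ c : ℝ, c ≠ 0 →
      (Dd (Sum.inr r) : Module.End ℝ (SuperPoly 0 n)) = c • D (Sum.inr s) → D (Sum.inr s) f = 0 := by
    intro r s hr hs c hc hrs
    have h1 := e4 r hr
    rw [rot_inr_inr, Dd_inr_zero, LinearMap.smul_apply, e5, smul_zero, map_zero, add_zero, hrs,
      LinearMap.smul_apply, map_smul] at h1
    have h2 := D_inr_X_inr_self (i, 0) (D (Sum.inr s) f)
    rw [(smul_eq_zero.mp h1).resolve_left hc, map_zero, D_inr_D_inr, e6, map_zero, neg_zero, map_zero,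
      sub_zero] at h2
    exact h2.symm
  -- Each pair j < p contributes one copy of f to 𝔼f and the others nothing, so f has degree p,
  -- which differs from ℓ.
  have e8 : euler 0 n f = (p : ℝ) • f := by
    rw [euler_zero_apply, Fintype.sum_prod_type, ← sum_ite_lt (by omega : p ≤ n)]
    refine Finset.sum_congr rfl fun j _ => ?_
    rw [Fin.sum_univ_two]
    rcases lt_trichotomy (j : ℕ) p with hj | hj | hj
    · have h1 := D_inr_X_inr_self (j, 0) f
      rw [(he j hj).1, map_zero, eq_comm, sub_eq_zero] at h1
      rw [if_pos hj, (he j hj).2, map_zero, add_zero, ← h1]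
    · obtain rfl : j = i := Fin.ext hj
      rw [if_neg (by omega), e5, e6, map_zero, map_zero, add_zero]
    · rw [if_neg (by omega), e7 (j, 0) (j, 1) hj hj 2 (by norm_num) (Dd_inr_zero j),
        e7 (j, 1) (j, 0) hj hj (-2) (by norm_num) (Dd_inr_one j), map_zero, map_zero, add_zero]
  rw [hE, ← sub_eq_zero, ← sub_smul] at e8
  exact (smul_eq_zero.mp e8).resolve_left (sub_ne_zero.mpr (Nat.cast_injective.ne hp.ne'))

/-- Every nonzero submodule of `ℋ_ℓ(ℝ^{0|2n})` contains an extremal vector. -/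
theorem exists_isExtremal {l : ℕ} (hl : l ≤ n) {U : Submodule ℝ (SuperPoly 0 n)}
    (hU : IsActStable U) (hH : U ≤ Harm 0 n l) (h0 : U ≠ ⊥) : ∃ f ∈ U, IsExtremal l f ∧ f ≠ 0 := by
  by_contra! h
  have key : ∀ i p, i + p = l → ∀ f ∈ U, IsExtremal p f → f = 0 := by
    intro i
    induction i with
    | zero => intro p hp; rw [show p = l by omega]; exact h
    | succ i ih => intro p hp f hf he; exact eq_zero_of_isExtremal hl (by omega) hU hH (ih (p + 1) (by omega)) hf he
  refine h0 (eq_bot_iff.mpr fun f hf => key l 0 rfl f hf fun j hj => ?_)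
  omega

/-- The first `ℓ` of the variables `θ₁, θ₃, …`. -/
def oddPrefix (n l : ℕ) : Finset (Fin n × Fin 2) :=
  (Finset.univ.filter fun j : Fin n => (j : ℕ) < l) ×ˢ {0}

theorem card_oddPrefix {l : ℕ} (hl : l ≤ n) : (oddPrefix n l).card = l := by
  rw [oddPrefix, Finset.card_product, Finset.card_singleton, mul_one]
  have := sum_ite_lt hl (1 : ℝ)
  rw [← Finset.sum_filter, Finset.sum_const, nsmul_eq_mul, mul_one, smul_eq_mul, mul_one] at this
  exact_mod_cast this

/-- A vector of degree ℓ that is extremal for ℓ is a multiple of θ₁θ₃⋯θ_{2ℓ-1}, so any two nonzero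
submodules share this line. -/
theorem eq_bot_or_eq_bot_of_fermionic {l : ℕ} (hl : l ≤ n) {U₁ U₂ : Submodule ℝ (SuperPoly 0 n)}
    (h₁ : IsActStable U₁) (h₂ : IsActStable U₂) (hH₁ : U₁ ≤ Harm 0 n l) (hH₂ : U₂ ≤ Harm 0 n l)
    (hd : U₁ ⊓ U₂ = ⊥) : U₁ = ⊥ ∨ U₂ = ⊥ := by
  by_contra! h
  obtain ⟨f₁, hf₁, he₁, h0₁⟩ := exists_isExtremal hl h₁ hH₁ h.1
  obtain ⟨f₂, hf₂, he₂, h0₂⟩ := exists_isExtremal hl h₂ hH₂ h.2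
  obtain ⟨v, -, -, -, hv⟩ := exists_monomial (oddPrefix n l)
  rw [card_oddPrefix hl] at hv
  have hX : ∀ f : SuperPoly 0 n, IsExtremal l f → ∀ t ∈ oddPrefix n l, X (Sum.inr t) f = 0 := by
    rintro f hf ⟨j, t⟩ ht
    simp only [oddPrefix, Finset.mem_product, Finset.mem_filter, Finset.mem_singleton,
      Finset.mem_univ, true_and] at ht
    rw [ht.2]
    exact (hf j ht.1).1
  obtain ⟨c₁, hc₁⟩ := hv f₁ (mem_Harm.mp (hH₁ hf₁)).1 (hX f₁ he₁)
  obtain ⟨c₂, hc₂⟩ := hv f₂ (mem_Harm.mp (hH₂ hf₂)).1 (hX f₂ he₂)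
  have hc : c₁ ≠ 0 := fun h => h0₁ (by rw [hc₁, h, zero_smul])
  have hvU : v = c₁⁻¹ • f₁ := by rw [hc₁, inv_smul_smul₀ hc]
  have hm : f₂ ∈ U₁ ⊓ U₂ := ⟨by rw [hc₂, hvU]; exact U₁.smul_mem _ (U₁.smul_mem _ hf₁), hf₂⟩
  rw [hd, Submodule.mem_bot] at hm
  exact h0₂ hm

theorem Harm_zero_ne_bot {l : ℕ} (hl : l ≤ n) : Harm 0 n l ≠ ⊥ := by
  obtain ⟨v, hv0, hv, hD, -⟩ := exists_monomial (oddPrefix n l)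
  rw [card_oddPrefix hl] at hv
  refine fun h => hv0 ?_
  have : v ∈ Harm 0 n l := by
    refine mem_Harm.mpr ⟨hv, ?_⟩
    rw [lap_apply]
    have : ∀ j : Fin n, D (Sum.inr (j, 1)) v = 0 := fun j => hD _ (by simp [oddPrefix])
    simp [this]
  rwa [h] at this

/-! ### Nonvanishing and the final case distinction -/

theorem IsOspSubmodule.isActStable {U : Submodule ℝ (SuperPoly m n)} (h : IsOspSubmodule U) :
    IsActStable U := h.act_mem

theorem isOspSubmodule_Harm (m n l : ℕ) : IsOspSubmodule (Harm m n l) where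
  act_mem _ hA := mem_Harm_of_commute (euler_act _) (lap_act hA) l
  parity_mem := mem_Harm_of_commute (parity_euler m n) (parity_lap m n) l

theorem isOspSubmodule_GenHarm (m n l : ℕ) : IsOspSubmodule (GenHarm m n l) where
  act_mem _ hA := mem_GenHarm_of_commute (euler_act _) (lap_act hA) (Rsq_act hA) l
  parity_mem := mem_GenHarm_of_commute (parity_euler m n) (parity_lap m n) (parity_Rsq m n) l

theorem Harm_le_GenHarm (m n l : ℕ) : Harm m n l ≤ GenHarm m n l := fun f hf => by
  obtain ⟨h1, h2⟩ := mem_Harm.mp hf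
  exact mem_GenHarm.mpr ⟨h1, by rw [h2, map_zero, map_zero]⟩

theorem Harm_succ_ne_bot_of_mem {l : ℕ} {g : SuperPoly m n} (hg : euler m n g = (l : ℝ) • g)
    (h0 : g ≠ 0) : Harm (m + 1) n l ≠ ⊥ := by
  intro h
  have : ck 0 l g ∈ Harm (m + 1) n l :=
    mem_Harm.mpr ⟨by rw [euler_ck hg, Nat.cast_zero, add_zero],
      lap_ck_eq_zero hg (by omega) le_rfl⟩
  rw [h, Submodule.mem_bot] at this
  exact h0 (by rw [← res_ck_zero l g, this, map_zero])

theorem lastPow_ne_zero (m n l : ℕ) : lastPow m n l ≠ 0 := by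
  induction l with
  | zero => exact one_ne_zero'
  | succ l ih =>
    intro h
    rw [lastPow, pow_succ', Module.End.mul_apply] at h
    exact ih (X_last_injective h)

theorem Harm_add_two_ne_bot (m n l : ℕ) : Harm (m + 2) n l ≠ ⊥ :=
  Harm_succ_ne_bot_of_mem (euler_lastPow l) (lastPow_ne_zero m n l)

/-- Extend a fermionic monomial of degree ℓ as boundary value if ℓ ≤ 2n; for ℓ = 2n + 1 use the top
monomial as normal derivative. -/
theorem Harm_one_ne_bot {l : ℕ} (hl : l ≤ 2 * n + 1) : Harm 1 n l ≠ ⊥ := by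
  have hcard : (Finset.univ : Finset (Fin n × Fin 2)).card = 2 * n := by simp [mul_comm]
  rcases Nat.lt_succ_iff_lt_or_eq.mp (Nat.lt_succ_of_le hl) with h | h
  · obtain ⟨S, -, hS⟩ := Finset.exists_subset_card_eq
      (s := (Finset.univ : Finset (Fin n × Fin 2))) (n := l) (by omega)
    obtain ⟨v, hv0, hv, -⟩ := exists_monomial S
    rw [hS] at hv
    exact Harm_succ_ne_bot_of_mem hv hv0
  · obtain ⟨v, hv0, hv, -⟩ := exists_monomial (Finset.univ : Finset (Fin n × Fin 2))
    rw [hcard] at hv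
    intro hb
    have : ck 1 l v ∈ Harm 1 n l :=
      mem_Harm.mpr ⟨by rw [euler_ck hv, h]; push_cast; rfl,
        lap_ck_eq_zero hv le_rfl (by rw [h]; push_cast; linarith)⟩
    rw [hb, Submodule.mem_bot] at this
    exact hv0 (by rw [← res_D_ck_one l v, this, map_zero, map_zero])

/-- Both Cauchy data are fermionic of degree at least ℓ - 1 > 2n. -/
theorem Harm_one_eq_bot {l : ℕ} (hl : 2 * n + 1 < l) : Harm 1 n l = ⊥ := by
  rw [eq_bot_iff]
  intro f hf
  obtain ⟨h1, h2⟩ := mem_Harm.mp hf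
  refine eq_zero_of_lap_of_res h2 ?_ ?_
  · exact eq_zero_of_two_mul_lt (a := l) (by omega) (by rw [euler_res, h1, map_smul])
  · refine eq_zero_of_two_mul_lt (a := l - 1) (by omega) ?_
    rw [euler_res, euler_D_of h1, map_smul, Nat.cast_sub (by omega), Nat.cast_one]

/-- The generalized eigenspaces of the Casimir operator on `𝒫_ℓ(ℝ^{m+1|2n})` are indecomposable. -/
theorem eq_bot_or_eq_bot_of_casEigen {l : ℕ} {c : ℝ} (hml : m = 1 → l ≤ 2 * n)
    {U₁ U₂ : Submodule ℝ (SuperPoly (m + 1) n)} (h₁ : IsActStable U₁) (h₂ : IsActStable U₂)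
    (hW : U₁ ⊔ U₂ = casEigen (m + 1) n l c) (hd : U₁ ⊓ U₂ = ⊥) : U₁ = ⊥ ∨ U₂ = ⊥ := by
  refine eq_bot_or_eq_bot_of_invariants (fun a ha h hE hinv => ?_) h₁ h₂ hW hd
  -- The critical degree 2 - M of the hyperplane is 2n + 2 in ℝ^{0|2n}, beyond the top degree 2n; in
  -- ℝ^{1|2n} it is 2n + 1, beyond ℓ by assumption; with two or more bosonic variables it is
  -- harmless.
  rcases m with _ | _ | m
  · refine isRsqPow_of_isInvariant (Q := fun _ => True) (fun _ _ => trivial)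
      (fun b _ _ hb g hg _ _ => ?_) hE hinv trivial
    rw [eq_zero_of_two_mul_lt (by simp only [superdim] at hb; omega) hg]
    exact isRsqPow_zero b
  · have := hml rfl
    exact isRsqPow_of_lt (by simp only [superdim]; push_cast; omega) hE hinv
  · exact isRsqPow_of_two_le hE hinv

/-- The pair containing ℓ has sum 2n + 1 - m. For m = 0 this is odd, so there are no exceptional
indices; in the plane, m = 1, it gives ℓ ≤ 2n, as the general argument needs. -/
theorem isIndecomposable_GenHarm {k l : ℕ} (hl : l ∈ tildeB (superdim (m + 2) n) k) :
    IsIndecomposable (GenHarm (m + 1) n l) := by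
  have hW : GenHarm (m + 1) n l = casEigen (m + 1) n l (cas (m + 1) n l) :=
    Submodule.ext fun f => mem_GenHarm_of_mem_tildeB hl
  obtain ⟨-, q, hq, hpar, h⟩ := mem_tildeB_iff.mp hl
  simp only [superdim] at h
  refine ⟨isOspSubmodule_GenHarm _ _ _, ?_, fun U₁ U₂ h₁ h₂ hU hd => ?_⟩
  · rcases m with _ | m
    · push_cast at h; omega
    · exact fun hb => Harm_add_two_ne_bot m n l (eq_bot_iff.mpr (hb ▸ Harm_le_GenHarm _ _ _))
  · refine eq_bot_or_eq_bot_of_casEigen (fun hm => ?_) h₁.isActStable h₂.isActStable (hU.trans hW) hd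
    subst hm
    push_cast at h
    omega

/-- A regular ℋ_ℓ is a full generalized eigenspace, so the general argument applies except in the
plane with ℓ > 2n, where z^ℓ replaces it. -/
theorem isIndecomposable_Harm {k l : ℕ} (hl : l ∈ regularB (superdim (m + 2) n) k)
    (h0 : m = 0 → l ≤ 2 * n + 1) : IsIndecomposable (Harm (m + 1) n l) := by
  have hW : Harm (m + 1) n l = casEigen (m + 1) n l (cas (m + 1) n l) :=
    Submodule.ext fun f => mem_Harm_of_mem_regularB hl
  refine ⟨isOspSubmodule_Harm _ _ _, ?_, fun U₁ U₂ h₁ h₂ hU hd => ?_⟩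
  · rcases m with _ | m
    · exact Harm_one_ne_bot (h0 rfl)
    · exact Harm_add_two_ne_bot m n l
  · by_cases hm : m = 1 ∧ 2 * n < l
    · obtain ⟨rfl, hnl⟩ := hm
      exact eq_bot_or_eq_bot_of_plane hnl h₁.isActStable h₂.isActStable (hU ▸ le_sup_left)
        (hU ▸ le_sup_right) hd
    · exact eq_bot_or_eq_bot_of_casEigen (fun h => by omega) h₁.isActStable h₂.isActStable
        (hU.trans hW) hd

theorem isIndecomposable_Harm_zero {l : ℕ} (hl : l ≤ n) : IsIndecomposable (Harm 0 n l) :=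
  ⟨isOspSubmodule_Harm _ _ _, Harm_zero_ne_bot hl, fun _ _ h₁ h₂ hU hd =>
    eq_bot_or_eq_bot_of_fermionic hl h₁.isActStable h₂.isActStable (hU ▸ le_sup_left)
      (hU ▸ le_sup_right) hd⟩

end SuperHarmonic

end

theorem theorem2 (m n k : ℕ) :
    -- `ℋ_k(ℝ^{m+1|2n}) ≃ ⨁ ℋ̃_ℓ(ℝ^{m|2n}) ⊕ ⨁ ℋ_ℓ(ℝ^{m|2n})` as modules over `𝔬𝔰𝔭(m|2n)`
    (∃ e : Harm (m + 1) n k ≃ₗ[ℝ]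
        HarmSum m n (tildeB (superdim (m + 1) n) k) (regularB (superdim (m + 1) n) k),
      (∀ (A : osp m n) (f : Harm (m + 1) n k),
        e (harmAct k (ospIncl A) f) = harmSumAct _ _ A (e f)) ∧
      (∀ f : Harm (m + 1) n k,
        e (harmParity (m + 1) n k f) = harmSumParity m n _ _ (e f))) ∧
    -- the summands are indecomposable, apart from those that vanish for `m = 0` and `m = 1`
    (∀ ℓ ∈ tildeB (superdim (m + 1) n) k,
      if m = 0 then GenHarm m n ℓ = ⊥ else IsIndecomposable (GenHarm m n ℓ)) ∧
    (∀ ℓ ∈ regularB (superdim (m + 1) n) k,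
      if (m = 0 ∧ n < ℓ) ∨ (m = 1 ∧ 2 * n + 1 < ℓ) then Harm m n ℓ = ⊥
      else IsIndecomposable (Harm m n ℓ)) := by
  refine ⟨exists_decomposition m n k, fun ℓ hℓ => ?_, fun ℓ hℓ => ?_⟩
  · rcases m with _ | m
    · rw [if_pos rfl]
      exact GenHarm_zero_eq_bot hℓ
    · rw [if_neg (Nat.succ_ne_zero m)]
      exact isIndecomposable_GenHarm hℓ
  · rcases m with _ | m
    · by_cases h : n < ℓ
      · rw [if_pos (Or.inl ⟨rfl, h⟩)]
        exact Harm_zero_eq_bot h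
      · rw [if_neg (by omega)]
        exact isIndecomposable_Harm_zero (not_lt.mp h)
    · by_cases h : m = 0 ∧ 2 * n + 1 < ℓ
      · rw [if_pos (Or.inr ⟨by omega, h.2⟩)]
        obtain ⟨rfl, h⟩ := h
        exact Harm_one_eq_bot h
      · rw [if_neg (by omega)]
        exact isIndecomposable_Harm hℓ (by omega)
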